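/- Let $(R,\mathfrak m,k)$ be a Gorenstein local ring of Krull dimension $d>0$ that is not regular. For a finitely generated $R$-module $N$, an MCM approximation of $N$ is a surjective homomorphism $p\colon X\to N$ with $X$ a maximal Cohen–Macaulay $R$-module and $\ker p$ of finite projective dimension; it is called minimal if every $\varphi\in\operatorname{End}_R(X)$ with $p\circ\varphi=p$ is an automorphism. Write $X_N$ for the module $X$ in a minimal MCM approximation of $N$ (unique up to isomorphism), and write $\Omega^n_A N$ for the $n$-th syzygy in the minimal free resolution of a finitely generated module $N$ over a Noetherian local ring $A$ (with $\Omega^0_A N=N$). Then: 1. There is an $R$-module $M$ of finite length and infinite projective dimension such that minimal MCM approximations of $M$ and of $\Omega_R^{d-1}k$ exist and $X_M\cong X_{\Omega_R^{d-1}k}$. 2. There is a system of parameters $x_1,\dots,x_d$ of $R$ with $x_i\notin\mathfrak m^2+(x_1,\dots,x_{i-1})$ for all $i=1,\dots,d$. For every such system of parameters, with $R'=R/(x_1,\dots,x_d)$, the $R$-module $M=\Omega^{d-1}_{R'}k$ has all the properties in 1. -/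

import Mathlib

universe u

open CategoryTheory IsLocalRing

/-- A Gorenstein local ring: a Noetherian local ring of finite injective dimension over itself. -/
class IsGorensteinLocalRing (R : Type u) [CommRing R] : Prop
    extends IsLocalRing R, IsNoetherianRing R where
  injectiveDimension_ne_top : injectiveDimension (ModuleCat.of R R) ≠ ⊤

/-- `x₁, …, x_d` is a system of parameters of the local ring `R`: here `d = dim R`, the `x_i` lie
in the maximal ideal, and they generate an ideal primary to the maximal ideal. -/
structure IsSystemOfParameters (R : Type u) [CommRing R] [IsLocalRing R] {d : ℕ}
    (x : Fin d → R) : Prop where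
  dim_eq : ringKrullDim R = d
  mem : ∀ i, x i ∈ maximalIdeal R
  radical_eq : (Ideal.span (Set.range x)).radical = maximalIdeal R

/-- The first syzygy of `M`: the kernel of the map from the free module on a generating set of
minimal cardinality onto `M`. For a finitely generated module over a local ring, this is the
kernel of a minimal free cover. -/
noncomputable def firstSyzygy (R : Type u) [CommRing R] (M : ModuleCat.{u} R) :
    ModuleCat.{u} R :=
  ModuleCat.of R (LinearMap.ker (Finsupp.linearCombination R
    (Subtype.val : (⊤ : Submodule R M).generators → M)))

/-- The `n`-th syzygy of `M` in its minimal free resolution, with `syzygy R 0 M = M`. -/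
noncomputable def syzygy (R : Type u) [CommRing R] : ℕ → ModuleCat.{u} R → ModuleCat.{u} R
  | 0, M => M
  | n + 1, M => syzygy R n (firstSyzygy R M)

/-- The depth of a finitely generated module over a Noetherian local ring: the supremum of the
lengths of regular sequences on `M` in the maximal ideal. For `M ≠ 0` finitely generated, a weakly
regular sequence in the maximal ideal is regular by Nakayama; for `M = 0` this gives the usual
convention `depth 0 = ∞`. -/
noncomputable def moduleDepth (R : Type u) [CommRing R] [IsLocalRing R]
    (M : Type u) [AddCommGroup M] [Module R M] : ℕ∞ :=
  ⨆ (rs : List R) (_ : (∀ r ∈ rs, r ∈ maximalIdeal R) ∧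
    RingTheory.Sequence.IsWeaklyRegular M rs), (rs.length : ℕ∞)

/-- Maximal Cohen-Macaulay modules: finitely generated with `depth M ≥ dim R` (that is, `M = 0` or
`depth M = dim R`). -/
structure IsMaximalCohenMacaulay (R : Type u) [CommRing R] [IsLocalRing R]
    (M : Type u) [AddCommGroup M] [Module R M] : Prop where
  finite : Module.Finite R M
  dim_le_depth : ringKrullDim R ≤ (moduleDepth R M : WithBot ℕ∞)

/-- `p : X → M` is an MCM approximation of `M`: `X` is maximal Cohen-Macaulay, `p` is surjective,
and the kernel of `p` has finite projective dimension. -/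
structure IsMCMApproximation {R : Type u} [CommRing R] [IsLocalRing R]
    {X M : ModuleCat.{u} R} (p : X →ₗ[R] M) : Prop where
  isMCM : IsMaximalCohenMacaulay R X
  surjective : Function.Surjective p
  projectiveDimension_ker_ne_top :
    projectiveDimension (ModuleCat.of R (LinearMap.ker p)) ≠ ⊤

/-- An MCM approximation `p : X → M` is minimal if every endomorphism `φ` of `X` with `p ∘ φ = p`
is an automorphism. -/
structure IsMinimalMCMApproximation {R : Type u} [CommRing R] [IsLocalRing R]
    {X M : ModuleCat.{u} R} (p : X →ₗ[R] M) : Prop extends IsMCMApproximation p where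
  minimal : ∀ φ : X →ₗ[R] X, p ∘ₗ φ = p → Function.Bijective φ

/-- `X_M ≅ X_N`: minimal MCM approximations of `M` and of `N` exist, and the maximal
Cohen-Macaulay modules in any two such approximations are isomorphic. -/
def IsoMinimalMCM {R : Type u} [CommRing R] [IsLocalRing R] (M N : ModuleCat.{u} R) : Prop :=
  (∃ (X : ModuleCat.{u} R) (p : X →ₗ[R] M), IsMinimalMCMApproximation p) ∧
  (∃ (Y : ModuleCat.{u} R) (q : Y →ₗ[R] N), IsMinimalMCMApproximation q) ∧
  ∀ (X Y : ModuleCat.{u} R) (p : X →ₗ[R] M) (q : Y →ₗ[R] N),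
    IsMinimalMCMApproximation p → IsMinimalMCMApproximation q → Nonempty (X ≃ₗ[R] Y)

/-- The `n`-th syzygy over `R' = R/I` of the residue field `k`, viewed as an `R`-module. For an
ideal `I` contained in the maximal ideal `𝔪` of `R`, the residue field is `R'/𝔪R'`. -/
noncomputable def quotientResidueSyzygy (R : Type u) [CommRing R] [IsLocalRing R] (I : Ideal R)
    (n : ℕ) : ModuleCat.{u} R :=
  (ModuleCat.restrictScalars (Ideal.Quotient.mk I)).obj
    (syzygy (R ⧸ I) n
      (ModuleCat.of (R ⧸ I) ((R ⧸ I) ⧸ (maximalIdeal R).map (Ideal.Quotient.mk I))))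

/-!
The module `X_N`, for `N = Ω_R^{d-1} k`, has no free direct summand: this is the vanishing of the
delta invariant of `N` over a nonregular Gorenstein ring (`not_surjective_of_minimal_syzygy`). Hence
a minimal approximation `X → N` stays minimal after composition with any surjection `N → M` whose
kernel has finite projective dimension, because over a Gorenstein ring an approximation `X → M` is
minimal as soon as no linear form on `X` takes the value `1` on its kernel
(`bijective_of_comp_eq`). So `X_M ≅ X_N` for all such `M`, and `M` has infinite projective dimension,
since otherwise `X_M` would be free (`IsGorensteinSequence.isoMinimalMCM`).

For `M = Ω_{R'}^{d-1} k` such a surjection comes from the decomposition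
`Ω_R^{n+1} k / x ≅ Ω_{R/x}^{n+1} k ⊕ Ω_{R/x}^n k` for a regular element `x ∈ 𝔪 ∖ 𝔪²`
(`splitsModulo_syzygy_residueField`), which follows from `𝔪/x𝔪 ≅ 𝔪/xR ⊕ k` by passing to syzygies.
The projection of `Ω_R^n k` to the first summand has a kernel of finite projective dimension, and
these projections compose along the given system of parameters, which is a regular sequence because
`R` is Cohen–Macaulay (`IsMinimalRegularSystem.exists_syzygy_map`,
`IsGorensteinSequence.isWeaklyRegular_of_isSystemOfParameters`).

The same decomposition gives Dutta's theorem that a nonregular ring has no syzygy `Ω_R^n k` with a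
free direct summand (`isRegularLocalRing_of_surjective`), by induction on the dimension: a surjection
onto `R` induces one from a summand over `R/x` onto `R/x`. The delta invariant vanishes by Dutta's
theorem and the cyclicity of `Ext^1(N, R) ≅ Ext^d(k, R) ≅ k`: the kernel of a minimal approximation
`X → N` is zero or free on one element `y`, every `b ∈ 𝔪` is the value at `y` of a linear form, and if
there were a surjective form on `X`, a suitable choice of forms would produce a surjection `N → R`, or
`N → R/b` for some regular `b ∈ 𝔪 ∖ 𝔪²`.

Approximations exist because a maximal regular sequence `rs` makes `R/rs` self-injective: finite
modules over it embed in free ones, and passing to syzygies adds one regular element at a time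
(`IsGorensteinSequence.hasApprox`, `HasApprox.ker`). The finite injective dimension of `R` enters
through the properties collected in `IsGorensteinSequence`.
-/

open Abelian RingTheory.Sequence Pointwise

/-! ### Long exact sequences of Ext for unbundled modules -/

section ExtToolbox

variable {R : Type u} [CommRing R]
variable {A B C N M Y : Type u} [AddCommGroup A] [Module R A] [AddCommGroup B] [Module R B]
  [AddCommGroup C] [Module R C] [AddCommGroup N] [Module R N] [AddCommGroup M] [Module R M]
  [AddCommGroup Y] [Module R Y]

/-- The `R`-module `Ext^i(N, M)`, for unbundled modules. -/
abbrev ExtMod (R : Type u) [CommRing R] (N M : Type u) [AddCommGroup N] [Module R N]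
    [AddCommGroup M] [Module R M] (i : ℕ) : Type u :=
  Ext (ModuleCat.of R N) (ModuleCat.of R M) i

/-- The short exact sequence of `ModuleCat R` attached to an exact pair of linear maps. -/
lemma shortExact_of_exact {f : A →ₗ[R] B} {g : B →ₗ[R] C} (hf : Function.Injective f)
    (hfg : Function.Exact f g) (hg : Function.Surjective g) :
    (ModuleCat.shortComplexOfCompEqZero f g hfg.linearMap_comp_eq_zero).ShortExact :=
  ModuleCat.shortComplex_shortExact _ hfg hf hg

lemma ext_middle_of_left_right {f : A →ₗ[R] B} {g : B →ₗ[R] C} (hf : Function.Injective f)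
    (hfg : Function.Exact f g) (hg : Function.Surjective g) {i : ℕ}
    (hA : Subsingleton (ExtMod R A Y i)) (hC : Subsingleton (ExtMod R C Y i)) :
    Subsingleton (ExtMod R B Y i) := by
  refine subsingleton_of_forall_eq 0 fun e ↦ ?_
  obtain ⟨e', rfl⟩ := Ext.contravariant_sequence_exact₂ (shortExact_of_exact hf hfg hg) _ e
    (Subsingleton.elim (α := ExtMod R A Y i) _ _)
  rw [Subsingleton.elim (α := ExtMod R C Y i) e' 0, Ext.comp_zero]

lemma ext_left_of_middle_right {f : A →ₗ[R] B} {g : B →ₗ[R] C} (hf : Function.Injective f)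
    (hfg : Function.Exact f g) (hg : Function.Surjective g) {i : ℕ}
    (hB : Subsingleton (ExtMod R B Y i)) (hC : Subsingleton (ExtMod R C Y (i + 1))) :
    Subsingleton (ExtMod R A Y i) := by
  refine subsingleton_of_forall_eq 0 fun e ↦ ?_
  obtain ⟨e', rfl⟩ := Ext.contravariant_sequence_exact₁ (shortExact_of_exact hf hfg hg) _ e
    (add_comm 1 i) (Subsingleton.elim (α := ExtMod R C Y (i + 1)) _ _)
  rw [Subsingleton.elim (α := ExtMod R B Y i) e' 0, Ext.comp_zero]

lemma ext_right_of_left_middle {f : A →ₗ[R] B} {g : B →ₗ[R] C} (hf : Function.Injective f)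
    (hfg : Function.Exact f g) (hg : Function.Surjective g) {i : ℕ}
    (hA : Subsingleton (ExtMod R A Y i)) (hB : Subsingleton (ExtMod R B Y (i + 1))) :
    Subsingleton (ExtMod R C Y (i + 1)) := by
  refine subsingleton_of_forall_eq 0 fun e ↦ ?_
  obtain ⟨e', rfl⟩ := Ext.contravariant_sequence_exact₃ (shortExact_of_exact hf hfg hg) _ e
    (Subsingleton.elim (α := ExtMod R B Y (i + 1)) _ _) (add_comm 1 i)
  rw [Subsingleton.elim (α := ExtMod R A Y i) e' 0, Ext.comp_zero]

lemma ext_covariant_middle {f : A →ₗ[R] B} {g : B →ₗ[R] C} (hf : Function.Injective f)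
    (hfg : Function.Exact f g) (hg : Function.Surjective g) {i : ℕ}
    (hA : Subsingleton (ExtMod R N A i)) (hC : Subsingleton (ExtMod R N C i)) :
    Subsingleton (ExtMod R N B i) := by
  refine subsingleton_of_forall_eq 0 fun e ↦ ?_
  obtain ⟨e', rfl⟩ := Ext.covariant_sequence_exact₂ _ (shortExact_of_exact hf hfg hg) e
    (Subsingleton.elim (α := ExtMod R N C i) _ _)
  rw [Subsingleton.elim (α := ExtMod R N A i) e' 0, Ext.zero_comp]

lemma ext_covariant_right {f : A →ₗ[R] B} {g : B →ₗ[R] C} (hf : Function.Injective f)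
    (hfg : Function.Exact f g) (hg : Function.Surjective g) {i : ℕ}
    (hA : Subsingleton (ExtMod R N A (i + 1))) (hB : Subsingleton (ExtMod R N B i)) :
    Subsingleton (ExtMod R N C i) := by
  refine subsingleton_of_forall_eq 0 fun e ↦ ?_
  obtain ⟨e', rfl⟩ := Ext.covariant_sequence_exact₃ _ (shortExact_of_exact hf hfg hg) e rfl
    (Subsingleton.elim (α := ExtMod R N A (i + 1)) _ _)
  rw [Subsingleton.elim (α := ExtMod R N B i) e' 0, Ext.zero_comp]

lemma ext_zero_subsingleton_iff : Subsingleton (ExtMod R N M 0) ↔ Subsingleton (N →ₗ[R] M) :=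
  ((Ext.linearEquiv₀ (R := R)).trans ModuleCat.homLinearEquiv).toEquiv.subsingleton_congr

lemma ext_of_projective [Module.Projective R N] (i : ℕ) :
    Subsingleton (ExtMod R N M (i + 1)) := by
  have : Projective (ModuleCat.of R N) := (IsProjective.iff_projective N).mp ‹_›
  exact Ext.subsingleton_of_projective _ _ _

lemma ext_congr_left (e : A ≃ₗ[R] B) {i : ℕ} (h : Subsingleton (ExtMod R A Y i)) :
    Subsingleton (ExtMod R B Y i) := by
  refine subsingleton_of_forall_eq 0 fun x ↦ ?_
  rw [← x.mk₀_id_comp, ← e.toModuleIso.inv_hom_id, ← Ext.mk₀_comp_mk₀,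
    Ext.comp_assoc_of_second_deg_zero,
    Subsingleton.elim (α := ExtMod R A Y i) ((Ext.mk₀ e.toModuleIso.hom).comp x (zero_add i)) 0,
    Ext.comp_zero]

lemma ext_congr_right (e : A ≃ₗ[R] B) {i : ℕ} (h : Subsingleton (ExtMod R N A i)) :
    Subsingleton (ExtMod R N B i) := by
  refine subsingleton_of_forall_eq 0 fun x ↦ ?_
  rw [← x.comp_mk₀_id, ← e.toModuleIso.inv_hom_id, ← Ext.mk₀_comp_mk₀,
    ← Ext.comp_assoc_of_third_deg_zero,
    Subsingleton.elim (α := ExtMod R N A i) (x.comp (Ext.mk₀ e.toModuleIso.inv) (add_zero i)) 0,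
    Ext.zero_comp]

/-- If `Ext¹(X, ker g) = 0`, every map from `X` to the target of a surjection `g` lifts. -/
lemma exists_lift_of_ext_one {g : B →ₗ[R] C} (hg : Function.Surjective g)
    (h : Subsingleton (ExtMod R N (LinearMap.ker g) 1)) (a : N →ₗ[R] C) :
    ∃ b : N →ₗ[R] B, g ∘ₗ b = a := by
  obtain ⟨b, hb⟩ := Ext.covariant_sequence_exact₃ (ModuleCat.of R N)
    (LinearMap.shortExact_shortComplexKer hg) (Ext.mk₀ (ModuleCat.ofHom a)) (zero_add 1)
    (Subsingleton.elim (α := ExtMod R N (LinearMap.ker g) 1) _ _)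
  obtain ⟨b, rfl⟩ := (Ext.mk₀_bijective _ _).2 b
  rw [Ext.mk₀_comp_mk₀, (Ext.mk₀_bijective _ _).1.eq_iff] at hb
  exact ⟨b.hom, by simpa using congrArg ModuleCat.Hom.hom hb⟩

lemma exact_lsmul_mkQ (x : R) :
    Function.Exact (LinearMap.lsmul R M x) (x • (⊤ : Submodule R M)).mkQ :=
  LinearMap.exact_lsmul_mkQ_smul_top M x

lemma lsmul_injective_of_isSMulRegular {x : R} (h : IsSMulRegular M x) :
    Function.Injective (LinearMap.lsmul R M x) := h

lemma mk₀_lsmul_comp (x : R) {i : ℕ} (e : ExtMod R N Y i) :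
    (Ext.mk₀ (ModuleCat.ofHom (LinearMap.lsmul R N x))).comp e (zero_add i) = x • e := by
  have h : ModuleCat.ofHom (LinearMap.lsmul R N x) = x • 𝟙 (ModuleCat.of R N) := rfl
  rw [h, Ext.mk₀_smul, Ext.smul_comp, Ext.mk₀_id_comp]

lemma comp_mk₀_lsmul (x : R) {i : ℕ} (e : ExtMod R N M i) :
    e.comp (Ext.mk₀ (ModuleCat.ofHom (LinearMap.lsmul R M x))) (add_zero i) = x • e := by
  have h : ModuleCat.ofHom (LinearMap.lsmul R M x) = x • 𝟙 (ModuleCat.of R M) := rfl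
  rw [h, Ext.mk₀_smul, Ext.comp_smul, Ext.comp_mk₀_id]

lemma shortExact_quotSMulTop {x : R} (h : IsSMulRegular M x) :
    (ModuleCat.shortComplexOfCompEqZero (LinearMap.lsmul R M x) (x • (⊤ : Submodule R M)).mkQ
      (exact_lsmul_mkQ x).linearMap_comp_eq_zero).ShortExact :=
  shortExact_of_exact (lsmul_injective_of_isSMulRegular h) (exact_lsmul_mkQ x)
    (Submodule.mkQ_surjective _)

/-- If the equation `x e' = e` can always be solved in `Ext^i(N, Y)` for some `x` in the maximal
ideal, then `Ext^i(N, Y) = 0` by Nakayama's lemma. -/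
lemma ext_subsingleton_of_smul_surjective [IsLocalRing R] [IsNoetherianRing R] [Module.Finite R N]
    [Module.Finite R Y] {x : R} (hx : x ∈ maximalIdeal R) {i : ℕ}
    (h : ∀ e : ExtMod R N Y i, ∃ e' : ExtMod R N Y i, x • e' = e) :
    Subsingleton (ExtMod R N Y i) := by
  by_contra! ntr
  have : x ∈ (Module.annihilator R (ExtMod R N Y i)).jacobson :=
    (IsLocalRing.maximalIdeal_le_jacobson _) hx
  apply Submodule.top_ne_pointwise_smul_of_mem_jacobson_annihilator this
  rw [eq_comm, eq_top_iff]
  intro y _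
  obtain ⟨z, rfl⟩ := h y
  exact Submodule.smul_mem_pointwise_smul _ _ ⊤ trivial

/-- For `x ∈ 𝔪` acting injectively on `N` through an exact sequence `0 → N → N → C → 0`,
vanishing of `Ext^{i+1}(C, Y)` forces vanishing of `Ext^i(N, Y)`. -/
lemma ext_subsingleton_of_quotient [IsLocalRing R] [IsNoetherianRing R] [Module.Finite R N]
    [Module.Finite R Y] {x : R} (hx : x ∈ maximalIdeal R) (hreg : IsSMulRegular N x) {i : ℕ}
    (h : Subsingleton (ExtMod R (QuotSMulTop x N) Y (i + 1))) :
    Subsingleton (ExtMod R N Y i) := by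
  refine ext_subsingleton_of_smul_surjective hx fun e ↦ ?_
  obtain ⟨e', he'⟩ := Ext.contravariant_sequence_exact₁
    (shortExact_quotSMulTop hreg) _ e
    (add_comm 1 i) (Subsingleton.elim (α := ExtMod R (QuotSMulTop x N) Y (i + 1)) _ _)
  exact ⟨e', (mk₀_lsmul_comp x e').symm.trans he'⟩

/-- Multiplication by `x` on `Ext^i(N, M)` is zero if `x` kills `N`. -/
lemma ext_smul_eq_zero {x : R} (hx : ∀ n : N, x • n = 0) {i : ℕ} (e : ExtMod R N M i) :
    x • e = 0 := by
  have h0 : x • 𝟙 (ModuleCat.of R N) = 0 := by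
    ext n
    exact hx n
  calc x • e = x • ((Ext.mk₀ (𝟙 (ModuleCat.of R N))).comp e (zero_add i)) := by
        rw [Ext.mk₀_id_comp]
    _ = (Ext.mk₀ (x • 𝟙 (ModuleCat.of R N))).comp e (zero_add i) := by
        rw [Ext.mk₀_smul, Ext.smul_comp]
    _ = 0 := by rw [h0, Ext.mk₀_zero, Ext.zero_comp]

/-- Rees: if `N` is killed by an `M`-regular sequence of length `> i`, then `Ext^i(N, M) = 0`. -/
lemma ext_subsingleton_of_isWeaklyRegular (rs : List R) (hreg : IsWeaklyRegular M rs)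
    (hN : ∀ r ∈ rs, ∀ n : N, r • n = 0) {i : ℕ} (hi : i < rs.length) :
    Subsingleton (ExtMod R N M i) := by
  induction rs generalizing M i with
  | nil => simp at hi
  | cons r rs ih =>
    rw [isWeaklyRegular_cons_iff] at hreg
    have hr : ∀ n : N, r • n = 0 := hN r (by simp)
    rcases i with _ | i
    · rw [ext_zero_subsingleton_iff]
      exact hreg.1.linearMap_subsingleton_of_mem_annihilator (Module.mem_annihilator.mpr hr)
    · have h := ih hreg.2 (fun s hs ↦ hN s (by simp [hs])) (by simpa using hi)
      refine subsingleton_of_forall_eq 0 fun e ↦ ?_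
      obtain ⟨e', rfl⟩ := Ext.covariant_sequence_exact₁ _
        (shortExact_quotSMulTop hreg.1) e
        ((comp_mk₀_lsmul r e).trans (ext_smul_eq_zero hr e)) rfl
      rw [Subsingleton.elim (α := ExtMod R N (QuotSMulTop r M) i) e' 0, Ext.zero_comp]

end ExtToolbox

/-! ### Modules of finite projective dimension -/

section FinPD

/-- The module `M` has finite projective dimension. -/
def FinPD (R : Type u) [CommRing R] (M : Type u) [AddCommGroup M] [Module R M] : Prop :=
  projectiveDimension (ModuleCat.of R M) ≠ ⊤

variable {R : Type u} [CommRing R]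
variable {A B C : Type u} [AddCommGroup A] [Module R A] [AddCommGroup B] [Module R B]
  [AddCommGroup C] [Module R C]

lemma finPD_iff : FinPD R A ↔ ∃ n, HasProjectiveDimensionLT (ModuleCat.of R A) n := by
  rw [FinPD, projectiveDimension_ne_top_iff]
  refine ⟨fun ⟨n, h⟩ ↦ ⟨n + 1, h⟩, fun ⟨n, h⟩ ↦ ⟨n, ?_⟩⟩
  exact hasProjectiveDimensionLT_of_ge _ n (n + 1) (by lia)

lemma FinPD.of_projective [Module.Projective R A] : FinPD R A := by
  have : Projective (ModuleCat.of R A) := (IsProjective.iff_projective A).mp ‹_›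
  exact finPD_iff.mpr ⟨1, inferInstance⟩

lemma FinPD.of_subsingleton [Subsingleton A] : FinPD R A :=
  FinPD.of_projective

lemma FinPD.congr (e : A ≃ₗ[R] B) (h : FinPD R A) : FinPD R B := by
  obtain ⟨n, hn⟩ := finPD_iff.mp h
  exact finPD_iff.mpr ⟨n, hasProjectiveDimensionLT_of_iso e.toModuleIso n⟩

/-- A direct summand of a module of finite projective dimension has finite projective dimension. -/
lemma FinPD.of_retract (i : A →ₗ[R] B) (r : B →ₗ[R] A) (hri : r ∘ₗ i = LinearMap.id)
    (h : FinPD R B) : FinPD R A := by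
  obtain ⟨n, hn⟩ := finPD_iff.mp h
  have ret : Retract (ModuleCat.of R A) (ModuleCat.of R B) :=
    { i := ModuleCat.ofHom i
      r := ModuleCat.ofHom r
      retract := by rw [← ModuleCat.ofHom_comp, hri]; rfl }
  exact finPD_iff.mpr ⟨n, ret.hasProjectiveDimensionLT n⟩

variable {f : A →ₗ[R] B} {g : B →ₗ[R] C}

lemma FinPD.middle (hf : Function.Injective f) (hfg : Function.Exact f g)
    (hg : Function.Surjective g) (hA : FinPD R A) (hC : FinPD R C) : FinPD R B := by
  obtain ⟨a, ha⟩ := finPD_iff.mp hA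
  obtain ⟨c, hc⟩ := finPD_iff.mp hC
  refine finPD_iff.mpr ⟨a + c, ?_⟩
  refine (shortExact_of_exact hf hfg hg).hasProjectiveDimensionLT_X₂ (a + c) ?_ ?_
  · exact hasProjectiveDimensionLT_of_ge (ModuleCat.of R A) a _ (by lia)
  · exact hasProjectiveDimensionLT_of_ge (ModuleCat.of R C) c _ (by lia)

lemma FinPD.right (hf : Function.Injective f) (hfg : Function.Exact f g)
    (hg : Function.Surjective g) (hA : FinPD R A) (hB : FinPD R B) : FinPD R C := by
  obtain ⟨a, ha⟩ := finPD_iff.mp hA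
  obtain ⟨c, hc⟩ := finPD_iff.mp hB
  refine finPD_iff.mpr ⟨a + c + 1, ?_⟩
  refine (shortExact_of_exact hf hfg hg).hasProjectiveDimensionLT_X₃ (a + c) ?_ ?_
  · exact hasProjectiveDimensionLT_of_ge (ModuleCat.of R A) a _ (by lia)
  · exact hasProjectiveDimensionLT_of_ge (ModuleCat.of R B) c _ (by lia)

lemma FinPD.left (hf : Function.Injective f) (hfg : Function.Exact f g)
    (hg : Function.Surjective g) (hB : FinPD R B) (hC : FinPD R C) : FinPD R A := by
  obtain ⟨a, ha⟩ := finPD_iff.mp hB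
  obtain ⟨c, hc⟩ := finPD_iff.mp hC
  refine finPD_iff.mpr ⟨a + c, ?_⟩
  refine (shortExact_of_exact hf hfg hg).hasProjectiveDimensionLT_X₁ (a + c) ?_ ?_
  · exact hasProjectiveDimensionLT_of_ge (ModuleCat.of R B) a _ (by lia)
  · exact hasProjectiveDimensionLT_of_ge (ModuleCat.of R C) c _ (by lia)

lemma FinPD.prod (hA : FinPD R A) (hB : FinPD R B) : FinPD R (A × B) :=
  FinPD.middle LinearMap.inl_injective Function.Exact.inl_snd LinearMap.snd_surjective hA hB

/-- The kernel of a surjection between modules of finite projective dimension. -/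
lemma FinPD.ker (hg : Function.Surjective g) (hB : FinPD R B) (hC : FinPD R C) :
    FinPD R (LinearMap.ker g) :=
  FinPD.left (Submodule.injective_subtype _) (LinearMap.exact_subtype_ker_map g) hg hB hC

/-- A module has finite projective dimension if it surjects onto one with kernel of finite
projective dimension. -/
lemma FinPD.of_ker (hg : Function.Surjective g) (hA : FinPD R (LinearMap.ker g)) (hC : FinPD R C) :
    FinPD R B :=
  FinPD.middle (Submodule.injective_subtype _) (LinearMap.exact_subtype_ker_map g) hg hA hC

lemma FinPD.quotient_of_isWeaklyRegular [IsLocalRing R] [IsNoetherianRing R] [Module.Finite R A]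
    (rs : List R) (hreg : IsWeaklyRegular A rs) (h : FinPD R A) :
    FinPD R (A ⧸ (Ideal.ofList rs • ⊤ : Submodule R A)) := by
  induction rs generalizing A with
  | nil =>
    refine h.congr (Submodule.quotEquivOfEqBot _ ?_).symm
    rw [Ideal.ofList_nil, Submodule.bot_smul]
  | cons r rs ih =>
    rw [isWeaklyRegular_cons_iff] at hreg
    refine (ih hreg.2 ?_).congr (Submodule.quotOfListConsSMulTopEquivQuotSMulTopInner A r rs).symm
    exact FinPD.right (lsmul_injective_of_isSMulRegular hreg.1) (exact_lsmul_mkQ r)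
      (Submodule.mkQ_surjective _) h h

end FinPD

/-! ### Maximal regular sequences in Gorenstein rings -/

section GorensteinRings

variable {R : Type u} [CommRing R]
variable {N M Y : Type u} [AddCommGroup N] [Module R N] [AddCommGroup M] [Module R M]
  [AddCommGroup Y] [Module R Y]

/-- The `R`-module `M` is generated by one element. -/
def IsCyclicModule (R : Type u) [CommRing R] (M : Type u) [AddCommGroup M] [Module R M] : Prop :=
  ∃ e : M, ∀ y : M, ∃ r : R, r • e = y

lemma IsCyclicModule.of_surjective (h : IsCyclicModule R M) (f : M →ₗ[R] N)
    (hf : Function.Surjective f) : IsCyclicModule R N := by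
  obtain ⟨e, he⟩ := h
  refine ⟨f e, fun y ↦ ?_⟩
  obtain ⟨x, rfl⟩ := hf y
  obtain ⟨r, rfl⟩ := he x
  exact ⟨r, (map_smul f r e).symm⟩

lemma mk₀_inv_comp_mk₀_hom_comp (e : M ≃ₗ[R] N) {i : ℕ} (x : ExtMod R N Y i) :
    (Ext.mk₀ e.toModuleIso.inv).comp ((Ext.mk₀ e.toModuleIso.hom).comp x (zero_add i))
      (zero_add i) = x := by
  rw [← Ext.comp_assoc_of_second_deg_zero, Ext.mk₀_comp_mk₀, e.toModuleIso.inv_hom_id,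
    Ext.mk₀_id_comp]

lemma ext_of_subsingleton [Subsingleton N] (i : ℕ) : Subsingleton (ExtMod R N Y i) :=
  subsingleton_of_forall_eq 0 fun e ↦ by
    simpa using ext_smul_eq_zero (x := (1 : R)) (fun n ↦ Subsingleton.elim _ _) e

lemma ext_of_subsingleton_right [Subsingleton Y] (i : ℕ) : Subsingleton (ExtMod R N Y i) :=
  subsingleton_of_forall_eq 0 fun e ↦ by
    have h : ModuleCat.ofHom (LinearMap.lsmul R Y 1) = 0 :=
      ModuleCat.hom_ext (LinearMap.ext fun x ↦ Subsingleton.elim _ _)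
    rw [← one_smul R e, ← comp_mk₀_lsmul, h, Ext.mk₀_zero, Ext.comp_zero]

/-- `Ext^0` is `Hom`. -/
noncomputable def extZeroEquiv (R : Type u) [CommRing R] (N M : Type u) [AddCommGroup N]
    [Module R N] [AddCommGroup M] [Module R M] : ExtMod R N M 0 ≃ₗ[R] (N →ₗ[R] M) :=
  (Ext.linearEquiv₀ (R := R)).trans ModuleCat.homLinearEquiv

instance isSimpleModule_residueField [IsLocalRing R] : IsSimpleModule R (ResidueField R) :=
  isSimpleModule_iff_isCoatom.mpr (maximalIdeal.isMaximal R).out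

/-- Dividing by a regular element raises by one the highest degree in which `Ext(-, Y)` may be
nonzero, and keeps the top `Ext` cyclic. -/
lemma ext_quotient_isWeaklyRegular (rs : List R) (hreg : IsWeaklyRegular M rs) (j : ℕ)
    (hvan : ∀ i > j, Subsingleton (ExtMod R M Y i)) (hcyc : IsCyclicModule R (ExtMod R M Y j)) :
    (∀ i > j + rs.length,
      Subsingleton (ExtMod R (M ⧸ (Ideal.ofList rs • ⊤ : Submodule R M)) Y i)) ∧
    IsCyclicModule R
      (ExtMod R (M ⧸ (Ideal.ofList rs • ⊤ : Submodule R M)) Y (j + rs.length)) := by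
  induction rs generalizing M j with
  | nil =>
    let e : M ≃ₗ[R] M ⧸ (Ideal.ofList ([] : List R) • ⊤ : Submodule R M) :=
      (Submodule.quotEquivOfEqBot _ (by rw [Ideal.ofList_nil, Submodule.bot_smul])).symm
    refine ⟨fun i hi ↦ ext_congr_left e (hvan i hi), ?_⟩
    refine hcyc.of_surjective
      ((Ext.mk₀ e.toModuleIso.inv).precompOfLinear R (ModuleCat.of R Y) (zero_add j)) fun x ↦ ?_
    exact ⟨_, mk₀_inv_comp_mk₀_hom_comp e x⟩
  | cons r rs ih =>
    rw [isWeaklyRegular_cons_iff] at hreg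
    have hS := shortExact_quotSMulTop hreg.1
    have h1 : ∀ i > j + 1, Subsingleton (ExtMod R (QuotSMulTop r M) Y i) := by
      rintro (_ | i) hi
      · simp at hi
      · exact ext_right_of_left_middle (lsmul_injective_of_isSMulRegular hreg.1)
          (exact_lsmul_mkQ r) (Submodule.mkQ_surjective _) (hvan i (by lia)) (hvan _ (by lia))
    have h2 : IsCyclicModule R (ExtMod R (QuotSMulTop r M) Y (j + 1)) := by
      refine hcyc.of_surjective
        (hS.extClass.precompOfLinear R (ModuleCat.of R Y) (add_comm 1 j)) fun x ↦ ?_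
      have := hvan (j + 1) (by lia)
      exact Ext.contravariant_sequence_exact₃ hS _ x
        (Subsingleton.elim (α := ExtMod R M Y (j + 1)) _ _) (add_comm 1 j)
    obtain ⟨h3, h4⟩ := ih hreg.2 (j + 1) h1 h2
    let e := (Submodule.quotOfListConsSMulTopEquivQuotSMulTopInner M r rs).symm
    have hlen : j + (r :: rs).length = j + 1 + rs.length := by simp; ring
    rw [hlen]
    refine ⟨fun i hi ↦ ext_congr_left e (h3 i hi), ?_⟩
    refine h4.of_surjective
      ((Ext.mk₀ e.toModuleIso.inv).precompOfLinear R (ModuleCat.of R Y) (zero_add _)) fun x ↦ ?_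
    exact ⟨_, mk₀_inv_comp_mk₀_hom_comp e x⟩

lemma isSMulRegular_quotient_prime {p : Ideal R} [hp : p.IsPrime] {y : R} (hy : y ∉ p) :
    IsSMulRegular (R ⧸ p) y := by
  rw [isSMulRegular_iff_right_eq_zero_of_smul]
  intro a ha
  obtain ⟨a, rfl⟩ := Ideal.Quotient.mk_surjective a
  rw [Algebra.smul_def, Ideal.Quotient.algebraMap_eq, ← map_mul,
    Ideal.Quotient.eq_zero_iff_mem] at ha
  exact Ideal.Quotient.eq_zero_iff_mem.mpr ((hp.mem_or_mem ha).resolve_left hy)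

section Local

variable [IsLocalRing R] [IsNoetherianRing R]

/-- If `Ext^{n+1}(-, Y)` vanishes on finite modules, then vanishing of `Ext^n(-, Y)` on finite
modules is detected by the residue field: for a prime `p ≠ 𝔪`, multiplication by an element of
`𝔪 ∖ p` is surjective on `Ext^n(R/p, Y)`, which is therefore zero. -/
lemma ext_subsingleton_of_residueField {n : ℕ} [Module.Finite R Y]
    (hvan : ∀ (N : Type u) [AddCommGroup N] [Module R N] [Module.Finite R N],
      Subsingleton (ExtMod R N Y (n + 1)))
    (hk : Subsingleton (ExtMod R (ResidueField R) Y n))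
    (N : Type u) [AddCommGroup N] [Module R N] [hfin : Module.Finite R N] :
    Subsingleton (ExtMod R N Y n) := by
  induction hfin using IsNoetherianRing.induction_on_isQuotientEquivQuotientPrime with
  | subsingleton N => exact ext_of_subsingleton n
  | quotient N p e =>
    by_cases hp : p.1 = maximalIdeal R
    · exact ext_congr_left (e.trans (Submodule.quotEquivOfEq _ _ hp)).symm hk
    · obtain ⟨y, hy, hyp⟩ := SetLike.exists_of_lt
        (lt_of_le_of_ne (le_maximalIdeal p.2.ne_top) hp)
      exact ext_congr_left e.symm
        (ext_subsingleton_of_quotient hy (isSMulRegular_quotient_prime hyp) (hvan _))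
  | exact N₁ N₂ N₃ f g hf hg hfg h₁ h₃ => exact ext_middle_of_left_right hf hfg hg h₁ h₃

omit [IsNoetherianRing R] in
lemma maximalIdeal_smul_residueField {r : R} (hr : r ∈ maximalIdeal R) (n : ResidueField R) :
    r • n = 0 := by
  rw [Algebra.smul_def, ResidueField.algebraMap_eq, (residue_eq_zero_iff r).mpr hr, zero_mul]

lemma ringKrullDim_quotient_ofList {rs : List R} (hmem : ∀ r ∈ rs, r ∈ maximalIdeal R)
    (hreg : IsWeaklyRegular R rs) :
    ringKrullDim (R ⧸ Ideal.ofList rs) + rs.length = ringKrullDim R :=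
  ringKrullDim_add_length_eq_ringKrullDim_of_isRegular rs
    ((IsLocalRing.isRegular_iff_isWeaklyRegular_of_subset_maximalIdeal hmem).mpr hreg)

lemma length_le_ringKrullDim {rs : List R} (hmem : ∀ r ∈ rs, r ∈ maximalIdeal R)
    (hreg : IsWeaklyRegular R rs) : (rs.length : WithBot ℕ∞) ≤ ringKrullDim R := by
  rw [← ringKrullDim_quotient_ofList hmem hreg]
  have : Nontrivial (R ⧸ Ideal.ofList rs) := Ideal.Quotient.nontrivial_iff.mpr
    (ne_top_of_le_ne_top (maximalIdeal.isMaximal R).ne_top (Ideal.span_le.mpr hmem))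
  exact le_add_of_nonneg_left ringKrullDim_nonneg_of_nontrivial

/-- A regular sequence in the maximal ideal modulo which no element of the maximal ideal is
regular: the residue field embeds in the quotient. -/
lemma exists_maximal_isWeaklyRegular {d : ℕ} (hdim : ringKrullDim R = d) :
    ∃ rs : List R, (∀ r ∈ rs, r ∈ maximalIdeal R) ∧ IsWeaklyRegular R rs ∧
      ∃ f : ResidueField R →ₗ[R] R ⧸ (Ideal.ofList rs • ⊤ : Submodule R R),
        Function.Injective f := by
  by_contra! hcon
  have key : ∀ t : ℕ, ∃ rs : List R, rs.length = t ∧ (∀ r ∈ rs, r ∈ maximalIdeal R) ∧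
      IsWeaklyRegular R rs := by
    intro t
    induction t with
    | zero => exact ⟨[], rfl, by simp, .nil R R⟩
    | succ t ih =>
      obtain ⟨rs, hlen, hmem, hreg⟩ := ih
      have hsub : Subsingleton
          (ResidueField R →ₗ[R] R ⧸ (Ideal.ofList rs • ⊤ : Submodule R R)) :=
        subsingleton_of_forall_eq 0 fun f ↦
          (LinearMap.injective_or_eq_zero f).resolve_left (hcon rs hmem hreg f)
      obtain ⟨r, hr, hrreg⟩ := IsSMulRegular.subsingleton_linearMap_iff.mp hsub
      have hr' : r ∈ maximalIdeal R := by
        have h1 := Module.mem_annihilator.mp hr 1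
        rwa [Algebra.smul_def, mul_one, ResidueField.algebraMap_eq, residue_eq_zero_iff] at h1
      refine ⟨rs ++ [r], by simp [hlen], ?_, ?_⟩
      · intro s hs
        rcases List.mem_append.mp hs with h | h
        · exact hmem s h
        · rwa [List.mem_singleton.mp h]
      · rw [isWeaklyRegular_append_iff, isWeaklyRegular_singleton_iff]
        exact ⟨hreg, hrreg⟩
  obtain ⟨rs, hlen, hmem, hreg⟩ := key (d + 1)
  have h1 := length_le_ringKrullDim hmem hreg
  rw [hlen, hdim] at h1
  exact absurd (Nat.cast_le.mp h1) (by lia)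

/-- The homological properties of a maximal regular sequence `rs` in a Gorenstein local ring:
`R` has injective dimension at most `rs.length` with respect to finite modules, `rs` generates an
`𝔪`-primary ideal, and `Ext^{rs.length}(k, R)` is cyclic. -/
structure IsGorensteinSequence (R : Type u) [CommRing R] [IsLocalRing R] (rs : List R) :
    Prop where
  mem : ∀ r ∈ rs, r ∈ maximalIdeal R
  isWeaklyRegular : IsWeaklyRegular R rs
  exists_injective : ∃ f : ResidueField R →ₗ[R] R ⧸ (Ideal.ofList rs • ⊤ : Submodule R R),
    Function.Injective f
  ext_subsingleton : ∀ i > rs.length, ∀ (N : Type u) [AddCommGroup N] [Module R N]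
    [Module.Finite R N], Subsingleton (ExtMod R N R i)
  isCyclic : IsCyclicModule R (ExtMod R (ResidueField R) R rs.length)
  eq_maximalIdeal : ∀ p : Ideal R, p.IsPrime → Ideal.ofList rs ≤ p → p = maximalIdeal R

/-- The largest `n` with `Ext^n(k, R) ≠ 0` bounds the degrees in which `Ext(-, R)` may be nonzero on
finite modules. -/
lemma exists_ext_vanishing_bound (R : Type u) [CommRing R] [IsGorensteinLocalRing R] :
    ∃ n : ℕ, (∀ i > n, ∀ (N : Type u) [AddCommGroup N] [Module R N] [Module.Finite R N],
      Subsingleton (ExtMod R N R i)) ∧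
      ¬ Subsingleton (ExtMod R (ResidueField R) R n) := by
  classical
  let P : ℕ → Prop := fun n ↦ ∀ i ≥ n, ∀ (N : Type u) [AddCommGroup N] [Module R N]
    [Module.Finite R N], Subsingleton (ExtMod R N R i)
  have hex : ∃ n, P n := by
    obtain ⟨n, hn⟩ := (injectiveDimension_ne_top_iff _).mp
      (IsGorensteinLocalRing.injectiveDimension_ne_top (R := R))
    exact ⟨n + 1, fun i hi N _ _ _ ↦
      HasInjectiveDimensionLT.subsingleton (ModuleCat.of R R) (n + 1) i hi (ModuleCat.of R N)⟩
  have h0 : Nat.find hex ≠ 0 := by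
    intro h
    have h1 := Nat.find_spec hex 0 h.le R
    rw [ext_zero_subsingleton_iff] at h1
    exact one_ne_zero (α := R)
      (LinearMap.congr_fun (Subsingleton.elim (LinearMap.id : R →ₗ[R] R) 0) (1 : R))
  obtain ⟨n, hn⟩ := Nat.exists_eq_succ_of_ne_zero h0
  have hspec : P (n + 1) := by
    have := Nat.find_spec hex
    rwa [hn] at this
  refine ⟨n, fun i hi ↦ hspec i hi, fun hk ↦ ?_⟩
  have : P n := by
    intro i hi N _ _ _
    rcases eq_or_lt_of_le hi with rfl | hi
    · exact ext_subsingleton_of_residueField (fun N _ _ _ ↦ hspec (n + 1) le_rfl N) hk N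
    · exact hspec i hi N
  exact Nat.find_min hex (by lia) this

theorem exists_isGorensteinSequence (R : Type u) [CommRing R] [IsGorensteinLocalRing R] {d : ℕ}
    (hdim : ringKrullDim R = d) : ∃ rs : List R, IsGorensteinSequence R rs := by
  obtain ⟨rs, hmem, hreg, f, hf⟩ := exists_maximal_isWeaklyRegular hdim
  obtain ⟨n, hvan, hne⟩ := exists_ext_vanishing_bound R
  -- the Koszul estimate: `R/rs` has projective dimension `rs.length`
  obtain ⟨hA, hcyc⟩ := ext_quotient_isWeaklyRegular (Y := R) rs hreg 0
    (fun i hi ↦ by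
      obtain ⟨j, rfl⟩ := Nat.exists_eq_succ_of_ne_zero hi.ne'
      exact ext_of_projective j)
    (by
      refine IsCyclicModule.of_surjective (M := R) ⟨(1 : R), fun y ↦ ⟨y, by simp⟩⟩
        (((extZeroEquiv R R R).trans (LinearMap.ringLmapEquivSelf R R R)).symm.toLinearMap)
        (LinearEquiv.surjective _))
  rw [zero_add] at hA hcyc
  -- `Ext^n(R/rs, R) → Ext^n(k, R)` is surjective for `n` the injective dimension
  have hn : n ≤ rs.length := by
    by_contra! h
    exact hne (ext_left_of_middle_right hf (LinearMap.exact_map_mkQ_range f)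
      (Submodule.mkQ_surjective _) (hA n h) (hvan (n + 1) (by lia) _))
  have hn' : rs.length ≤ n := by
    by_contra! h
    exact hne (ext_subsingleton_of_isWeaklyRegular rs hreg
      (fun r hr x ↦ maximalIdeal_smul_residueField (hmem r hr) x) h)
  obtain rfl : n = rs.length := le_antisymm hn hn'
  refine ⟨rs, hmem, hreg, ⟨f, hf⟩, hvan, ?_, ?_⟩
  · have hS := shortExact_of_exact hf (LinearMap.exact_map_mkQ_range f) (Submodule.mkQ_surjective _)
    refine hcyc.of_surjective ((Ext.mk₀ (ModuleCat.ofHom f)).precompOfLinear R (ModuleCat.of R R)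
      (zero_add _)) fun x ↦ ?_
    have := hvan (rs.length + 1) (by lia) (_ ⧸ LinearMap.range f)
    exact Ext.contravariant_sequence_exact₁ hS _ x (add_comm 1 _)
      (Subsingleton.elim (α := ExtMod R (_ ⧸ LinearMap.range f) R (rs.length + 1)) _ _)
  · intro p hp hle
    by_contra hpm
    obtain ⟨y, hy, hyp⟩ := SetLike.exists_of_lt (lt_of_le_of_ne (le_maximalIdeal hp.ne_top) hpm)
    have h1 : Subsingleton (ExtMod R (R ⧸ p) R rs.length) :=
      ext_subsingleton_of_quotient hy (isSMulRegular_quotient_prime hyp)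
        (hvan _ (by lia) _)
    -- the surjection `R/p → k` induces an injection on `Ext^{rs.length}(-, R)`
    let g : R ⧸ p →ₗ[R] ResidueField R := Submodule.factor (le_maximalIdeal hp.ne_top)
    have hg : Function.Surjective g := Submodule.factor_surjective _
    have hker : ∀ r ∈ rs, ∀ z : LinearMap.ker g, r • z = 0 := by
      intro r hr z
      obtain ⟨z, hz⟩ := z
      obtain ⟨a, rfl⟩ := Ideal.Quotient.mk_surjective z
      ext
      change r • (Ideal.Quotient.mk p a) = 0
      rw [Algebra.smul_def, Ideal.Quotient.algebraMap_eq, ← map_mul,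
        Ideal.Quotient.eq_zero_iff_mem]
      exact p.mul_mem_right _ (hle (Ideal.subset_span hr))
    rcases hl : rs.length with _ | l
    · rw [hl, ext_zero_subsingleton_iff] at h1
      refine hne ?_
      rw [hl, ext_zero_subsingleton_iff]
      refine subsingleton_of_forall_eq 0 fun φ ↦ ?_
      have h2 : φ ∘ₗ g = 0 := Subsingleton.elim _ _
      ext x
      obtain ⟨x, rfl⟩ := hg x
      exact LinearMap.congr_fun h2 x
    · refine hne ?_
      rw [hl] at h1 ⊢
      exact ext_right_of_left_middle (Submodule.injective_subtype _)
        (LinearMap.exact_subtype_ker_map g) hg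
        (ext_subsingleton_of_isWeaklyRegular rs hreg hker (by lia)) h1

end Local

end GorensteinRings

/-! ### Vanishing of Ext for maximal Cohen–Macaulay modules -/

section MaximalCohenMacaulay

variable {R : Type u} [CommRing R]
variable {N M X Y : Type u} [AddCommGroup N] [Module R N] [AddCommGroup M] [Module R M]
  [AddCommGroup X] [Module R X] [AddCommGroup Y] [Module R Y]

variable [IsLocalRing R] [IsNoetherianRing R] {rs : List R}

omit [IsNoetherianRing R] in
lemma krullDimLE_zero_of_surjective {A : Type*} [CommRing A] (f : R →+* A)
    (hf : Function.Surjective f)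
    (h : ∀ p : Ideal R, p.IsPrime → RingHom.ker f ≤ p → p = maximalIdeal R) :
    Ring.KrullDimLE 0 A := by
  refine Ring.krullDimLE_zero_iff.mpr fun P hP ↦ ?_
  have h1 := h (P.comap f) inferInstance (Ideal.comap_mono bot_le)
  have h2 : P = (maximalIdeal R).map f := by rw [← h1, Ideal.map_comap_of_surjective _ hf]
  rw [h2]
  exact (Ideal.map_eq_top_or_isMaximal_of_surjective _ hf
    (maximalIdeal.isMaximal R)).resolve_left fun h3 ↦ hP.ne_top (h2.trans h3)

omit [IsNoetherianRing R] in
lemma IsGorensteinSequence.krullDimLE_zero (h : IsGorensteinSequence R rs) :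
    Ring.KrullDimLE 0 (R ⧸ Ideal.ofList rs) :=
  krullDimLE_zero_of_surjective (Ideal.Quotient.mk _) Ideal.Quotient.mk_surjective fun p hp hle ↦
    h.eq_maximalIdeal p hp (Ideal.mk_ker.symm.trans_le hle)

lemma IsGorensteinSequence.length_eq (h : IsGorensteinSequence R rs) :
    ringKrullDim R = rs.length := by
  have : Nontrivial (R ⧸ Ideal.ofList rs) := Ideal.Quotient.nontrivial_iff.mpr
    (ne_top_of_le_ne_top (maximalIdeal.isMaximal R).ne_top (Ideal.span_le.mpr h.mem))
  have := h.krullDimLE_zero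
  rw [← ringKrullDim_quotient_ofList h.mem h.isWeaklyRegular,
    ringKrullDimZero_iff_ringKrullDim_eq_zero.mp this, zero_add]

omit [IsLocalRing R] [IsNoetherianRing R] in
/-- `Hom(N, M/rs M)` embeds in `Ext^{rs.length}(N, M)` if the `M`-regular sequence `rs` kills
`N`. -/
lemma exists_injective_hom_quotient_ext (rs : List R) (hreg : IsWeaklyRegular M rs)
    (hN : ∀ r ∈ rs, ∀ n : N, r • n = 0) :
    ∃ f : (N →ₗ[R] M ⧸ (Ideal.ofList rs • ⊤ : Submodule R M)) →ₗ[R] ExtMod R N M rs.length,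
      Function.Injective f := by
  induction rs generalizing M with
  | nil =>
    let e : M ≃ₗ[R] M ⧸ (Ideal.ofList ([] : List R) • ⊤ : Submodule R M) :=
      (Submodule.quotEquivOfEqBot _ (by rw [Ideal.ofList_nil, Submodule.bot_smul])).symm
    exact ⟨((LinearEquiv.congrRight e.symm).trans (extZeroEquiv R N M).symm).toLinearMap,
      LinearEquiv.injective _⟩
  | cons r rs ih =>
    have hreg' := (isWeaklyRegular_cons_iff M r rs).mp hreg
    obtain ⟨f, hf⟩ := ih hreg'.2 (fun s hs ↦ hN s (by simp [hs]))
    let e := Submodule.quotOfListConsSMulTopEquivQuotSMulTopInner M r rs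
    let f₀ : (N →ₗ[R] M ⧸ (Ideal.ofList (r :: rs) • ⊤ : Submodule R M)) ≃ₗ[R] _ :=
      LinearEquiv.congrRight e
    let f₂ := (shortExact_quotSMulTop hreg'.1).extClass.postcompOfLinear R (ModuleCat.of R N)
      (rfl : rs.length + 1 = rs.length + 1)
    have hf₂ : Function.Injective f₂ := by
      refine (injective_iff_map_eq_zero f₂).mpr fun x hx ↦ ?_
      obtain ⟨y, rfl⟩ := Ext.covariant_sequence_exact₃ _ (shortExact_quotSMulTop hreg'.1) x rfl hx
      have := ext_subsingleton_of_isWeaklyRegular (r :: rs) hreg hN (i := rs.length) (by simp)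
      rw [Subsingleton.elim (α := ExtMod R N M rs.length) y 0, Ext.zero_comp]
    exact ⟨f₂ ∘ₗ f ∘ₗ f₀.toLinearMap, hf₂.comp (hf.comp f₀.injective)⟩

omit [IsNoetherianRing R] in
lemma exists_residueField_map_one_eq {s : M} (hs : ∀ r ∈ maximalIdeal R, r • s = 0) :
    ∃ ψ : ResidueField R →ₗ[R] M, ψ 1 = s :=
  ⟨Submodule.liftQ (maximalIdeal R) (LinearMap.toSpanSingleton R M s) fun r hr ↦ hs r hr,
    (Submodule.liftQ_apply (maximalIdeal R) (LinearMap.toSpanSingleton R M s) (1 : R)).trans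
      (one_smul R s)⟩

omit [IsNoetherianRing R] in
/-- The socle of the Artinian ring `R/rs` is simple. -/
lemma IsGorensteinSequence.exists_socle (h : IsGorensteinSequence R rs) :
    ∃ s : R ⧸ Ideal.ofList rs, s ≠ 0 ∧ (∀ r ∈ maximalIdeal R, r • s = 0) ∧
      ∀ s' : R ⧸ Ideal.ofList rs, (∀ r ∈ maximalIdeal R, r • s' = 0) → ∃ r : R, r • s = s' := by
  let E : (R ⧸ (Ideal.ofList rs • ⊤ : Submodule R R)) ≃ₗ[R] R ⧸ Ideal.ofList rs :=
    Submodule.quotEquivOfEq _ _ (by rw [smul_eq_mul, Ideal.mul_top])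
  obtain ⟨φ, hφ⟩ := h.exists_injective
  obtain ⟨j, hj⟩ := exists_injective_hom_quotient_ext (N := ResidueField R) rs h.isWeaklyRegular
    (fun r hr n ↦ maximalIdeal_smul_residueField (h.mem r hr) n)
  refine ⟨E (φ 1), fun h0 ↦ one_ne_zero (hφ ((E.map_eq_zero_iff.mp h0).trans (map_zero φ).symm)),
    fun r hr ↦ ?_, ?_⟩
  · rw [← map_smul, ← map_smul, maximalIdeal_smul_residueField hr, map_zero, map_zero]
  · intro s' hs'
    obtain ⟨ψ, hψ⟩ := exists_residueField_map_one_eq (s := E.symm s') fun r hr ↦ by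
      rw [← map_smul, hs' r hr, map_zero]
    obtain ⟨e, he⟩ := h.isCyclic
    obtain ⟨a, ha⟩ := he (j φ)
    obtain ⟨b, hb⟩ := he (j ψ)
    -- `j φ = a e` is nonzero and `𝔪` kills `e`, so `a` is a unit
    have hu : IsUnit a := by
      by_contra hu
      have h0 : j φ = 0 := by
        rw [← ha]
        exact ext_smul_eq_zero (fun n ↦ maximalIdeal_smul_residueField hu n) e
      have h1 : φ = 0 := hj (h0.trans (map_zero j).symm)
      exact one_ne_zero (hφ (by rw [h1]; rfl) : (1 : ResidueField R) = 0)
    obtain ⟨u, rfl⟩ := hu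
    refine ⟨b * ↑u⁻¹, ?_⟩
    have h2 : (b * (↑u⁻¹ : R)) • φ = ψ := by
      apply hj
      rw [map_smul, ← ha, ← hb, smul_smul, mul_assoc, Units.inv_mul, mul_one]
    rw [← map_smul, ← LinearMap.smul_apply, h2, hψ, E.apply_symm_apply]

/-- Over a Gorenstein local ring, `Ext^i(X, R) = 0` for `i > 0` if `X` has a regular sequence of
length `dim R`. -/
lemma IsGorensteinSequence.ext_ring_subsingleton (h : IsGorensteinSequence R rs)
    [Module.Finite R X] {xs : List R} (hmem : ∀ x ∈ xs, x ∈ maximalIdeal R)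
    (hreg : IsWeaklyRegular X xs) {i : ℕ} (hi : rs.length < i + xs.length) :
    Subsingleton (ExtMod R X R i) := by
  induction xs generalizing X i with
  | nil => exact h.ext_subsingleton i (by simpa using hi) X
  | cons x xs ih =>
    rw [isWeaklyRegular_cons_iff] at hreg
    exact ext_subsingleton_of_quotient (hmem x (by simp)) hreg.1
      (ih (fun y hy ↦ hmem y (by simp [hy])) hreg.2 (by simp at hi; lia))

omit [IsNoetherianRing R] in
/-- The definition of depth as a supremum is attained at `dim R`. -/
lemma exists_isWeaklyRegular_of_isMaximalCohenMacaulay {d : ℕ} (hdim : ringKrullDim R = d)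
    (h : IsMaximalCohenMacaulay R X) :
    ∃ xs : List R, (∀ x ∈ xs, x ∈ maximalIdeal R) ∧ IsWeaklyRegular X xs ∧ d ≤ xs.length := by
  by_contra! hcon
  have h1 := h.dim_le_depth
  rw [hdim] at h1
  have h2 : (d : ℕ∞) ≤ moduleDepth R X := by exact_mod_cast h1
  rcases d with _ | d
  · exact absurd (hcon [] (by simp) (.nil R X)) (by simp)
  · have h3 : moduleDepth R X ≤ d := by
      refine iSup₂_le fun xs hxs ↦ ?_
      exact_mod_cast Nat.lt_succ_iff.mp (hcon xs hxs.1 hxs.2)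
    have := h2.trans h3
    norm_cast at this
    lia

lemma IsGorensteinSequence.ext_subsingleton_of_isMCM (h : IsGorensteinSequence R rs)
    (hX : IsMaximalCohenMacaulay R X) (i : ℕ) : Subsingleton (ExtMod R X R (i + 1)) := by
  have := hX.finite
  obtain ⟨xs, h1, h2, h3⟩ := exists_isWeaklyRegular_of_isMaximalCohenMacaulay h.length_eq hX
  exact h.ext_ring_subsingleton h1 h2 (by lia)

omit [IsLocalRing R] [IsNoetherianRing R] in
lemma isMaximalCohenMacaulay_of_isWeaklyRegular [IsLocalRing R] [Module.Finite R X]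
    (hdim : ringKrullDim R = rs.length)
    (hmem : ∀ x ∈ rs, x ∈ maximalIdeal R) (hreg : IsWeaklyRegular X rs) :
    IsMaximalCohenMacaulay R X := by
  refine ⟨inferInstance, ?_⟩
  rw [hdim]
  have : (rs.length : ℕ∞) ≤ moduleDepth R X := le_iSup₂_of_le rs ⟨hmem, hreg⟩ le_rfl
  exact_mod_cast this

omit [IsLocalRing R] in
/-- If `Ext^i(X, R) = 0` for all `i > 0`, then `Ext^i(X, V) = 0` for all `i > 0` and all finite `V`
of finite projective dimension. -/
lemma ext_subsingleton_of_finPD (hX : ∀ i, Subsingleton (ExtMod R X R (i + 1)))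
    [Module.Finite R Y] (hY : FinPD R Y) (i : ℕ) : Subsingleton (ExtMod R X Y (i + 1)) := by
  have hfree (n : ℕ) (i : ℕ) : Subsingleton (ExtMod R X (Fin n → R) (i + 1)) := by
    induction n with
    | zero =>
      exact ext_of_subsingleton_right (i + 1)
    | succ n ih =>
      refine ext_congr_right (Fin.consLinearEquiv R (fun _ ↦ R)) ?_
      exact ext_covariant_middle LinearMap.inl_injective Function.Exact.inl_snd
        LinearMap.snd_surjective (hX i) ih
  obtain ⟨n, hn⟩ := finPD_iff.mp hY
  induction n generalizing Y i with
  | zero =>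
    have h0 : 𝟙 (ModuleCat.of R Y) = 0 :=
      (Limits.IsZero.iff_id_eq_zero _).mp (isZero_of_hasProjectiveDimensionLT_zero _)
    exact subsingleton_of_forall_eq 0 fun e ↦ by
      rw [← e.comp_mk₀_id, h0, Ext.mk₀_zero, Ext.comp_zero]
  | succ n ih =>
    obtain ⟨m, f, hf⟩ := Module.Finite.exists_fin' R Y
    have hex := LinearMap.exact_subtype_ker_map f
    have hinj := Submodule.injective_subtype (LinearMap.ker f)
    rcases n with _ | n
    · -- `Y` is projective, hence a summand of `R^m`
      have : Projective (ModuleCat.of R Y) := inferInstance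
      have : Module.Projective R Y := (IsProjective.iff_projective Y).mpr this
      obtain ⟨s, hs⟩ := Module.projective_lifting_property f LinearMap.id hf
      refine subsingleton_of_forall_eq 0 fun e ↦ ?_
      have hid : 𝟙 (ModuleCat.of R Y) = ModuleCat.ofHom s ≫ ModuleCat.ofHom f := by
        rw [← ModuleCat.ofHom_comp, hs]; rfl
      have := hfree m i
      rw [← e.comp_mk₀_id, hid, ← Ext.mk₀_comp_mk₀, ← Ext.comp_assoc_of_third_deg_zero,
        Subsingleton.elim (α := ExtMod R X (Fin m → R) (i + 1))
          (e.comp (Ext.mk₀ (ModuleCat.ofHom s)) (add_zero _)) 0, Ext.zero_comp]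
    · have hk : HasProjectiveDimensionLT (ModuleCat.of R (LinearMap.ker f)) (n + 1) := by
        have : Projective (ModuleCat.of R (Fin m → R)) :=
          (IsProjective.iff_projective _).mp inferInstance
        exact ((shortExact_of_exact hinj hex hf).hasProjectiveDimensionLT_X₃_iff n this).mp hn
      exact ext_covariant_right hinj hex hf
        (ih (finPD_iff.mpr ⟨_, hk⟩) (i + 1) hk) (hfree m i)

omit [IsLocalRing R] in
/-- Maps from a module with `Ext^{>0}(X, R) = 0` lift along surjections whose kernel has finite
projective dimension. -/
lemma exists_lift_of_finPD (hX : ∀ i, Subsingleton (ExtMod R X R (i + 1)))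
    [Module.Finite R N] {g : N →ₗ[R] M} (hg : Function.Surjective g)
    (hk : FinPD R (LinearMap.ker g)) (a : X →ₗ[R] M) : ∃ b : X →ₗ[R] N, g ∘ₗ b = a :=
  exists_lift_of_ext_one hg (ext_subsingleton_of_finPD hX hk 0) a

omit [IsLocalRing R] in
/-- A finite module `X` of finite projective dimension with `Ext^{>0}(X, R) = 0` is projective. -/
lemma projective_of_finPD (hX : ∀ i, Subsingleton (ExtMod R X R (i + 1)))
    [Module.Finite R X] (hpd : FinPD R X) : Module.Projective R X := by
  obtain ⟨m, f, hf⟩ := Module.Finite.exists_fin' R X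
  obtain ⟨s, hs⟩ := exists_lift_of_finPD hX hf (FinPD.ker hf .of_projective hpd) LinearMap.id
  exact Module.Projective.of_split s f hs

end MaximalCohenMacaulay

/-! ### Artinian local rings with simple socle -/

section SelfInjective

lemma length_eq_add_range_of_exact {R M N P : Type*} [CommRing R] [AddCommGroup M] [Module R M]
    [AddCommGroup N] [Module R N] [AddCommGroup P] [Module R P] {f : M →ₗ[R] N} {g : N →ₗ[R] P}
    (hf : Function.Injective f) (hfg : Function.Exact f g) :
    Module.length R N = Module.length R M + Module.length R (LinearMap.range g) := by
  refine Module.length_eq_add_of_exact f g.rangeRestrict hf g.surjective_rangeRestrict ?_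
  rw [LinearMap.exact_iff, LinearMap.ker_rangeRestrict, ← LinearMap.exact_iff]
  exact hfg

variable {A : Type u} [CommRing A] [IsLocalRing A] [IsArtinianRing A]

/-- In an Artinian local ring with simple socle, dualizing does not increase the length. -/
lemma length_dual_le {s : A}
    (hs : ∀ s' : A, (∀ r ∈ maximalIdeal A, r • s' = 0) → ∃ r : A, r • s = s')
    (hs0 : ∀ r ∈ maximalIdeal A, r • s = 0)
    (M : Type u) [AddCommGroup M] [Module A M] [hM : Module.Finite A M] :
    Module.length A (M →ₗ[A] A) ≤ Module.length A M := by
  induction hM using IsNoetherianRing.induction_on_isQuotientEquivQuotientPrime with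
  | subsingleton N => rw [Module.length_eq_zero]; exact bot_le
  | quotient N p e =>
    have hp : p.1 = maximalIdeal A := IsLocalRing.eq_maximalIdeal inferInstance
    let e' : N ≃ₗ[A] ResidueField A := e.trans (Submodule.quotEquivOfEq _ _ hp)
    obtain ⟨ψ, hψ⟩ := exists_residueField_map_one_eq hs0
    -- evaluation at the generator embeds `Hom(k, A)` in the socle
    let ev : (N →ₗ[A] A) →ₗ[A] A := LinearMap.applyₗ (e'.symm 1)
    have hev : Function.Injective ev := by
      refine (injective_iff_map_eq_zero ev).mpr fun f hf ↦ ?_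
      ext n
      obtain ⟨a, ha⟩ := residue_surjective (e' n)
      have hn : n = a • e'.symm 1 := by
        rw [← map_smul, Algebra.smul_def, mul_one, ResidueField.algebraMap_eq, ha,
          e'.symm_apply_apply]
      rw [hn, map_smul, show f (e'.symm 1) = 0 from hf, smul_zero, LinearMap.zero_apply]
    have hmem : ∀ f, ev f ∈ LinearMap.range ψ := by
      intro f
      obtain ⟨r, hr⟩ := hs (ev f) fun r hr ↦ by
        change r • f (e'.symm 1) = 0
        rw [← map_smul, ← map_smul, maximalIdeal_smul_residueField hr, map_zero, map_zero]
      exact ⟨r • 1, by rw [map_smul, hψ, hr]⟩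
    calc Module.length A (N →ₗ[A] A)
        ≤ Module.length A (LinearMap.range ψ) :=
          Module.length_le_of_injective (ev.codRestrict _ hmem)
            (fun f g hfg ↦ hev (congrArg Subtype.val hfg))
      _ ≤ Module.length A (ResidueField A) :=
          Module.length_le_of_surjective ψ.rangeRestrict ψ.surjective_rangeRestrict
      _ = Module.length A N := e'.symm.length_eq
  | exact N₁ N₂ N₃ f g hf hg hfg h₁ h₃ =>
    have hex := LinearMap.exact_lcomp_of_exact_of_surjective A hfg hg
    have hinj := LinearMap.lcomp_injective_of_surjective (S := A) (N := A) g hg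
    rw [length_eq_add_range_of_exact hinj hex, Module.length_eq_add_of_exact f g hf hg hfg, add_comm]
    exact add_le_add ((Module.length_le_of_injective _ (Submodule.injective_subtype _)).trans h₁) h₃

/-- An Artinian local ring with simple socle is self-injective: for an ideal `I`, counting lengths
in `0 → Hom(A/I, A) → Hom(A, A) → Hom(I, A)` forces the last map to be surjective. -/
lemma baer_of_simple_socle {s : A}
    (hs : ∀ s' : A, (∀ r ∈ maximalIdeal A, r • s' = 0) → ∃ r : A, r • s = s')
    (hs0 : ∀ r ∈ maximalIdeal A, r • s = 0) : Module.Baer A A := by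
  intro I g
  let res : (A →ₗ[A] A) →ₗ[A] (I →ₗ[A] A) := LinearMap.lcomp A A I.subtype
  suffices h : LinearMap.range res = ⊤ by
    obtain ⟨g', hg'⟩ := LinearMap.range_eq_top.mp h g
    exact ⟨g', fun x hx ↦ LinearMap.congr_fun hg' ⟨x, hx⟩⟩
  have hex := LinearMap.exact_lcomp_of_exact_of_surjective A (LinearMap.exact_subtype_mkQ I)
    (Submodule.mkQ_surjective _)
  have hinj := LinearMap.lcomp_injective_of_surjective (S := A) (N := A) I.mkQ
    (Submodule.mkQ_surjective _)
  have h1 : Module.length A A =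
      Module.length A ((A ⧸ I) →ₗ[A] A) + Module.length A (LinearMap.range res) := by
    rw [← length_eq_add_range_of_exact hinj hex]
    exact (LinearMap.ringLmapEquivSelf A A A).length_eq.symm
  have h2 : Module.length A A = Module.length A I + Module.length A (A ⧸ I) :=
    Module.length_eq_add_of_exact I.subtype I.mkQ (Submodule.injective_subtype _)
      (Submodule.mkQ_surjective _) (LinearMap.exact_subtype_mkQ I)
  have h3 := length_dual_le hs hs0 (A ⧸ I)
  have h4 := length_dual_le hs hs0 I
  have hfin : ∀ (M : Type u) [AddCommGroup M] [Module A M] [Module.Finite A M],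
      Module.length A M ≠ ⊤ := fun M _ _ _ ↦ Module.length_ne_top
  have h5 : Module.length A I ≤ Module.length A (LinearMap.range res) := by
    rw [h1, add_comm] at h2
    have h6 := h2.ge.trans (add_le_add_right h3 (Module.length A (LinearMap.range res)))
    exact (ENat.add_le_add_iff_right (hfin _)).mp h6
  by_contra hne
  exact absurd (Submodule.length_lt hne) (not_lt.mpr (h4.trans h5))

/-- Finite modules over an Artinian local ring with simple socle embed in finite free modules. -/
theorem exists_injective_pi_of_simple_socle {s : A} (hne : s ≠ 0)
    (hs : ∀ s' : A, (∀ r ∈ maximalIdeal A, r • s' = 0) → ∃ r : A, r • s = s')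
    (hs0 : ∀ r ∈ maximalIdeal A, r • s = 0)
    (M : Type u) [AddCommGroup M] [Module A M] [Module.Finite A M] :
    ∃ (n : ℕ) (f : M →ₗ[A] Fin n → A), Function.Injective f := by
  have hbaer := baer_of_simple_socle hs hs0
  obtain ⟨ψ, hψ⟩ := exists_residueField_map_one_eq hs0
  have hsep : ∀ m : M, m ≠ 0 → ∃ φ : M →ₗ[A] A, φ m ≠ 0 := by
    intro m hm
    let q : A →ₗ[A] M := LinearMap.toSpanSingleton A M m
    -- `A m ≅ A / Ann(m)` surjects onto the residue field, which embeds as the socle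
    have hker : LinearMap.ker q ≤ maximalIdeal A := by
      refine le_maximalIdeal fun h ↦ hm ?_
      have : (1 : A) ∈ LinearMap.ker q := h ▸ Submodule.mem_top
      simpa [q] using this
    let θ : (A ⧸ LinearMap.ker q) →ₗ[A] A := ψ ∘ₗ Submodule.factor hker
    obtain ⟨φ, hφ⟩ := hbaer.extension_property (Submodule.liftQ _ q le_rfl)
      (LinearMap.ker_eq_bot.mp (Submodule.ker_liftQ_eq_bot _ _ _ le_rfl)) θ
    refine ⟨φ, fun h ↦ hne ?_⟩
    have h1 := LinearMap.congr_fun hφ (Submodule.Quotient.mk 1)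
    have h2 : (Submodule.liftQ (LinearMap.ker q) q le_rfl) (Submodule.Quotient.mk 1) = m :=
      (Submodule.liftQ_apply _ q (1 : A)).trans (one_smul A m)
    rw [LinearMap.comp_apply, h2, h] at h1
    exact hψ.symm.trans h1.symm
  let 𝒮 : Set (Submodule A M) := {K | ∃ (n : ℕ) (f : M →ₗ[A] Fin n → A), LinearMap.ker f = K}
  obtain ⟨K, ⟨n, f, rfl⟩, hmin⟩ := (wellFounded_lt (α := Submodule A M)).has_min 𝒮
    ⟨⊤, 0, 0, LinearMap.ker_zero⟩
  refine ⟨n, f, LinearMap.ker_eq_bot.mp ?_⟩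
  by_contra hK
  obtain ⟨m, hm, hm0⟩ := (Submodule.ne_bot_iff _).mp hK
  obtain ⟨φ, hφ⟩ := hsep m hm0
  let f' : M →ₗ[A] Fin (n + 1) → A := (Fin.consLinearEquiv A (fun _ ↦ A)).toLinearMap ∘ₗ φ.prod f
  have hker : LinearMap.ker f' = LinearMap.ker φ ⊓ LinearMap.ker f := by
    rw [LinearEquiv.ker_comp, LinearMap.ker_prod]
  refine hmin _ ⟨n + 1, f', rfl⟩ (lt_of_le_of_ne (hker ▸ inf_le_right) fun h ↦ hφ ?_)
  have : m ∈ LinearMap.ker f' := h ▸ hm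
  rw [hker] at this
  exact this.1

end SelfInjective

/-! ### Existence of maximal Cohen–Macaulay approximations -/

section Approximations

variable {R : Type u} [CommRing R]
variable {A B C F X : Type u} [AddCommGroup A] [Module R A] [AddCommGroup B] [Module R B]
  [AddCommGroup C] [Module R C] [AddCommGroup F] [Module R F] [AddCommGroup X] [Module R X]

/-- In `0 → A → B → C → 0` with `x` regular on `C`, the sequence stays exact modulo `x`. -/
lemma quotSMulTop_exact {f : A →ₗ[R] B} {g : B →ₗ[R] C} (hf : Function.Injective f)
    (hfg : Function.Exact f g) (hg : Function.Surjective g) {x : R} (hx : IsSMulRegular C x) :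
    Function.Injective (QuotSMulTop.map x f) ∧
      Function.Exact (QuotSMulTop.map x f) (QuotSMulTop.map x g) ∧
      Function.Surjective (QuotSMulTop.map x g) := by
  refine ⟨?_, QuotSMulTop.map_exact x hfg hg, QuotSMulTop.map_surjective x hg⟩
  refine (injective_iff_map_eq_zero _).mpr fun a ha ↦ ?_
  obtain ⟨a, rfl⟩ := Submodule.Quotient.mk_surjective _ a
  have ha' : f a ∈ x • (⊤ : Submodule R B) := (Submodule.Quotient.mk_eq_zero _).mp ha
  obtain ⟨b, -, hb⟩ := (Submodule.mem_smul_pointwise_iff_exists _ _ _).mp ha'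
  have hgb : g b = 0 := by
    refine (isSMulRegular_iff_right_eq_zero_of_smul.mp hx) _ ?_
    rw [← map_smul, hb, hfg.apply_apply_eq_zero]
  obtain ⟨a', rfl⟩ := (hfg b).mp hgb
  refine (Submodule.Quotient.mk_eq_zero _).mpr
    ((Submodule.mem_smul_pointwise_iff_exists _ _ _).mpr ⟨a', trivial, hf ?_⟩)
  rw [map_smul, hb]

/-- The depth lemma for a fixed sequence: if `rs` is regular on `B` and all of `rs` except
possibly its last element on `C`, then `rs` is regular on the kernel of a surjection `B → C`. -/
lemma isWeaklyRegular_of_exact (rs : List R) (j : ℕ) {f : A →ₗ[R] B} {g : B →ₗ[R] C}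
    (hf : Function.Injective f) (hfg : Function.Exact f g) (hg : Function.Surjective g)
    (hB : IsWeaklyRegular B rs) (hC : IsWeaklyRegular C (rs.take j)) :
    IsWeaklyRegular A (rs.take (j + 1)) := by
  induction rs generalizing A B C j with
  | nil => simp
  | cons r rs ih =>
    rw [isWeaklyRegular_cons_iff] at hB
    rw [List.take_succ_cons, isWeaklyRegular_cons_iff]
    have hr : IsSMulRegular A r := hB.1.of_injective f hf
    rcases j with _ | j
    · exact ⟨hr, by simp⟩
    · rw [List.take_succ_cons, isWeaklyRegular_cons_iff] at hC
      obtain ⟨h1, h2, h3⟩ := quotSMulTop_exact hf hfg hg hC.1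
      exact ⟨hr, ih j h1 h2 h3 hB.2 hC.2⟩

lemma isWeaklyRegular_pi (rs : List R) (hR : IsWeaklyRegular R rs) (n : ℕ) :
    IsWeaklyRegular (Fin n → R) rs :=
  ((TensorProduct.rid R (Fin n → R)).isWeaklyRegular_congr rs).mp
    (hR.isWeaklyRegular_lTensor (M₂ := Fin n → R))

/-- A partial maximal Cohen-Macaulay approximation: a surjection onto `B`, with kernel of finite
projective dimension, from a finite module on which the first `j` elements of `rs` are regular. -/
def HasApprox (R : Type u) [CommRing R] (rs : List R) (j : ℕ) (B : Type u) [AddCommGroup B]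
    [Module R B] : Prop :=
  ∃ (X : ModuleCat.{u} R) (p : X →ₗ[R] B), Module.Finite R X ∧ IsWeaklyRegular X (rs.take j) ∧
    Function.Surjective p ∧ FinPD R (LinearMap.ker p)

lemma HasApprox.congr {rs : List R} {j : ℕ} (h : HasApprox R rs j B) (e : B ≃ₗ[R] C) :
    HasApprox R rs j C := by
  obtain ⟨X, p, h1, h2, h3, h4⟩ := h
  refine ⟨X, e.toLinearMap ∘ₗ p, h1, h2, e.surjective.comp h3, ?_⟩
  rw [LinearEquiv.ker_comp]
  exact h4

lemma hasApprox_self (rs : List R) [Module.Finite R B] : HasApprox R rs 0 B :=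
  ⟨ModuleCat.of R B, LinearMap.id, inferInstance, by simp, Function.surjective_id, by
    have : Subsingleton (LinearMap.ker (LinearMap.id : B →ₗ[R] B)) := by
      rw [LinearMap.ker_id]; infer_instance
    exact .of_subsingleton⟩

/-- Passing to syzygies: given a surjection `f : F → B` from a finite module of finite projective
dimension, an approximation `X → B` induces one of `ker f` by the kernel of a free cover of `X`,
chosen so large that it maps onto both `F` and `ker (X → B)`. -/
lemma HasApprox.ker [IsNoetherianRing R] {rs : List R} (hR : IsWeaklyRegular R rs) {j : ℕ}
    (h : HasApprox R rs j B) [Module.Finite R F] (hF : FinPD R F) {f : F →ₗ[R] B}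
    (hf : Function.Surjective f) : HasApprox R rs (j + 1) (LinearMap.ker f) := by
  obtain ⟨X, p, hfin, hX, hp, hk⟩ := h
  obtain ⟨n, α, hα⟩ := Module.Finite.exists_fin' R F
  obtain ⟨m, β, hβ⟩ := Module.Finite.exists_fin' R (LinearMap.ker p)
  -- lift `R^n → F → B` through `p`
  obtain ⟨γ, hγ⟩ := Module.projective_lifting_property p (f ∘ₗ α) hp
  let q : (Fin n → R) × (Fin m → R) →ₗ[R] X := γ.coprod ((LinearMap.ker p).subtype ∘ₗ β)
  have hqa (a : Fin n → R) (b : Fin m → R) : q (a, b) = γ a + (β b : X) := rfl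
  have hpq : ∀ g, p (q g) = f (α g.1) := by
    rintro ⟨a, b⟩
    have h1 : p (γ a) = f (α a) := LinearMap.congr_fun hγ a
    have h2 : p (β b : X) = 0 := (β b).2
    rw [hqa, map_add, h1, h2, add_zero]
  have hq : Function.Surjective q := by
    intro x
    obtain ⟨y, hy⟩ := hf (p x)
    obtain ⟨a, rfl⟩ := hα y
    have h1 : p (γ a) = f (α a) := LinearMap.congr_fun hγ a
    obtain ⟨b, hb⟩ := hβ ⟨x - γ a, by rw [LinearMap.mem_ker, map_sub, h1, hy, sub_self]⟩
    exact ⟨(a, b), by rw [hqa, hb, add_sub_cancel]⟩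
  let θ : LinearMap.ker q →ₗ[R] LinearMap.ker f :=
    (α ∘ₗ LinearMap.fst R _ _ ∘ₗ (LinearMap.ker q).subtype).codRestrict _ fun g ↦ by
      have h1 := hpq g.1
      rw [show q g.1 = 0 from g.2, map_zero] at h1
      exact h1.symm
  have hθ : Function.Surjective θ := by
    rintro ⟨y, hy⟩
    obtain ⟨a, rfl⟩ := hα y
    have h1 : p (γ a) = f (α a) := LinearMap.congr_fun hγ a
    obtain ⟨b, hb⟩ := hβ ⟨- γ a, by
      rw [LinearMap.mem_ker, map_neg, h1, show f (α a) = 0 from hy, neg_zero]⟩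
    exact ⟨⟨(a, b), by
      rw [LinearMap.mem_ker, hqa, hb, add_neg_cancel]⟩, rfl⟩
  -- the kernel of `θ` is the kernel of the surjection `ker α × R^m → ker p` induced by `q`
  let V := LinearMap.ker (α ∘ₗ LinearMap.fst R (Fin n → R) (Fin m → R))
  have hV : FinPD R V := FinPD.ker (hα.comp LinearMap.fst_surjective) .of_projective hF
  let η : V →ₗ[R] LinearMap.ker p := (q ∘ₗ V.subtype).codRestrict _ fun v ↦ by
    have hv : α v.1.1 = 0 := v.2
    exact (hpq v.1).trans (by rw [hv, map_zero])
  have hη : Function.Surjective η := by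
    intro u
    obtain ⟨b, hb⟩ := hβ u
    refine ⟨⟨(0, b), by rw [LinearMap.mem_ker]; exact map_zero α⟩, Subtype.ext ?_⟩
    exact (hqa 0 b).trans (by rw [map_zero, zero_add, hb])
  have hθη : FinPD R (LinearMap.ker θ) := by
    let e : LinearMap.ker η ≃ₗ[R] LinearMap.ker θ :=
      { toFun := fun v ↦ ⟨⟨v.1.1, congrArg Subtype.val v.2⟩, Subtype.ext v.1.2⟩
        map_add' := fun _ _ ↦ rfl
        map_smul' := fun _ _ ↦ rfl
        invFun := fun g ↦ ⟨⟨g.1.1, congrArg Subtype.val g.2⟩, Subtype.ext g.1.2⟩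
        left_inv := fun _ ↦ rfl
        right_inv := fun _ ↦ rfl }
    exact (FinPD.ker hη hV hk).congr e
  refine ⟨ModuleCat.of R (LinearMap.ker q), θ, inferInstance, ?_, hθ, hθη⟩
  have e : (Fin (n + m) → R) ≃ₗ[R] (Fin n → R) × (Fin m → R) :=
    (LinearEquiv.funCongrLeft R R finSumFinEquiv).trans (LinearEquiv.sumArrowLequivProdArrow _ _ R R)
  exact isWeaklyRegular_of_exact rs j (Submodule.injective_subtype _)
    (LinearMap.exact_subtype_ker_map q) hq
    ((e.isWeaklyRegular_congr rs).mp (isWeaklyRegular_pi rs hR _)) hX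

lemma HasApprox.of_exact [IsNoetherianRing R] {rs : List R} (hR : IsWeaklyRegular R rs) {j : ℕ}
    (h : HasApprox R rs j B) [Module.Finite R F] (hF : FinPD R F) {i : A →ₗ[R] F} {f : F →ₗ[R] B}
    (hi : Function.Injective i) (hif : Function.Exact i f) (hf : Function.Surjective f) :
    HasApprox R rs (j + 1) A :=
  (h.ker hR hF hf).congr ((LinearEquiv.ofInjective i hi).trans
    (LinearEquiv.ofEq _ _ hif.linearMap_ker_eq.symm)).symm

lemma HasApprox.of_injective [IsNoetherianRing R] {rs : List R} (hR : IsWeaklyRegular R rs) {j : ℕ}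
    {S : Type u} [CommRing S] [Algebra R S] [Module S A] [IsScalarTower R S A] [Module S F]
    [IsScalarTower R S F] [Module.Finite R F] (hF : FinPD R F) {i : A →ₗ[S] F}
    (h : HasApprox R rs j (F ⧸ LinearMap.range i)) (hi : Function.Injective i) :
    HasApprox R rs (j + 1) A := by
  have hex : Function.Exact (i.restrictScalars R) ((LinearMap.range i).mkQ.restrictScalars R) := by
    rw [LinearMap.coe_restrictScalars, LinearMap.coe_restrictScalars]
    exact LinearMap.exact_map_mkQ_range i
  have hg : Function.Surjective ((LinearMap.range i).mkQ.restrictScalars R) := by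
    rw [LinearMap.coe_restrictScalars]
    exact Submodule.mkQ_surjective _
  exact h.of_exact hR hF (i := i.restrictScalars R) hi hex hg

lemma mk_mem_maximalIdeal [IsLocalRing R] {I : Ideal R} [IsLocalRing (R ⧸ I)]
    (hI : I ≤ maximalIdeal R) {r : R} (hr : r ∈ maximalIdeal R) :
    Ideal.Quotient.mk I r ∈ maximalIdeal (R ⧸ I) := by
  rw [mem_maximalIdeal, mem_nonunits_iff, isUnit_iff_exists]
  rintro ⟨b, hb, -⟩
  obtain ⟨b, rfl⟩ := Ideal.Quotient.mk_surjective b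
  rw [← map_mul, ← map_one (Ideal.Quotient.mk I), Ideal.Quotient.eq] at hb
  refine (maximalIdeal.isMaximal R).ne_top ((Ideal.eq_top_iff_one _).mpr ?_)
  rw [show (1 : R) = r * b - (r * b - 1) by ring]
  exact sub_mem (Ideal.mul_mem_right _ _ hr) (hI hb)

/-- Finite modules over `R/rs` have partial approximations of every length: embed them in finite
free modules over the self-injective ring `R/rs` and pass to syzygies. -/
lemma IsGorensteinSequence.hasApprox [IsLocalRing R] [IsNoetherianRing R] {rs : List R}
    (h : IsGorensteinSequence R rs) (j : ℕ)
    (M : Type u) [AddCommGroup M] [Module R M] [Module (R ⧸ Ideal.ofList rs) M]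
    [IsScalarTower R (R ⧸ Ideal.ofList rs) M] [Module.Finite (R ⧸ Ideal.ofList rs) M] :
    HasApprox R rs j M := by
  have hle : Ideal.ofList rs ≤ maximalIdeal R := Ideal.span_le.mpr h.mem
  have : Nontrivial (R ⧸ Ideal.ofList rs) := Ideal.Quotient.nontrivial_iff.mpr
    (ne_top_of_le_ne_top (maximalIdeal.isMaximal R).ne_top hle)
  have : IsLocalRing (R ⧸ Ideal.ofList rs) :=
    .of_surjective' (Ideal.Quotient.mk _) Ideal.Quotient.mk_surjective
  have := h.krullDimLE_zero
  have : IsArtinianRing (R ⧸ Ideal.ofList rs) :=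
    isArtinianRing_iff_isNoetherianRing_krullDimLE_zero.mpr ⟨inferInstance, this⟩
  obtain ⟨s, hs0, hs1, hs2⟩ := h.exists_socle
  have hmax : ∀ r ∈ maximalIdeal R, Ideal.Quotient.mk (Ideal.ofList rs) r ∈
      maximalIdeal (R ⧸ Ideal.ofList rs) := by
    exact fun r hr ↦ mk_mem_maximalIdeal hle hr
  have hfree : FinPD R (R ⧸ Ideal.ofList rs) :=
    (FinPD.quotient_of_isWeaklyRegular rs h.isWeaklyRegular .of_projective).congr
      (Submodule.quotEquivOfEq _ _ (by rw [smul_eq_mul, Ideal.mul_top]))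
  have hfree' (n : ℕ) : FinPD R (Fin n → R ⧸ Ideal.ofList rs) := by
    induction n with
    | zero => exact .of_subsingleton
    | succ n ih => exact (hfree.prod ih).congr (Fin.consLinearEquiv R (fun _ ↦ R ⧸ Ideal.ofList rs))
  induction j generalizing M with
  | zero =>
    have : Module.Finite R M := Module.Finite.trans (R ⧸ Ideal.ofList rs) M
    exact hasApprox_self rs
  | succ j ih =>
    obtain ⟨n, f, hf⟩ := exists_injective_pi_of_simple_socle hs0
      (fun s' hs' ↦ by
        obtain ⟨r, hr⟩ := hs2 s' fun r hr ↦ by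
          rw [Algebra.smul_def]; exact hs' _ (hmax r hr)
        exact ⟨Ideal.Quotient.mk _ r, by rw [← hr, Algebra.smul_def]; rfl⟩)
      (fun a ha ↦ by
        obtain ⟨r, rfl⟩ := Ideal.Quotient.mk_surjective a
        rw [smul_eq_mul]
        refine (Algebra.smul_def r s).symm.trans (hs1 r ?_)
        by_contra hr
        exact ha ((not_not.mp hr : IsUnit r).map (Ideal.Quotient.mk (Ideal.ofList rs)))) M
    have hQ : HasApprox R rs j ((Fin n → R ⧸ Ideal.ofList rs) ⧸ LinearMap.range f) := ih _
    exact hQ.of_injective h.isWeaklyRegular (hfree' n) hf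

end Approximations

/-! ### Minimal approximations -/

section Minimality

variable {R : Type u} [CommRing R]
variable {X Y M : Type u} [AddCommGroup X] [Module R X] [AddCommGroup Y] [Module R Y]
  [AddCommGroup M] [Module R M]

lemma isWeaklyRegular_of_retract (rs : List R) {i : X →ₗ[R] Y} {r : Y →ₗ[R] X}
    (hri : r ∘ₗ i = LinearMap.id) (h : IsWeaklyRegular Y rs) : IsWeaklyRegular X rs := by
  induction rs generalizing X Y with
  | nil => exact .nil R X
  | cons x rs ih =>
    rw [isWeaklyRegular_cons_iff] at h ⊢
    refine ⟨h.1.of_injective i (Function.LeftInverse.injective (LinearMap.congr_fun hri)), ?_⟩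
    refine ih (i := QuotSMulTop.map x i) (r := QuotSMulTop.map x r) ?_ h.2
    refine LinearMap.ext fun v ↦ ?_
    obtain ⟨v, rfl⟩ := Submodule.Quotient.mk_surjective _ v
    exact congrArg _ (LinearMap.congr_fun hri v)

lemma map_mem_smul_top_of_forall_mem {ι : Type*} [Finite ι] {I : Ideal R} (b : (ι → R) →ₗ[R] X)
    {v : ι → R} (hv : ∀ i, v i ∈ I) : b v ∈ I • (⊤ : Submodule R X) := by
  classical
  have := Fintype.ofFinite ι
  rw [LinearMap.pi_apply_eq_sum_univ b v]
  exact sum_mem fun i _ ↦ Submodule.smul_mem_smul (hv i) trivial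

variable [IsLocalRing R]

/-- An approximation `p : X → M` is minimal if no linear form on `X` takes the value `1` on the
kernel. Indeed `φ - id` maps to `ker p` if `p ∘ φ = p`, and lifts to a map `a` to a free cover
`b : R^n → ker p`; the matrix `ab` has entries in the maximal ideal, so `φ = id + ba` is surjective
by Nakayama's lemma. -/
lemma bijective_of_comp_eq [IsNoetherianRing R] [Module.Finite R X]
    (hX : ∀ i, Subsingleton (ExtMod R X R (i + 1))) {p : X →ₗ[R] M}
    (hk : FinPD R (LinearMap.ker p))
    (hmin : ∀ f : X →ₗ[R] R, ∀ y ∈ LinearMap.ker p, f y ≠ 1) {φ : X →ₗ[R] X} (hφ : p ∘ₗ φ = p) :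
    Function.Bijective φ := by
  obtain ⟨n, β, hβ⟩ := Module.Finite.exists_fin' R (LinearMap.ker p)
  let δ : X →ₗ[R] LinearMap.ker p := (φ - LinearMap.id).codRestrict _ fun x ↦ by
    have h1 : p (φ x) = p x := LinearMap.congr_fun hφ x
    rw [LinearMap.mem_ker, LinearMap.sub_apply, map_sub, h1, LinearMap.id_apply, sub_self]
  obtain ⟨a, ha⟩ := exists_lift_of_finPD hX hβ (FinPD.ker hβ .of_projective hk) δ
  let b : (Fin n → R) →ₗ[R] X := (LinearMap.ker p).subtype ∘ₗ β
  have hba : ∀ x, φ x = x + b (a x) := fun x ↦ by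
    have h1 : b (a x) = φ x - x := congrArg Subtype.val (LinearMap.congr_fun ha x)
    rw [h1, add_sub_cancel]
  have hmem : ∀ g i, a (b g) i ∈ maximalIdeal R := by
    intro g i hu
    obtain ⟨u, hu⟩ := hu
    refine hmin ((↑u⁻¹ : R) • (LinearMap.proj i ∘ₗ a)) (b g) (β g).2 ?_
    change (↑u⁻¹ : R) * a (b g) i = 1
    rw [← hu, Units.inv_mul]
  have hsurj : Function.Surjective φ := by
    rw [← LinearMap.range_eq_top, eq_top_iff]
    refine Submodule.le_of_le_smul_of_le_jacobson_bot (Module.finite_def.mp ‹_›)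
      (IsLocalRing.maximalIdeal_le_jacobson _) fun z _ ↦ ?_
    have h1 : z = φ (z - b (a z)) + b (a (b (a z))) := by
      rw [hba, map_sub, map_sub]
      abel
    rw [h1]
    exact Submodule.add_mem_sup ⟨_, rfl⟩ (map_mem_smul_top_of_forall_mem b (hmem _))
  exact ⟨IsNoetherian.injective_of_surjective_endomorphism φ hsurj, hsurj⟩

lemma apply_ne_one_of_minimal {p : X →ₗ[R] M}
    (hmin : ∀ φ : X →ₗ[R] X, p ∘ₗ φ = p → Function.Bijective φ) (f : X →ₗ[R] R) {y : X}
    (hy : y ∈ LinearMap.ker p) : f y ≠ 1 := by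
  intro hfy
  have h1 := hmin (LinearMap.id - (LinearMap.toSpanSingleton R X y) ∘ₗ f) <| by
    ext x
    simp [LinearMap.mem_ker.mp hy]
  have h2 : y = 0 := h1.1 (by simp [hfy])
  rw [h2, map_zero] at hfy
  exact zero_ne_one hfy

/-- Splitting off free summands contained in the kernel turns an approximation into a minimal one;
the process stops because the kernels of the projections from the original module increase. -/
lemma exists_minimal_approx [IsNoetherianRing R] {rs : List R} {X₀ : ModuleCat.{u} R}
    {p₀ : X₀ →ₗ[R] M} (hfin : Module.Finite R X₀) (hreg : IsWeaklyRegular X₀ rs)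
    (hp : Function.Surjective p₀) (hk : FinPD R (LinearMap.ker p₀)) :
    ∃ (X : ModuleCat.{u} R) (p : X →ₗ[R] M), Module.Finite R X ∧ IsWeaklyRegular X rs ∧
      Function.Surjective p ∧ FinPD R (LinearMap.ker p) ∧
      ∀ f : X →ₗ[R] R, ∀ y ∈ LinearMap.ker p, f y ≠ 1 := by
  let S : Set (Submodule R X₀) := {K | ∃ (X : ModuleCat.{u} R) (q : X₀ →ₗ[R] X) (p : X →ₗ[R] M),
    LinearMap.ker q = K ∧ Function.Surjective q ∧ IsWeaklyRegular X rs ∧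
      Function.Surjective p ∧ FinPD R (LinearMap.ker p)}
  obtain ⟨K, ⟨X, q, p, hqK, hq, hX, hp', hk'⟩, hmax⟩ :=
    (wellFounded_gt (α := Submodule R X₀)).has_min S
      ⟨_, X₀, LinearMap.id, p₀, rfl, Function.surjective_id, hreg, hp, hk⟩
  refine ⟨X, p, Module.Finite.of_surjective q hq, hX, hp', hk', fun f y hy hfy ↦ ?_⟩
  have hpy : p y = 0 := hy
  -- the projection onto the complement `ker f` of the free summand spanned by `y`
  let π : X →ₗ[R] LinearMap.ker f :=
    (LinearMap.id - (LinearMap.toSpanSingleton R X y) ∘ₗ f).codRestrict _ fun x ↦ by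
      simp [hfy]
  have hπ : ∀ x, (π x : X) = x - f x • y := fun _ ↦ rfl
  have hπr : π ∘ₗ (LinearMap.ker f).subtype = LinearMap.id := by
    ext v
    have h1 : f v = 0 := v.2
    simp [hπ, h1]
  have hπs : Function.Surjective π := fun v ↦ ⟨v, LinearMap.congr_fun hπr v⟩
  let p' : LinearMap.ker f →ₗ[R] M := p ∘ₗ (LinearMap.ker f).subtype
  have hp'π : ∀ x, p' (π x) = p x := fun x ↦ by
    change p (π x : X) = p x
    rw [hπ, map_sub, map_smul, hpy, smul_zero, sub_zero]
  refine hmax (LinearMap.ker (π ∘ₗ q)) ⟨ModuleCat.of R (LinearMap.ker f), π ∘ₗ q, p', rfl,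
    hπs.comp hq, isWeaklyRegular_of_retract rs hπr hX, fun m ↦ ?_, ?_⟩ ?_
  · obtain ⟨x, rfl⟩ := hp' m
    exact ⟨π x, hp'π x⟩
  · refine FinPD.of_retract (B := LinearMap.ker p)
      (((LinearMap.ker f).subtype ∘ₗ (LinearMap.ker p').subtype).codRestrict _ fun v ↦ v.2)
      ((π ∘ₗ (LinearMap.ker p).subtype).codRestrict _ fun u ↦ ?_) ?_ hk'
    · exact (hp'π u).trans u.2
    · ext v
      exact congrArg Subtype.val (LinearMap.congr_fun hπr v.1)
  · refine lt_of_le_of_ne (hqK ▸ LinearMap.ker_le_ker_comp q π) fun hKe ↦ ?_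
    obtain ⟨x, rfl⟩ := hq y
    have h1 : x ∈ LinearMap.ker (π ∘ₗ q) := by
      refine Subtype.ext ?_
      change (π (q x) : X) = 0
      rw [hπ, hfy, one_smul, sub_self]
    rw [← hKe, ← hqK] at h1
    rw [LinearMap.mem_ker.mp h1, map_zero] at hfy
    exact zero_ne_one hfy

omit [IsLocalRing R] in
lemma nonempty_linearEquiv_of_minimal [IsNoetherianRing R] [Module.Finite R X] [Module.Finite R Y]
    (hX : ∀ i, Subsingleton (ExtMod R X R (i + 1))) (hY : ∀ i, Subsingleton (ExtMod R Y R (i + 1)))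
    {p : X →ₗ[R] M} {q : Y →ₗ[R] M} (hp : Function.Surjective p) (hq : Function.Surjective q)
    (hpk : FinPD R (LinearMap.ker p)) (hqk : FinPD R (LinearMap.ker q))
    (hpm : ∀ φ : X →ₗ[R] X, p ∘ₗ φ = p → Function.Bijective φ)
    (hqm : ∀ φ : Y →ₗ[R] Y, q ∘ₗ φ = q → Function.Bijective φ) : Nonempty (X ≃ₗ[R] Y) := by
  obtain ⟨a, ha⟩ := exists_lift_of_finPD hX hq hqk p
  obtain ⟨b, hb⟩ := exists_lift_of_finPD hY hp hpk q
  have h1 : Function.Bijective (b ∘ₗ a) := hpm _ (by rw [← LinearMap.comp_assoc, hb, ha])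
  have h2 : Function.Bijective (a ∘ₗ b) := hqm _ (by rw [← LinearMap.comp_assoc, ha, hb])
  exact ⟨LinearEquiv.ofBijective a
    ⟨Function.Injective.of_comp (f := b) h1.1, Function.Surjective.of_comp (g := b) h2.2⟩⟩

variable [IsNoetherianRing R]

lemma IsGorensteinSequence.exists_isMinimalMCMApproximation {rs : List R}
    (h : IsGorensteinSequence R rs) {N : ModuleCat.{u} R} {j : ℕ} (hj : rs.length ≤ j)
    (hN : HasApprox R rs j N) :
    ∃ (X : ModuleCat.{u} R) (p : X →ₗ[R] N), IsMinimalMCMApproximation p := by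
  obtain ⟨X₀, p₀, h1, h2, h3, h4⟩ := hN
  rw [List.take_of_length_le hj] at h2
  obtain ⟨X, p, g1, g2, g3, g4, g5⟩ := exists_minimal_approx h1 h2 h3 h4
  have hX : IsMaximalCohenMacaulay R X :=
    isMaximalCohenMacaulay_of_isWeaklyRegular h.length_eq h.mem g2
  exact ⟨X, p, ⟨hX, g3, g4⟩, fun φ hφ ↦
    bijective_of_comp_eq (h.ext_subsingleton_of_isMCM hX) g4 g5 hφ⟩

lemma IsGorensteinSequence.nonempty_linearEquiv {rs : List R}
    (h : IsGorensteinSequence R rs) {N X Y : ModuleCat.{u} R} {p : X →ₗ[R] N} {q : Y →ₗ[R] N}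
    (hp : IsMinimalMCMApproximation p) (hq : IsMinimalMCMApproximation q) :
    Nonempty (X ≃ₗ[R] Y) :=
  have := hp.isMCM.finite
  have := hq.isMCM.finite
  nonempty_linearEquiv_of_minimal (h.ext_subsingleton_of_isMCM hp.isMCM)
    (h.ext_subsingleton_of_isMCM hq.isMCM) hp.surjective hq.surjective
    hp.projectiveDimension_ker_ne_top hq.projectiveDimension_ker_ne_top hp.minimal hq.minimal

end Minimality

/-! ### Minimal free covers and syzygies -/

section MinimalCovers

variable {R : Type u} [CommRing R]

lemma mem_smul_top_pi_iff {ι : Type u} [Finite ι] {I : Ideal R} {v : ι → R} :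
    v ∈ I • (⊤ : Submodule R (ι → R)) ↔ ∀ i, v i ∈ I := by
  refine ⟨fun hv i ↦ ?_, fun hv ↦ map_mem_smul_top_of_forall_mem (I := I) LinearMap.id hv⟩
  have := Submodule.smul_top_le_comap_smul_top I (LinearMap.proj i : (ι → R) →ₗ[R] R) hv
  rwa [Submodule.mem_comap, smul_eq_mul, Ideal.mul_top] at this

variable [IsLocalRing R]
variable {F F' M M' : Type u} [AddCommGroup F] [Module R F] [AddCommGroup F'] [Module R F']
  [AddCommGroup M] [Module R M] [AddCommGroup M'] [Module R M']

/-- A minimal cover: a surjection whose kernel lies in `𝔪F`. The source is required to be free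
only where this is used. -/
structure IsMinimalCover (f : F →ₗ[R] M) : Prop where
  surjective : Function.Surjective f
  ker_le : LinearMap.ker f ≤ maximalIdeal R • (⊤ : Submodule R F)

/-- A lift of a surjection along a minimal cover is surjective, by Nakayama's lemma. -/
lemma IsMinimalCover.surjective_of_comp [Module.Finite R F'] {f : F →ₗ[R] M} {f' : F' →ₗ[R] M}
    (hf : Function.Surjective f) (hf' : IsMinimalCover f') {a : F →ₗ[R] F'} (ha : f' ∘ₗ a = f) :
    Function.Surjective a := by
  rw [← LinearMap.range_eq_top, eq_top_iff]
  refine Submodule.le_of_le_smul_of_le_jacobson_bot (Module.finite_def.mp ‹_›)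
    (IsLocalRing.maximalIdeal_le_jacobson _) fun z _ ↦ ?_
  obtain ⟨y, hy⟩ := hf (f' z)
  have h1 : f' (a y) = f y := LinearMap.congr_fun ha y
  rw [← add_sub_cancel (a y) z]
  refine Submodule.add_mem_sup ⟨y, rfl⟩ (hf'.ker_le ?_)
  rw [LinearMap.mem_ker, map_sub, h1, hy, sub_self]

/-- Minimal free covers are unique: any comparison map is an isomorphism. -/
lemma IsMinimalCover.bijective_of_comp [IsNoetherianRing R] [Module.Finite R F]
    [Module.Finite R F'] [Module.Projective R F'] {f : F →ₗ[R] M}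
    {f' : F' →ₗ[R] M} (hf : IsMinimalCover f) (hf' : IsMinimalCover f') {a : F →ₗ[R] F'}
    (ha : f' ∘ₗ a = f) : Function.Bijective a := by
  obtain ⟨b, hb⟩ := Module.projective_lifting_property f f' hf.surjective
  have hb' : Function.Surjective b := hf.surjective_of_comp hf'.surjective hb
  have ha' : Function.Surjective a := hf'.surjective_of_comp hf.surjective ha
  have h1 := IsNoetherian.injective_of_surjective_endomorphism (b ∘ₗ a) (hb'.comp ha')
  exact ⟨Function.Injective.of_comp (f := b) h1, ha'⟩

lemma IsMinimalCover.nonempty_ker_equiv [IsNoetherianRing R] [Module.Finite R F]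
    [Module.Finite R F'] [Module.Projective R F] [Module.Projective R F'] {f : F →ₗ[R] M}
    {f' : F' →ₗ[R] M'} (hf : IsMinimalCover f) (hf' : IsMinimalCover f') (e : M ≃ₗ[R] M') :
    Nonempty (LinearMap.ker f ≃ₗ[R] LinearMap.ker f') := by
  have he : IsMinimalCover (e.toLinearMap ∘ₗ f) :=
    ⟨e.surjective.comp hf.surjective, by rw [LinearEquiv.ker_comp]; exact hf.ker_le⟩
  obtain ⟨a, ha⟩ := Module.projective_lifting_property f' (e.toLinearMap ∘ₗ f) hf'.surjective
  have hab := he.bijective_of_comp hf' ha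
  refine ⟨(LinearEquiv.ofBijective a hab).ofSubmodules _ _ ?_⟩
  ext y
  obtain ⟨y, rfl⟩ := hab.2 y
  have h1 : f' (a y) = e (f y) := LinearMap.congr_fun ha y
  simp [h1]

/-- `firstSyzygy` is the kernel of a minimal free cover: if a relation between the chosen
generators had a unit coefficient, there would be a smaller generating set. -/
lemma exists_isMinimalCover_firstSyzygy (M : ModuleCat.{u} R) [Module.Finite R M] :
    ∃ (ι : Type u) (_ : Finite ι) (f : (ι → R) →ₗ[R] M), IsMinimalCover f ∧
      Nonempty (firstSyzygy R M ≃ₗ[R] LinearMap.ker f) := by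
  have hfg : (⊤ : Submodule R M).FG := Module.finite_def.mp ‹_›
  have hfin : Finite (⊤ : Submodule R M).generators := hfg.finite_generators
  let c := Finsupp.linearCombination R (Subtype.val : (⊤ : Submodule R M).generators → M)
  let e := Finsupp.linearEquivFunOnFinite R R (⊤ : Submodule R M).generators
  have hcs : Function.Surjective c := by
    rw [← LinearMap.range_eq_top, Finsupp.range_linearCombination, Subtype.range_coe]
    exact Submodule.span_generators _
  have hunit : ∀ v, c v = 0 → ∀ g, v g ∈ maximalIdeal R := by
    intro v hv g hu
    obtain ⟨u, hu⟩ := hu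
    have h1 : c (v.erase g) ∈ Submodule.span R ((⊤ : Submodule R M).generators \ {(g : M)}) := by
      refine Submodule.sum_mem _ fun i hi ↦ Submodule.smul_mem _ _ (Submodule.subset_span ?_)
      refine ⟨i.2, fun h ↦ ?_⟩
      simp [Subtype.ext h] at hi
    have h2 : (u : R) • (g : M) + c (v.erase g) = 0 := by
      rw [← hv, hu, ← Finsupp.single_add_erase g v, map_add]
      simp [c]
    have h3 : (g : M) ∈ Submodule.span R ((⊤ : Submodule R M).generators \ {(g : M)}) := by
      have h3' := congrArg ((↑u⁻¹ : R) • ·) (eq_neg_of_add_eq_zero_left h2)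
      simp only [smul_smul, Units.inv_mul, one_smul, smul_neg] at h3'
      have h7 := Submodule.smul_mem _ (↑u⁻¹ : R) (neg_mem h1)
      rwa [smul_neg, ← h3'] at h7
    have h4 : Submodule.span R ((⊤ : Submodule R M).generators \ {(g : M)}) = ⊤ := by
      refine top_unique ((Submodule.span_generators (⊤ : Submodule R M)).ge.trans ?_)
      refine Submodule.span_le.mpr ?_
      intro y hy
      by_cases hyg : y = g
      · rw [hyg]; exact h3
      · exact Submodule.subset_span ⟨hy, hyg⟩
    have h5 := Submodule.spanFinrank_span_le_ncard_of_finite (R := R)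
      (hfg.finite_generators.subset (Set.sdiff_subset (t := {(g : M)})))
    rw [h4, ← hfg.generators_ncard] at h5
    have h6 := Set.ncard_sdiff_singleton_lt_of_mem g.2 hfg.finite_generators
    lia
  refine ⟨_, hfin, c ∘ₗ e.symm.toLinearMap, ⟨hcs.comp e.symm.surjective, fun v hv ↦ ?_⟩, ⟨?_⟩⟩
  · exact mem_smul_top_pi_iff.mpr (hunit _ hv)
  · refine e.ofSubmodules _ _ ?_
    ext v
    simp [c, e]

instance [IsNoetherianRing R] (M : ModuleCat.{u} R) [Module.Finite R M] :
    Module.Finite R (firstSyzygy R M) := by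
  obtain ⟨ι, _, f, -, ⟨e⟩⟩ := exists_isMinimalCover_firstSyzygy M
  exact Module.Finite.equiv e.symm

instance [IsNoetherianRing R] (n : ℕ) (M : ModuleCat.{u} R) [Module.Finite R M] :
    Module.Finite R (syzygy R n M) := by
  induction n generalizing M with
  | zero => assumption
  | succ n ih => exact ih (firstSyzygy R M)

lemma firstSyzygy_congr [IsNoetherianRing R] {M M' : ModuleCat.{u} R} [Module.Finite R M]
    (e : M ≃ₗ[R] M') : Nonempty (firstSyzygy R M ≃ₗ[R] firstSyzygy R M') := by
  have : Module.Finite R M' := Module.Finite.equiv e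
  obtain ⟨ι, _, f, hf, ⟨a⟩⟩ := exists_isMinimalCover_firstSyzygy M
  obtain ⟨ι', _, f', hf', ⟨a'⟩⟩ := exists_isMinimalCover_firstSyzygy M'
  obtain ⟨b⟩ := hf.nonempty_ker_equiv hf' e
  exact ⟨(a.trans b).trans a'.symm⟩

lemma syzygy_congr [IsNoetherianRing R] (n : ℕ) {M M' : ModuleCat.{u} R} [Module.Finite R M]
    (e : M ≃ₗ[R] M') : Nonempty (syzygy R n M ≃ₗ[R] syzygy R n M') := by
  induction n generalizing M M' with
  | zero => exact ⟨e⟩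
  | succ n ih =>
    obtain ⟨b⟩ := firstSyzygy_congr e
    exact ih b

omit [IsLocalRing R] in
lemma syzygy_succ_eq (n : ℕ) (M : ModuleCat.{u} R) :
    syzygy R (n + 1) M = firstSyzygy R (syzygy R n M) := by
  induction n generalizing M with
  | zero => rfl
  | succ n ih => exact ih (firstSyzygy R M)

end MinimalCovers

/-! ### Syzygies modulo a regular element -/

section Hypersurface

/-- The `R`-algebra `S` is the quotient of the local ring `R` by the regular element `x` of its
maximal ideal. -/
structure IsQuotientByRegular {R : Type u} [CommRing R] [IsLocalRing R] (S : Type u) [CommRing S]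
    [Algebra R S] (x : R) : Prop where
  mem : x ∈ maximalIdeal R
  regular : IsSMulRegular R x
  surjective : Function.Surjective (algebraMap R S)
  map_eq_zero_iff : ∀ r, algebraMap R S r = 0 ↔ x ∣ r

variable {R S : Type u} [CommRing R] [CommRing S] [IsLocalRing R] [Algebra R S] {x : R}

/-- The kernel of the reduction `R^κ → (R/x)^κ` is `xR^κ`, which is free. -/
lemma IsQuotientByRegular.finPD_pi (h : IsQuotientByRegular S x) (κ : Type u) [Finite κ] :
    FinPD R (κ → S) := by
  have hx (v : κ → R) (hv : (Algebra.linearMap R S).compLeft κ v = 0) : ∃ w : κ → R, v = x • w := by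
    choose w hw using fun i ↦ (h.map_eq_zero_iff (v i)).mp (congrFun hv i)
    exact ⟨w, funext hw⟩
  refine FinPD.right (f := LinearMap.lsmul R (κ → R) x) (g := (Algebra.linearMap R S).compLeft κ)
    (IsSMulRegular.pi fun _ ↦ h.regular) (fun v ↦ ⟨fun hv ↦ ?_, ?_⟩) (fun w ↦ ?_)
    .of_projective .of_projective
  · obtain ⟨w, rfl⟩ := hx v hv
    exact ⟨w, rfl⟩
  · rintro ⟨w, rfl⟩
    refine funext fun i ↦ (h.map_eq_zero_iff _).mpr ⟨w i, rfl⟩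
  · choose v hv using fun i ↦ h.surjective (w i)
    exact ⟨v, funext hv⟩

/-- Finite projective dimension over `R/x` implies finite projective dimension over `R`. -/
lemma IsQuotientByRegular.finPD_of_finPD [IsNoetherianRing S] (h : IsQuotientByRegular S x)
    (V : Type u) [AddCommGroup V]
    [Module R V] [Module S V] [IsScalarTower R S V] [Module.Finite S V] (hV : FinPD S V) :
    FinPD R V := by
  obtain ⟨n, hn⟩ := finPD_iff.mp hV
  induction n generalizing V with
  | zero =>
    have h0 : Limits.IsZero (ModuleCat.of S V) := isZero_of_hasProjectiveDimensionLT_zero _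
    have : Subsingleton V := ModuleCat.subsingleton_of_isZero h0
    exact .of_subsingleton
  | succ n ih =>
    obtain ⟨m, f, hf⟩ := Module.Finite.exists_fin' S V
    have hex := LinearMap.exact_subtype_ker_map f
    have hinj := Submodule.injective_subtype (LinearMap.ker f)
    have hfree : FinPD R (Fin m → S) :=
      (h.finPD_pi (ULift.{u} (Fin m))).congr (LinearEquiv.funCongrLeft R S Equiv.ulift.symm)
    rcases n with _ | n
    · have : Projective (ModuleCat.of S V) := inferInstance
      have : Module.Projective S V := (IsProjective.iff_projective V).mpr this
      obtain ⟨s, hs⟩ := Module.projective_lifting_property f LinearMap.id hf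
      exact hfree.of_retract (s.restrictScalars R) (f.restrictScalars R)
        (LinearMap.ext fun v ↦ LinearMap.congr_fun hs v)
    · have hk : HasProjectiveDimensionLT (ModuleCat.of S (LinearMap.ker f)) (n + 1) := by
        have : Projective (ModuleCat.of S (Fin m → S)) :=
          (IsProjective.iff_projective _).mp inferInstance
        exact ((shortExact_of_exact hinj hex hf).hasProjectiveDimensionLT_X₃_iff n this).mp hn
      exact FinPD.right (f := (LinearMap.ker f).subtype.restrictScalars R)
        (g := f.restrictScalars R) hinj hex hf (ih _ (finPD_iff.mpr ⟨_, hk⟩) hk) hfree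

/-- The `R`-module `A` decomposes modulo the `A`-regular element `x` as `A/xA ≅ B × C`, for modules
`B` and `C` over `S = R/x`, and the kernel of `A → B` has finite projective dimension over `R`. -/
def SplitsModulo (x : R) (A B C : Type u) [AddCommGroup A] [Module R A] [AddCommGroup B]
    [Module S B] [AddCommGroup C] [Module S C] : Prop :=
  IsSMulRegular A x ∧ ∃ (φ : A →ₛₗ[algebraMap R S] B) (ψ : A →ₛₗ[algebraMap R S] C),
    (∀ b c, ∃ a, φ a = b ∧ ψ a = c) ∧ (∀ a, φ a = 0 → ψ a = 0 → ∃ a', a = x • a') ∧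
    FinPD R (LinearMap.ker φ)

section Congr

variable {A B C A' B' C' : Type u} [AddCommGroup A] [Module R A] [AddCommGroup B] [Module S B]
  [AddCommGroup C] [Module S C] [AddCommGroup A'] [Module R A'] [AddCommGroup B'] [Module S B']
  [AddCommGroup C'] [Module S C']

omit [IsLocalRing R] in
lemma SplitsModulo.congr (h : SplitsModulo (S := S) x A B C) (eA : A ≃ₗ[R] A') (eB : B ≃ₗ[S] B')
    (eC : C ≃ₗ[S] C') : SplitsModulo (S := S) x A' B' C' := by
  obtain ⟨hreg, φ, ψ, h1, h2, h3⟩ := h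
  refine ⟨(eA.isSMulRegular_congr x).mp hreg, eB.toLinearMap.comp (φ.comp eA.symm.toLinearMap),
    eC.toLinearMap.comp (ψ.comp eA.symm.toLinearMap), fun b c ↦ ?_, fun a ha hb ↦ ?_, ?_⟩
  · obtain ⟨a, ha, hb⟩ := h1 (eB.symm b) (eC.symm c)
    exact ⟨eA a, by simp [ha], by simp [hb]⟩
  · obtain ⟨a', ha'⟩ := h2 (eA.symm a) (by simpa using ha) (by simpa using hb)
    exact ⟨eA a', by rw [← map_smul, ← ha', eA.apply_symm_apply]⟩
  · refine h3.congr (eA.ofSubmodules _ _ ?_)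
    ext y
    obtain ⟨y, rfl⟩ := eA.surjective y
    simp

variable [IsLocalRing S] [IsNoetherianRing S] {ι κ l : Type u} [Finite ι] [Finite κ] [Finite l]

/-- The decomposition `A/xA ≅ B × C` is inherited by minimal syzygies: a minimal free cover of `A`
reduces modulo `x` to a minimal free cover of `B × C`, hence to the product of minimal free covers
of `B` and of `C`. -/
lemma SplitsModulo.ker (hS : IsQuotientByRegular S x) (h : SplitsModulo (S := S) x A B C)
    {f : (ι → R) →ₗ[R] A} {g : (κ → S) →ₗ[S] B} {k : (l → S) →ₗ[S] C}
    (hf : IsMinimalCover f) (hg : IsMinimalCover g) (hk : IsMinimalCover k) :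
    SplitsModulo (S := S) x (LinearMap.ker f) (LinearMap.ker g) (LinearMap.ker k) := by
  classical
  have := Fintype.ofFinite ι
  obtain ⟨hreg, φ, ψ, h1, h2, h3⟩ := h
  have hx0 : algebraMap R S x = 0 := (hS.map_eq_zero_iff x).mpr dvd_rfl
  have hloc : IsLocalHom (algebraMap R S) := .of_surjective _ hS.surjective
  -- the coordinatewise reduction
  let red : (ι → R) →ₛₗ[algebraMap R S] (ι → S) :=
    { toFun := fun v i ↦ algebraMap R S (v i)
      map_add' := fun v w ↦ funext fun i ↦ map_add _ _ _
      map_smul' := fun r v ↦ funext fun i ↦ map_mul _ _ _ }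
  have hred : Function.Surjective red := fun w ↦ by
    choose v hv using fun i ↦ hS.surjective (w i)
    exact ⟨v, funext hv⟩
  have hred0 (v : ι → R) (hv : red v = 0) : ∃ w : ι → R, v = x • w := by
    choose w hw using fun i ↦ (hS.map_eq_zero_iff (v i)).mp (congrFun hv i)
    exact ⟨w, funext hw⟩
  have hredx (v : ι → R) : red (x • v) = 0 := by
    rw [map_smulₛₗ, hx0, zero_smul]
  -- the reduction of `f`
  let fbar : (ι → S) →ₗ[S] B × C := Fintype.linearCombination S
    fun i ↦ (φ (f fun j ↦ if i = j then 1 else 0), ψ (f fun j ↦ if i = j then 1 else 0))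
  have hfbar (v : ι → R) : fbar (red v) = (φ (f v), ψ (f v)) := by
    rw [Fintype.linearCombination_apply, LinearMap.pi_apply_eq_sum_univ f v]
    simp only [map_sum, map_smulₛₗ, Prod.smul_mk]
    exact Prod.ext Prod.fst_sum Prod.snd_sum
  have hkerf (v : ι → R) (hv : fbar (red v) = 0) : ∃ u, f (v - x • u) = 0 := by
    rw [hfbar, Prod.mk_eq_zero] at hv
    obtain ⟨a, ha⟩ := h2 _ hv.1 hv.2
    obtain ⟨u, rfl⟩ := hf.surjective a
    exact ⟨u, by rw [map_sub, ha, map_smul, sub_self]⟩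
  have hfbarc : IsMinimalCover fbar := by
    refine ⟨fun ⟨b, c⟩ ↦ ?_, fun w hw ↦ ?_⟩
    · obtain ⟨a, rfl, rfl⟩ := h1 b c
      obtain ⟨v, rfl⟩ := hf.surjective a
      exact ⟨red v, hfbar v⟩
    · obtain ⟨v, rfl⟩ := hred w
      obtain ⟨u, hu⟩ := hkerf v hw
      have h4 := mem_smul_top_pi_iff.mp (hf.ker_le hu)
      refine mem_smul_top_pi_iff.mpr fun i ↦ ?_
      have h5 : v i ∈ maximalIdeal R := by
        rw [show v i = (v - x • u) i + x * u i by simp]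
        exact add_mem (h4 i) (Ideal.mul_mem_right _ _ hS.mem)
      exact map_nonunit (algebraMap R S) _ h5
  have hgk : IsMinimalCover (g.prodMap k) := by
    refine ⟨hg.surjective.prodMap hk.surjective, ?_⟩
    rintro ⟨b, c⟩ hbc
    obtain ⟨hb, hc⟩ := Prod.mk_eq_zero.mp (LinearMap.mem_ker.mp hbc)
    have e : ((b, c) : (κ → S) × (l → S)) = LinearMap.inl S _ _ b + LinearMap.inr S _ _ c := by simp
    rw [e]
    exact add_mem (Submodule.smul_top_le_comap_smul_top _ _ (hg.ker_le hb))
      (Submodule.smul_top_le_comap_smul_top _ _ (hk.ker_le hc))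
  obtain ⟨α, hα⟩ := Module.projective_lifting_property (g.prodMap k) fbar hgk.surjective
  obtain ⟨hαi, hαs⟩ := hfbarc.bijective_of_comp hgk hα
  have hα1 (v : ι → R) : g (α (red v)).1 = φ (f v) :=
    congrArg Prod.fst ((LinearMap.congr_fun hα (red v)).trans (hfbar v))
  have hα2 (v : ι → R) : k (α (red v)).2 = ψ (f v) :=
    congrArg Prod.snd ((LinearMap.congr_fun hα (red v)).trans (hfbar v))
  let Φ₀ : (ι → R) →ₛₗ[algebraMap R S] (κ → S) := (LinearMap.fst S _ _ ∘ₗ α).comp red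
  let Ψ₀ : (ι → R) →ₛₗ[algebraMap R S] (l → S) := (LinearMap.snd S _ _ ∘ₗ α).comp red
  let Φ : LinearMap.ker f →ₛₗ[algebraMap R S] LinearMap.ker g :=
    (Φ₀.comp (LinearMap.ker f).subtype).codRestrict _ fun v ↦
      (hα1 v).trans (by rw [LinearMap.map_coe_ker, map_zero])
  let Ψ : LinearMap.ker f →ₛₗ[algebraMap R S] LinearMap.ker k :=
    (Ψ₀.comp (LinearMap.ker f).subtype).codRestrict _ fun v ↦
      (hα2 v).trans (by rw [LinearMap.map_coe_ker, map_zero])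
  have hΦΨ (b : LinearMap.ker g) (c : LinearMap.ker k) : ∃ a, Φ a = b ∧ Ψ a = c := by
    obtain ⟨w, hw⟩ := hαs (b.1, c.1)
    obtain ⟨v, rfl⟩ := hred w
    have hv : fbar (red v) = 0 := by
      rw [← hα, LinearMap.comp_apply, hw]
      exact Prod.ext b.2 c.2
    obtain ⟨u, hu⟩ := hkerf v hv
    have hvu : α (red (v - x • u)) = (b.1, c.1) := by
      rw [map_sub, hredx, sub_zero, hw]
    exact ⟨⟨v - x • u, hu⟩, Subtype.ext (congrArg Prod.fst hvu),
      Subtype.ext (congrArg Prod.snd hvu)⟩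
  refine ⟨(IsSMulRegular.pi fun _ ↦ hS.regular).of_injective (LinearMap.ker f).subtype
    (Submodule.injective_subtype _),
    Φ, Ψ, hΦΨ, fun a ha hb ↦ ?_, ?_⟩
  · have h4 : red a.1 = 0 := hαi (by
      rw [map_zero]
      exact Prod.ext (congrArg Subtype.val ha) (congrArg Subtype.val hb))
    obtain ⟨w, hw⟩ := hred0 _ h4
    refine ⟨⟨w, hreg ?_⟩, Subtype.ext hw⟩
    change x • f w = x • 0
    rw [← map_smul, ← hw, smul_zero]
    exact a.2
  · -- `ker Φ` is the kernel of the map `ker Φ₀ → ker φ` induced by `f`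
    let ρ : LinearMap.ker Φ₀ →ₗ[R] LinearMap.ker φ :=
      (f ∘ₗ (LinearMap.ker Φ₀).subtype).codRestrict _ fun v ↦ by
        have hv : (α (red v.1)).1 = 0 := v.2
        exact (hα1 v.1).symm.trans (by rw [hv, map_zero])
    have hρ : Function.Surjective ρ := by
      rintro ⟨u, hu⟩
      obtain ⟨v, rfl⟩ := hf.surjective u
      obtain ⟨w, hw, -⟩ := hΦΨ ⟨Φ₀ v, (hα1 v).trans hu⟩ 0
      have hw' : Φ₀ w.1 = Φ₀ v := congrArg Subtype.val hw
      refine ⟨⟨v - w.1, by rw [LinearMap.mem_ker, map_sub, hw', sub_self]⟩, Subtype.ext ?_⟩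
      change f (v - w.1) = f v
      rw [map_sub, LinearMap.map_coe_ker, sub_zero]
    have hΦ₀ : FinPD R (LinearMap.ker Φ₀) := by
      let Φ₁ : (ι → R) →ₗ[R] (κ → S) :=
        { toFun := Φ₀
          map_add' := map_add Φ₀
          map_smul' := fun r v ↦ by
            rw [map_smulₛₗ, algebraMap_smul]; rfl }
      refine FinPD.ker (g := Φ₁) (fun b ↦ ?_) .of_projective (hS.finPD_pi κ)
      obtain ⟨w, hw⟩ := hαs (b, 0)
      obtain ⟨v, rfl⟩ := hred w
      exact ⟨v, congrArg Prod.fst hw⟩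
    let e : LinearMap.ker ρ ≃ₗ[R] LinearMap.ker Φ :=
      { toFun := fun v ↦ ⟨⟨v.1.1, congrArg Subtype.val v.2⟩, Subtype.ext v.1.2⟩
        map_add' := fun _ _ ↦ rfl
        map_smul' := fun _ _ ↦ rfl
        invFun := fun g ↦ ⟨⟨g.1.1, congrArg Subtype.val g.2⟩, Subtype.ext g.1.2⟩
        left_inv := fun _ ↦ rfl
        right_inv := fun _ ↦ rfl }
    exact (FinPD.ker hρ hΦ₀ h3).congr e

end Congr

end Hypersurface

/-! ### Syzygies of the residue field modulo a regular element -/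

section ResidueFieldSyzygies

variable {R S : Type u} [CommRing R] [IsLocalRing R] [IsNoetherianRing R]

lemma nonempty_firstSyzygy_residueField_equiv (R : Type u) [CommRing R] [IsLocalRing R]
    [IsNoetherianRing R] :
    Nonempty (firstSyzygy R (ModuleCat.of R (ResidueField R)) ≃ₗ[R] maximalIdeal R) := by
  obtain ⟨ι, _, f, hf, ⟨e⟩⟩ :=
    exists_isMinimalCover_firstSyzygy (ModuleCat.of R (ResidueField R))
  have hker : LinearMap.ker (Algebra.linearMap R (ResidueField R)) = maximalIdeal R := by
    ext r
    exact IsLocalRing.residue_eq_zero_iff r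
  have h : IsMinimalCover (Algebra.linearMap R (ResidueField R)) :=
    ⟨IsLocalRing.residue_surjective, by rw [hker, smul_eq_mul, Ideal.mul_top]⟩
  obtain ⟨e'⟩ := hf.nonempty_ker_equiv h (LinearEquiv.refl R (ResidueField R))
  exact ⟨(e.trans e').trans (LinearEquiv.ofEq _ _ hker)⟩

variable [CommRing S] [IsLocalRing S] [Algebra R S] {x : R}

/-- For `x ∈ 𝔪 ∖ 𝔪²`, the module `𝔪/x𝔪` is the direct sum of `𝔪/xR` and `xR/x𝔪 ≅ k`: a linear form
`𝔪/𝔪² → k` taking the value `1` at `x` provides the splitting. -/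
lemma splitsModulo_maximalIdeal (hS : IsQuotientByRegular S x) (hx : x ∉ maximalIdeal R ^ 2) :
    SplitsModulo (S := S) x (maximalIdeal R) (maximalIdeal S) (ResidueField S) := by
  have hloc : IsLocalHom (algebraMap R S) := .of_surjective _ hS.surjective
  have hx0 : algebraMap R S x = 0 := (hS.map_eq_zero_iff x).mpr dvd_rfl
  let φ : maximalIdeal R →ₛₗ[algebraMap R S] maximalIdeal S :=
    { toFun := fun r ↦ ⟨algebraMap R S r, map_nonunit _ _ r.2⟩
      map_add' := fun _ _ ↦ Subtype.ext (map_add _ _ _)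
      map_smul' := fun _ _ ↦ Subtype.ext (map_mul _ _ _) }
  obtain ⟨l, hl⟩ := Module.Projective.exists_dual_eq_one (ResidueField R)
    (x := (maximalIdeal R).toCotangent ⟨x, hS.mem⟩)
    (fun h ↦ hx ((Ideal.toCotangent_eq_zero _ _).mp h))
  let ψ : maximalIdeal R →ₛₗ[algebraMap R S] ResidueField S :=
    { toFun := fun r ↦ ResidueField.map (algebraMap R S) (l ((maximalIdeal R).toCotangent r))
      map_add' := fun _ _ ↦ by simp only [map_add]
      map_smul' := fun r a ↦ by
        have h1 : l ((maximalIdeal R).toCotangent (r • a)) =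
            residue R r * l ((maximalIdeal R).toCotangent a) := by
          rw [map_smul]
          exact ((l.restrictScalars R).map_smul r _).trans (Algebra.smul_def _ _)
        rw [h1, map_mul, ResidueField.map_residue]
        rfl }
  have hψ (s : R) : ψ (s • ⟨x, hS.mem⟩) = residue S (algebraMap R S s) := by
    rw [map_smulₛₗ, show ψ ⟨x, hS.mem⟩ = 1 by
      change ResidueField.map (algebraMap R S) (l _) = 1
      rw [hl, map_one]]
    exact (Algebra.smul_def _ _).trans (mul_one _)
  have hφ (s : R) : φ (s • ⟨x, hS.mem⟩) = 0 := by
    rw [map_smulₛₗ, show φ ⟨x, hS.mem⟩ = 0 from Subtype.ext hx0, smul_zero]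
  have hφx (a : maximalIdeal R) (ha : φ a = 0) : ∃ s : R, a = s • ⟨x, hS.mem⟩ := by
    obtain ⟨s, hs⟩ := (hS.map_eq_zero_iff a).mp (congrArg Subtype.val ha)
    exact ⟨s, Subtype.ext (hs.trans (mul_comm _ _))⟩
  refine ⟨hS.regular.of_injective (Submodule.subtype _) (Submodule.injective_subtype _), φ, ψ,
    fun b c ↦ ?_, fun a ha hb ↦ ?_, ?_⟩
  · obtain ⟨r, hr⟩ := hS.surjective b.1
    have hrm : r ∈ maximalIdeal R := fun hu ↦ b.2 (hr ▸ hu.map (algebraMap R S))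
    obtain ⟨c', hc'⟩ := residue_surjective (c - ψ ⟨r, hrm⟩)
    obtain ⟨s, rfl⟩ := hS.surjective c'
    refine ⟨⟨r, hrm⟩ + s • ⟨x, hS.mem⟩, ?_, ?_⟩
    · rw [map_add, hφ, add_zero]
      exact Subtype.ext hr
    · rw [map_add, hψ, hc', add_sub_cancel]
  · obtain ⟨s, rfl⟩ := hφx a ha
    rw [hψ, residue_eq_zero_iff] at hb
    exact ⟨⟨s, fun hu ↦ hb (hu.map _)⟩, Subtype.ext (mul_comm s x)⟩
  · refine FinPD.congr (A := R) (LinearEquiv.ofBijective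
      ((LinearMap.toSpanSingleton R (maximalIdeal R) ⟨x, hS.mem⟩).codRestrict _ hφ) ⟨?_, ?_⟩)
      .of_projective
    · intro s t hst
      refine hS.regular ?_
      have : s * x = t * x := congrArg (fun a ↦ (a.1.1 : R)) hst
      simpa [mul_comm] using this
    · rintro ⟨a, ha⟩
      obtain ⟨s, rfl⟩ := hφx a ha
      exact ⟨s, rfl⟩

variable [IsNoetherianRing S]

lemma SplitsModulo.syzygy (hS : IsQuotientByRegular S x) (n : ℕ) {A : ModuleCat.{u} R}
    {B C : ModuleCat.{u} S} [Module.Finite R A] [Module.Finite S B] [Module.Finite S C]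
    (h : SplitsModulo (S := S) x A B C) :
    SplitsModulo (S := S) x (syzygy R n A) (syzygy S n B) (syzygy S n C) := by
  induction n generalizing A B C with
  | zero => exact h
  | succ n ih =>
    obtain ⟨ι, _, f, hf, ⟨e⟩⟩ := exists_isMinimalCover_firstSyzygy A
    obtain ⟨κ, _, g, hg, ⟨e'⟩⟩ := exists_isMinimalCover_firstSyzygy B
    obtain ⟨l, _, k, hk, ⟨e''⟩⟩ := exists_isMinimalCover_firstSyzygy C
    exact ih ((h.ker hS hf hg hk).congr e.symm e'.symm e''.symm)

/-- For `x ∈ 𝔪 ∖ 𝔪²` regular, `Ω_R^{n+1}k / x ≅ Ω_{R/x}^{n+1}k ⊕ Ω_{R/x}^n k`. -/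
lemma splitsModulo_syzygy_residueField (hS : IsQuotientByRegular S x)
    (hx : x ∉ maximalIdeal R ^ 2) (n : ℕ) :
    SplitsModulo (S := S) x (syzygy R (n + 1) (ModuleCat.of R (ResidueField R)))
      (syzygy S (n + 1) (ModuleCat.of S (ResidueField S)))
      (syzygy S n (ModuleCat.of S (ResidueField S))) := by
  obtain ⟨e⟩ := nonempty_firstSyzygy_residueField_equiv R
  obtain ⟨e'⟩ := nonempty_firstSyzygy_residueField_equiv S
  refine SplitsModulo.syzygy (A := firstSyzygy R (ModuleCat.of R (ResidueField R)))
    (B := firstSyzygy S (ModuleCat.of S (ResidueField S))) hS n ?_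
  exact (splitsModulo_maximalIdeal hS hx).congr e.symm e'.symm (LinearEquiv.refl S _)

lemma exists_syzygy_residueField_map (hS : IsQuotientByRegular S x)
    (hx : x ∉ maximalIdeal R ^ 2) (n : ℕ) :
    ∃ φ : syzygy R n (ModuleCat.of R (ResidueField R)) →ₛₗ[algebraMap R S]
      syzygy S n (ModuleCat.of S (ResidueField S)),
      Function.Surjective φ ∧ FinPD R (LinearMap.ker φ) := by
  have hloc : IsLocalHom (algebraMap R S) := .of_surjective _ hS.surjective
  rcases n with _ | n
  · let φ : ResidueField R →ₛₗ[algebraMap R S] ResidueField S :=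
      { toFun := ResidueField.map (algebraMap R S)
        map_add' := map_add _
        map_smul' := fun r a ↦ by
          rw [Algebra.smul_def, map_mul, Algebra.smul_def]
          rfl }
    refine ⟨φ, fun b ↦ ?_, ?_⟩
    · obtain ⟨b, rfl⟩ := residue_surjective b
      obtain ⟨r, rfl⟩ := hS.surjective b
      exact ⟨residue R r, ResidueField.map_residue _ _⟩
    · have : Subsingleton (LinearMap.ker φ) := ⟨fun a b ↦ Subtype.ext
        (RingHom.injective (ResidueField.map (algebraMap R S)) (a.2.trans b.2.symm))⟩
      exact @FinPD.of_subsingleton R _ _ _ _ this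
  · obtain ⟨-, φ, ψ, h1, -, h3⟩ := splitsModulo_syzygy_residueField hS hx n
    exact ⟨φ, fun b ↦ (h1 b 0).imp fun _ h ↦ h.1, h3⟩

end ResidueFieldSyzygies

/-! ### Free summands of syzygies of the residue field -/

section Regularity

/-- Prime avoidance, for the associated primes of `M` and one further ideal. -/
lemma exists_isSMulRegular_notMem {R : Type u} [CommRing R] [IsNoetherianRing R] {𝔪 I : Ideal R}
    {M : Type u} [AddCommGroup M] [Module R M] [Module.Finite R M]
    (hM : ∃ x ∈ 𝔪, IsSMulRegular M x) (hI : ¬ 𝔪 ≤ I) :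
    ∃ x ∈ 𝔪, IsSMulRegular M x ∧ x ∉ I := by
  by_contra! hcon
  have hreg := biUnion_associatedPrimes_eq_compl_regular R M
  have hsub : (𝔪 : Set R) ⊆ ⋃ p ∈ insert I (associatedPrimes R M), (p : Set R) := by
    intro x hx
    rw [Set.biUnion_insert, hreg]
    by_cases hxr : IsSMulRegular M x
    · exact .inl (hcon x hx hxr)
    · exact .inr hxr
  obtain ⟨p, hp, hle⟩ := (Ideal.subset_union_prime_finite
    ((associatedPrimes.finite R M).insert I) (f := id) I I
    (fun i hi hia _ ↦ ((Set.mem_insert_iff.mp hi).resolve_left hia).1)).mp hsub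
  rcases Set.mem_insert_iff.mp hp with rfl | hp
  · exact hI hle
  · obtain ⟨x, hx, hxr⟩ := hM
    have : x ∈ {r : R | IsSMulRegular M r}ᶜ := by
      rw [← hreg]
      exact Set.mem_biUnion hp (hle hx)
    exact this hxr

lemma exists_smul_eq_zero_of_forall_not_isSMulRegular {R : Type u} [CommRing R] [IsLocalRing R]
    [IsNoetherianRing R] {M : Type u} [AddCommGroup M] [Module R M] [Module.Finite R M]
    [Nontrivial M] (hM : ∀ x ∈ maximalIdeal R, ¬ IsSMulRegular M x) :
    ∃ m : M, m ≠ 0 ∧ ∀ x ∈ maximalIdeal R, x • m = 0 := by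
  have hreg := biUnion_associatedPrimes_eq_compl_regular R M
  have hsub : (maximalIdeal R : Set R) ⊆ ⋃ p ∈ associatedPrimes R M, (p : Set R) := by
    rw [hreg]
    exact hM
  obtain ⟨p, hp, hle⟩ := (Ideal.subset_union_prime_finite
    (associatedPrimes.finite R M) (f := id) ⊤ ⊤ (fun i hi _ _ ↦ hi.1)).mp hsub
  obtain ⟨hpp, m, hm⟩ := isAssociatedPrime_iff.mp hp
  refine ⟨m, ?_, fun x hx ↦ ?_⟩
  · rintro rfl
    exact hpp.ne_top (by simp [hm])
  · have : x ∈ p := hle hx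
    rw [hm] at this
    simpa [Submodule.mem_colon_singleton] using this

lemma surjective_of_isUnit {R : Type u} [CommRing R] {X : Type u} [AddCommGroup X] [Module R X]
    (f : X →ₗ[R] R) {x : X} (hx : IsUnit (f x)) : Function.Surjective f := fun s ↦ by
  obtain ⟨t, ht⟩ := hx.exists_left_inv
  exact ⟨(s * t) • x, by rw [map_smul, smul_eq_mul, mul_assoc, ht, mul_one]⟩

variable {R S : Type u} [CommRing R] [IsLocalRing R] [IsNoetherianRing R]

lemma isRegularLocalRing_of_maximalIdeal_eq_bot (h : maximalIdeal R = ⊥) :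
    IsRegularLocalRing R := by
  refine .of_spanFinrank_maximalIdeal_le _ ?_
  rw [h, Submodule.spanFinrank_bot]
  exact ringKrullDim_nonneg_of_nontrivial

lemma not_maximalIdeal_le_sq {x : R} (hx : x ∈ maximalIdeal R) (hreg : IsSMulRegular R x) :
    ¬ maximalIdeal R ≤ maximalIdeal R ^ 2 := by
  intro h
  have h0 : maximalIdeal R = ⊥ := Submodule.eq_bot_of_le_smul_of_le_jacobson_bot (maximalIdeal R) _
    (IsNoetherian.noetherian _) (by rwa [smul_eq_mul, ← sq]) (IsLocalRing.maximalIdeal_le_jacobson _)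
  rw [h0, Ideal.mem_bot] at hx
  subst hx
  exact one_ne_zero (hreg (a₁ := (1 : R)) (a₂ := 0) (by simp))

omit [IsNoetherianRing R] in
lemma isQuotientByRegular_quotient {x : R} (hx : x ∈ maximalIdeal R) (hreg : IsSMulRegular R x) :
    IsQuotientByRegular (R ⧸ Ideal.span {x}) x :=
  ⟨hx, hreg, Ideal.Quotient.mk_surjective, fun _ ↦
    Ideal.Quotient.eq_zero_iff_mem.trans Ideal.mem_span_singleton⟩

omit [IsNoetherianRing R] in
lemma isLocalRing_quotient {I : Ideal R} (hI : I ≤ maximalIdeal R) : IsLocalRing (R ⧸ I) :=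
  have : Nontrivial (R ⧸ I) := Ideal.Quotient.nontrivial_iff.mpr
    (ne_top_of_le_ne_top (maximalIdeal.isMaximal R).ne_top hI)
  .of_surjective' (Ideal.Quotient.mk _) Ideal.Quotient.mk_surjective

variable [CommRing S] [IsLocalRing S] [Algebra R S] {x : R}

omit [IsLocalRing S] in
lemma IsQuotientByRegular.ringKrullDim_add_one (hS : IsQuotientByRegular S x) :
    ringKrullDim S + 1 = ringKrullDim R := by
  have hker : RingHom.ker (algebraMap R S) = Ideal.span {x} := by
    ext r
    rw [RingHom.mem_ker, hS.map_eq_zero_iff, Ideal.mem_span_singleton]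
  rw [← ringKrullDim_quotient_span_singleton_succ_eq_ringKrullDim hS.regular hS.mem, ← hker,
    ringKrullDim_eq_of_ringEquiv (RingHom.quotientKerEquivOfSurjective hS.surjective)]

/-- If `R/x` is regular, then so is `R`: lifts of generators of the maximal ideal of `R/x`, together
with `x`, generate the maximal ideal of `R`. -/
lemma IsQuotientByRegular.isRegularLocalRing (hS : IsQuotientByRegular S x)
    (h : IsRegularLocalRing S) : IsRegularLocalRing R := by
  have hloc : IsLocalHom (algebraMap R S) := .of_surjective _ hS.surjective
  have hfg : Submodule.FG (maximalIdeal S) := IsNoetherian.noetherian _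
  choose lift hlift using hS.surjective
  let G := (Submodule.generators (maximalIdeal S))
  have hG : G.Finite := hfg.finite_generators
  have hspan : maximalIdeal R = Submodule.span R (insert x (lift '' G)) := by
    refine le_antisymm (fun r hr ↦ ?_) ?_
    · have h1 : algebraMap R S r ∈ Ideal.map (algebraMap R S) (Ideal.span (lift '' G)) := by
        rw [Ideal.map_span, ← Set.image_comp]
        have h2 : algebraMap R S ∘ lift = id := funext hlift
        rw [h2, Set.image_id]
        have : Ideal.span G = maximalIdeal S := Submodule.span_generators _
        rw [this]
        exact map_nonunit _ _ hr
      obtain ⟨t, ht, htr⟩ := (Ideal.mem_map_iff_of_surjective _ hS.surjective).mp h1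
      obtain ⟨s, hs⟩ := (hS.map_eq_zero_iff (r - t)).mp (by rw [map_sub, htr, sub_self])
      rw [← sub_add_cancel r t, hs]
      refine add_mem ?_ (Submodule.span_mono (Set.subset_insert _ _) ht)
      exact Ideal.mul_mem_right _ _ (Submodule.subset_span (Set.mem_insert _ _))
    · refine Submodule.span_le.mpr (Set.insert_subset hS.mem ?_)
      rintro _ ⟨g, hg, rfl⟩ hu
      have h3 : g ∈ maximalIdeal S := Submodule.FG.generators_mem _ hg
      exact h3 (hlift g ▸ hu.map (algebraMap R S))
  refine .of_spanFinrank_maximalIdeal_le _ ?_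
  have h4 : (maximalIdeal R).spanFinrank ≤ (maximalIdeal S).spanFinrank + 1 := by
    rw [hspan]
    refine (Submodule.spanFinrank_span_le_ncard_of_finite ((hG.image lift).insert x)).trans ?_
    refine (Set.ncard_insert_le _ _).trans (Nat.succ_le_succ ?_)
    rw [← hfg.generators_ncard]
    exact Set.ncard_image_le hG
  rw [← hS.ringKrullDim_add_one, ← (isRegularLocalRing_iff S).mp h]
  exact_mod_cast h4

/-- A linear form on `Ω_R^n k` with values in `R/x` factors through the summands `Ω_{R/x}^n k` and
`Ω_{R/x}^{n-1} k`, and one of its restrictions is surjective if it is surjective. -/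
lemma isRegularLocalRing_of_surjective_of_quotient [IsNoetherianRing S]
    (hS : IsQuotientByRegular S x) (hx : x ∉ maximalIdeal R ^ 2)
    (ih : ∀ n, ∀ f : syzygy S n (ModuleCat.of S (ResidueField S)) →ₗ[S] S,
      Function.Surjective f → IsRegularLocalRing S) (n : ℕ)
    (g : syzygy R n (ModuleCat.of R (ResidueField R)) →ₛₗ[algebraMap R S] S)
    (hg : Function.Surjective g) : IsRegularLocalRing R := by
  have hx0 : algebraMap R S x = 0 := (hS.map_eq_zero_iff x).mpr dvd_rfl
  refine hS.isRegularLocalRing ?_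
  obtain ⟨a, ha⟩ := hg 1
  rcases n with _ | n
  · refine isRegularLocalRing_of_maximalIdeal_eq_bot (eq_bot_iff.mpr fun s hs ↦ ?_)
    obtain ⟨r, rfl⟩ := hS.surjective s
    have hr : r ∈ maximalIdeal R := fun hu ↦ hs (hu.map (algebraMap R S))
    rw [Ideal.mem_bot, ← mul_one (algebraMap R S r), ← ha, ← smul_eq_mul, ← map_smulₛₗ]
    rw [show r • a = 0 from maximalIdeal_smul_residueField hr a, map_zero]
  · obtain ⟨-, φ, ψ, h1, h2, -⟩ := splitsModulo_syzygy_residueField hS hx n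
    choose p hp using h1
    have key {a b} (hφ : φ a = φ b) (hψ : ψ a = ψ b) : g a = g b := by
      obtain ⟨c, hc⟩ := h2 (a - b) (by rw [map_sub, hφ, sub_self]) (by rw [map_sub, hψ, sub_self])
      rw [← sub_eq_zero, ← map_sub, hc, map_smulₛₗ, hx0, zero_smul]
    let u : syzygy S (n + 1) (ModuleCat.of S (ResidueField S)) →ₗ[S] S :=
      { toFun := fun b ↦ g (p b 0)
        map_add' := fun b b' ↦ by
          rw [← map_add]
          exact key (by rw [map_add, (hp _ _).1, (hp _ _).1, (hp _ _).1])
            (by rw [map_add, (hp _ _).2, (hp _ _).2, (hp _ _).2, add_zero])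
        map_smul' := fun s b ↦ by
          obtain ⟨r, rfl⟩ := hS.surjective s
          rw [RingHom.id_apply, ← map_smulₛₗ]
          exact key (by rw [map_smulₛₗ, (hp _ _).1, (hp _ _).1])
            (by rw [map_smulₛₗ, (hp _ _).2, (hp _ _).2, smul_zero]) }
    let v : syzygy S n (ModuleCat.of S (ResidueField S)) →ₗ[S] S :=
      { toFun := fun b ↦ g (p 0 b)
        map_add' := fun b b' ↦ by
          rw [← map_add]
          exact key (by rw [map_add, (hp _ _).1, (hp _ _).1, (hp _ _).1, add_zero])
            (by rw [map_add, (hp _ _).2, (hp _ _).2, (hp _ _).2])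
        map_smul' := fun s b ↦ by
          obtain ⟨r, rfl⟩ := hS.surjective s
          rw [RingHom.id_apply, ← map_smulₛₗ]
          exact key (by rw [map_smulₛₗ, (hp _ _).1, (hp _ _).1, smul_zero])
            (by rw [map_smulₛₗ, (hp _ _).2, (hp _ _).2]) }
    have huv : u (φ a) + v (ψ a) = 1 := by
      rw [← ha]
      change g (p (φ a) 0) + g (p 0 (ψ a)) = g a
      rw [← map_add]
      exact key (by rw [map_add, (hp _ _).1, (hp _ _).1, add_zero])
        (by rw [map_add, (hp _ _).2, (hp _ _).2, zero_add])
    rcases isUnit_or_isUnit_of_add_one huv with h | h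
    · exact ih _ u (surjective_of_isUnit u h)
    · exact ih _ v (surjective_of_isUnit v h)

/-- A socle element of `R` annihilates the syzygies `Ω_R^n k`, `n > 0`, as they lie in `𝔪F` for a
free module `F`. -/
lemma isRegularLocalRing_of_surjective_of_forall_not_isSMulRegular
    (hM : ∀ x ∈ maximalIdeal R, ¬ IsSMulRegular R x) (n : ℕ)
    (f : syzygy R n (ModuleCat.of R (ResidueField R)) →ₗ[R] R) (hf : Function.Surjective f) :
    IsRegularLocalRing R := by
  obtain ⟨a, ha⟩ := hf 1
  rcases n with _ | n
  · refine isRegularLocalRing_of_maximalIdeal_eq_bot (eq_bot_iff.mpr fun r hr ↦ ?_)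
    rw [Ideal.mem_bot, ← mul_one r, ← ha, ← smul_eq_mul, ← map_smul]
    rw [show r • a = 0 from maximalIdeal_smul_residueField hr a, map_zero]
  · obtain ⟨s, hs0, hs⟩ := exists_smul_eq_zero_of_forall_not_isSMulRegular hM
    refine absurd ?_ hs0
    rw [← mul_one s, ← ha, ← smul_eq_mul, ← map_smul]
    suffices h : s • a = 0 by rw [h, map_zero]
    suffices h : ∀ P : ModuleCat.{u} R,
        P = firstSyzygy R (syzygy R n (ModuleCat.of R (ResidueField R))) → ∀ a : P, s • a = 0 from
      h _ (syzygy_succ_eq n _) a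
    rintro _ rfl a
    obtain ⟨ι, _, g, hg, ⟨e⟩⟩ := exists_isMinimalCover_firstSyzygy
      (syzygy R n (ModuleCat.of R (ResidueField R)))
    refine e.injective (Subtype.ext (funext fun i ↦ ?_))
    rw [map_smul, map_zero]
    exact (mul_comm _ _).trans (hs _ (mem_smul_top_pi_iff.mp (hg.ker_le (e a).2) i))

/-- Dutta's theorem: if a syzygy of the residue field has a free direct summand, then the ring is
regular. -/
theorem isRegularLocalRing_of_surjective (R : Type u) [CommRing R] [IsLocalRing R]
    [IsNoetherianRing R] (n : ℕ) (f : syzygy R n (ModuleCat.of R (ResidueField R)) →ₗ[R] R)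
    (hf : Function.Surjective f) : IsRegularLocalRing R := by
  obtain ⟨d, hd⟩ : ∃ d : ℕ, ringKrullDim R ≤ d :=
    ⟨_, ringKrullDim_le_spanFinrank_maximalIdeal R⟩
  induction d generalizing R n with
  | zero =>
    refine isRegularLocalRing_of_surjective_of_forall_not_isSMulRegular (fun x hx hreg ↦ ?_) n f hf
    have h1 := (length_le_ringKrullDim (rs := [x]) (by simpa using hx) (by simpa using hreg)).trans hd
    simp only [List.length_cons, List.length_nil] at h1
    norm_cast at h1
  | succ d ih =>
    by_cases hM : ∃ x ∈ maximalIdeal R, IsSMulRegular R x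
    · obtain ⟨x, hx, hreg, hxn⟩ := exists_isSMulRegular_notMem hM
        (not_maximalIdeal_le_sq hM.choose_spec.1 hM.choose_spec.2)
      have hS := isQuotientByRegular_quotient hx hreg
      have : IsLocalRing (R ⧸ Ideal.span {x}) := isLocalRing_quotient
        ((Ideal.span_singleton_le_iff_mem _).mpr hx)
      have hd' : ringKrullDim (R ⧸ Ideal.span {x}) ≤ d := by
        rw [← ENat.WithBot.add_le_add_one_right_iff, hS.ringKrullDim_add_one]
        exact_mod_cast hd
      let π : R →ₛₗ[algebraMap R (R ⧸ Ideal.span {x})] R ⧸ Ideal.span {x} :=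
        { toFun := Ideal.Quotient.mk _
          map_add' := map_add _
          map_smul' := fun _ _ ↦ map_mul _ _ _ }
      exact isRegularLocalRing_of_surjective_of_quotient hS hxn
        (fun m g hg ↦ ih _ m g hg hd') n (π.comp f) (Ideal.Quotient.mk_surjective.comp hf)
    · push Not at hM
      exact isRegularLocalRing_of_surjective_of_forall_not_isSMulRegular hM n f hf

end Regularity

/-! ### Ext of syzygies -/

section ExtOfSyzygies

variable {R : Type u} [CommRing R]
variable {A B C Y : Type u} [AddCommGroup A] [Module R A] [AddCommGroup B] [Module R B]
  [AddCommGroup C] [Module R C] [AddCommGroup Y] [Module R Y]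
  {f : A →ₗ[R] B} {g : B →ₗ[R] C}

/-- The connecting homomorphism `Ext^i(A, Y) → Ext^{i+1}(C, Y)` of `0 → A → B → C → 0`. -/
noncomputable def extBoundary (Y : Type u) [AddCommGroup Y] [Module R Y]
    (hf : Function.Injective f) (hfg : Function.Exact f g)
    (hg : Function.Surjective g) (i : ℕ) : ExtMod R A Y i →ₗ[R] ExtMod R C Y (i + 1) where
  toFun e := (shortExact_of_exact hf hfg hg).extClass.comp e (add_comm 1 i)
  map_add' _ _ := Ext.comp_add _ _ _ _
  map_smul' _ _ := Ext.comp_smul _ _ _ _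

variable (hf : Function.Injective f) (hfg : Function.Exact f g) (hg : Function.Surjective g)
include hf hfg hg

lemma extBoundary_injective {i : ℕ} (hB : Subsingleton (ExtMod R B Y i)) :
    Function.Injective (extBoundary Y hf hfg hg i) := by
  refine (injective_iff_map_eq_zero _).mpr fun e he ↦ ?_
  obtain ⟨e', rfl⟩ := Ext.contravariant_sequence_exact₁ (shortExact_of_exact hf hfg hg) _ e
    (add_comm 1 i) he
  rw [Subsingleton.elim (α := ExtMod R B Y i) e' 0, Ext.comp_zero]

lemma extBoundary_surjective {i : ℕ} (hB : Subsingleton (ExtMod R B Y (i + 1))) :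
    Function.Surjective (extBoundary Y hf hfg hg i) := fun e ↦
  Ext.contravariant_sequence_exact₃ (shortExact_of_exact hf hfg hg) _ e
    (Subsingleton.elim (α := ExtMod R B Y (i + 1)) _ _) (add_comm 1 i)

lemma exists_extension_of_extBoundary_eq_zero (c : A →ₗ[R] Y)
    (hc : extBoundary Y hf hfg hg 0 ((extZeroEquiv R A Y).symm c) = 0) :
    ∃ c' : B →ₗ[R] Y, c' ∘ₗ f = c := by
  obtain ⟨e, he⟩ := Ext.contravariant_sequence_exact₁ (shortExact_of_exact hf hfg hg) _
    ((extZeroEquiv R A Y).symm c) (add_comm 1 0) hc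
  obtain ⟨b, rfl⟩ := (Ext.mk₀_bijective _ _).2 e
  rw [Ext.mk₀_comp_mk₀] at he
  have h1 : (extZeroEquiv R A Y).symm c = Ext.mk₀ (ModuleCat.ofHom c) := rfl
  rw [h1] at he
  have h2 := (Ext.mk₀_bijective _ _).1 he
  exact ⟨b.hom, congrArg ModuleCat.Hom.hom h2⟩

omit hf hfg hg

variable [IsLocalRing R]

lemma ext_firstSyzygy_subsingleton (M : ModuleCat.{u} R) [Module.Finite R M] {i : ℕ}
    (h : Subsingleton (ExtMod R M Y (i + 2))) :
    Subsingleton (ExtMod R (firstSyzygy R M) Y (i + 1)) := by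
  obtain ⟨ι, _, f, hf, ⟨e⟩⟩ := exists_isMinimalCover_firstSyzygy M
  exact ext_congr_left e.symm (ext_left_of_middle_right (Submodule.injective_subtype _)
    (LinearMap.exact_subtype_ker_map f) hf.surjective (ext_of_projective i) h)

variable [IsNoetherianRing R]

lemma ext_syzygy_subsingleton (n : ℕ) (M : ModuleCat.{u} R) [Module.Finite R M] {i : ℕ}
    (h : Subsingleton (ExtMod R M Y (i + n + 1))) :
    Subsingleton (ExtMod R (syzygy R n M) Y (i + 1)) := by
  induction n generalizing M with
  | zero => exact h
  | succ n ih => exact ih (firstSyzygy R M) (ext_firstSyzygy_subsingleton M h)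

/-- `Ext^i(M, Y)` is zero or isomorphic to the residue field. -/
def IsResidualExt (R : Type u) [CommRing R] [IsLocalRing R] (M Y : Type u) [AddCommGroup M]
    [Module R M] [AddCommGroup Y] [Module R Y] (i : ℕ) : Prop :=
  IsCyclicModule R (ExtMod R M Y i) ∧ ∀ x ∈ maximalIdeal R, ∀ e : ExtMod R M Y i, x • e = 0

omit [IsNoetherianRing R] in
lemma IsResidualExt.firstSyzygy {M : ModuleCat.{u} R} [Module.Finite R M] {i : ℕ}
    (h : IsResidualExt R M Y (i + 2)) : IsResidualExt R (firstSyzygy R M) Y (i + 1) := by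
  obtain ⟨ι, _, f, hf, ⟨e⟩⟩ := exists_isMinimalCover_firstSyzygy M
  have hex : Function.Exact ((LinearMap.ker f).subtype ∘ₗ e.toLinearMap) f := by
    intro v
    refine ⟨fun hv ↦ ⟨e.symm ⟨v, hv⟩, by simp⟩, ?_⟩
    rintro ⟨a, rfl⟩
    exact (e a).2
  have hinj : Function.Injective ((LinearMap.ker f).subtype ∘ₗ e.toLinearMap) :=
    (Submodule.injective_subtype _).comp e.injective
  have h1 := extBoundary_injective hinj hex hf.surjective (ext_of_projective (M := Y) i)
  have h2 := extBoundary_surjective hinj hex hf.surjective (ext_of_projective (M := Y) (i + 1))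
  let E := LinearEquiv.ofBijective _ ⟨h1, h2⟩
  refine ⟨h.1.of_surjective E.symm.toLinearMap E.symm.surjective, fun x hx e ↦ E.injective ?_⟩
  rw [map_smul, map_zero]
  exact h.2 x hx _

lemma IsResidualExt.syzygy (n : ℕ) {M : ModuleCat.{u} R} [Module.Finite R M] {i : ℕ}
    (h : IsResidualExt R M Y (i + n + 1)) : IsResidualExt R (syzygy R n M) Y (i + 1) := by
  induction n generalizing M with
  | zero => exact h
  | succ n ih => exact ih (IsResidualExt.firstSyzygy (i := i + n) h)

end ExtOfSyzygies

/-! ### Vanishing of the delta invariant -/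

section Delta

variable {R : Type u} [CommRing R] [IsLocalRing R]
variable {X N M : Type u} [AddCommGroup X] [Module R X] [AddCommGroup N] [Module R N]
  [AddCommGroup M] [Module R M]

omit [IsLocalRing R] in
lemma exists_factor_of_ker_le {p : X →ₗ[R] N} (hp : Function.Surjective p) (g : X →ₗ[R] M)
    (h : LinearMap.ker p ≤ LinearMap.ker g) : ∃ g' : N →ₗ[R] M, g' ∘ₗ p = g := by
  refine ⟨(LinearMap.ker p).liftQ g h ∘ₗ (p.quotKerEquivOfSurjective hp).symm.toLinearMap, ?_⟩
  ext x
  have : (p.quotKerEquivOfSurjective hp).symm (p x) = (LinearMap.ker p).mkQ x := by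
    rw [LinearEquiv.symm_apply_eq]; rfl
  simp [this]

/-- The kernel of a minimal approximation of a module `N` with `Ext^1(N, R)` zero or `k` and
`Ext^i(N, R) = 0` for `i > 1` is free of rank at most one: if a coordinate form of the kernel extended
to `X`, it would take the value `1` on the kernel, so its image in `Ext^1(N, R)` generates. -/
lemma exists_generator_ker [IsNoetherianRing R] [Module.Finite R X] {p : X →ₗ[R] N}
    (hp : Function.Surjective p) (hk : FinPD R (LinearMap.ker p))
    (hX : ∀ i, Subsingleton (ExtMod R X R (i + 1)))
    (hN : ∀ i, Subsingleton (ExtMod R N R (i + 2))) (hN1 : IsResidualExt R N R 1)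
    (hmin : ∀ f : X →ₗ[R] R, ∀ y ∈ LinearMap.ker p, f y ≠ 1) :
    LinearMap.ker p = ⊥ ∨ ∃ y ∈ LinearMap.ker p, LinearMap.ker p ≤ Submodule.span R {y} ∧
      ∀ b ∈ maximalIdeal R, ∃ f : X →ₗ[R] R, f y = b := by
  have hinj := Submodule.injective_subtype (LinearMap.ker p)
  have hex := LinearMap.exact_subtype_ker_map p
  have : Module.Projective R (LinearMap.ker p) := projective_of_finPD
    (fun i ↦ ext_left_of_middle_right hinj hex hp (hX i) (hN i)) hk
  have : Module.Free R (LinearMap.ker p) := Module.free_of_flat_of_isLocalRing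
  let b := Module.Free.chooseBasis R (LinearMap.ker p)
  let δ : (LinearMap.ker p →ₗ[R] R) →ₗ[R] ExtMod R N R 1 :=
    extBoundary R hinj hex hp 0 ∘ₗ (extZeroEquiv R _ _).symm.toLinearMap
  have hδ (c : LinearMap.ker p →ₗ[R] R) (hc : δ c = 0) :
      ∃ f : X →ₗ[R] R, ∀ v : LinearMap.ker p, f v = c v := by
    obtain ⟨f, hf⟩ := exists_extension_of_extBoundary_eq_zero hinj hex hp c hc
    exact ⟨f, LinearMap.congr_fun hf⟩
  -- two coordinate forms would differ by a unit multiple modulo the forms that extend to `X`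
  obtain ⟨e, he⟩ := hN1.1
  choose r hr using fun i ↦ he (δ (b.coord i))
  have hunit (i) : IsUnit (r i) := by
    by_contra hri
    obtain ⟨f, hf⟩ := hδ (b.coord i) (by rw [← hr]; exact hN1.2 _ hri _)
    exact hmin f (b i) (b i).2 ((hf _).trans (by simp))
  have hss : Subsingleton (Module.Free.ChooseBasisIndex R (LinearMap.ker p)) := by
    refine ⟨fun i j ↦ ?_⟩
    by_contra hij
    obtain ⟨u, hu⟩ := hunit j
    obtain ⟨f, hf⟩ := hδ (b.coord i - (r i * ↑u⁻¹) • b.coord j) (by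
      rw [map_sub, map_smul, ← hr, ← hr, smul_smul, mul_assoc, ← hu, Units.inv_mul, mul_one,
        sub_self])
    exact hmin f (b i) (b i).2 ((hf _).trans (by simp [hij]))
  rcases isEmpty_or_nonempty (Module.Free.ChooseBasisIndex R (LinearMap.ker p)) with h | ⟨⟨i⟩⟩
  · left
    rw [← Submodule.subsingleton_iff_eq_bot]
    exact b.repr.toEquiv.subsingleton
  · right
    refine ⟨b i, (b i).2, fun v hv ↦ ?_, fun c hc ↦ ?_⟩
    · have := b.sum_repr ⟨v, hv⟩
      have huniv : (Finset.univ : Finset (Module.Free.ChooseBasisIndex R (LinearMap.ker p))) = {i} :=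
        Finset.eq_singleton_iff_unique_mem.mpr ⟨Finset.mem_univ _, fun _ _ ↦ Subsingleton.elim _ _⟩
      rw [huniv, Finset.sum_singleton] at this
      exact Submodule.mem_span_singleton.mpr ⟨_, congrArg Subtype.val this⟩
    · obtain ⟨f, hf⟩ := hδ (c • b.coord i) (by rw [map_smul]; exact hN1.2 c hc _)
      exact ⟨f, (hf _).trans (by simp)⟩

/-- The delta invariant of `Ω_R^{d-1} k` vanishes over a nonregular Gorenstein local ring `R` of
dimension `d`: its minimal approximation has no free direct summand. -/
theorem not_surjective_of_minimal_syzygy [IsNoetherianRing R] [Module.Finite R X] {rs : List R}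
    (h : IsGorensteinSequence R rs) {n : ℕ} (hn : rs.length = n + 1)
    (hreg : ¬ IsRegularLocalRing R)
    {p : X →ₗ[R] syzygy R n (ModuleCat.of R (ResidueField R))}
    (hp : Function.Surjective p) (hk : FinPD R (LinearMap.ker p))
    (hX : ∀ i, Subsingleton (ExtMod R X R (i + 1)))
    (hmin : ∀ f : X →ₗ[R] R, ∀ y ∈ LinearMap.ker p, f y ≠ 1) (f : X →ₗ[R] R) :
    ¬ Function.Surjective f := by
  intro hf
  -- a linear form on `X` which vanishes on `ker p` is not surjective, by Dutta's theorem
  have dutta (g : X →ₗ[R] R) (hg : LinearMap.ker p ≤ LinearMap.ker g) :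
      ¬ Function.Surjective g := by
    intro hgs
    obtain ⟨g', rfl⟩ := exists_factor_of_ker_le hp g hg
    exact hreg (isRegularLocalRing_of_surjective R n g' (Function.Surjective.of_comp (g := p) hgs))
  rcases exists_generator_ker hp hk hX
    (fun i ↦ ext_syzygy_subsingleton (i := i + 1) n _ (h.ext_subsingleton _ (by lia) _))
    (IsResidualExt.syzygy (i := 0) n
      (by
        have := h.isCyclic
        rw [hn] at this
        rw [zero_add]
        exact ⟨this, fun x hx e ↦ ext_smul_eq_zero (fun m ↦ maximalIdeal_smul_residueField hx m) e⟩))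
    hmin with h0 | ⟨y, hy, hyspan, hext⟩
  · exact dutta f (h0 ▸ bot_le) hf
  have hle {M : Type u} [AddCommGroup M] [Module R M] (g : X →ₗ[R] M) (hg : g y = 0) :
      LinearMap.ker p ≤ LinearMap.ker g :=
    hyspan.trans ((Submodule.span_singleton_le_iff_mem _ _).mpr hg)
  -- the values at `y` of the linear forms on `X` without unit values
  let T : Ideal R := Submodule.map (LinearMap.applyₗ y)
    (⨅ x : X, Submodule.comap (LinearMap.applyₗ x) (maximalIdeal R))
  have hT {b : R} : b ∈ T ↔ ∃ f : X →ₗ[R] R, (∀ x, f x ∈ maximalIdeal R) ∧ f y = b := by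
    simp [T]
  -- in particular, an element outside `T` is not in `𝔪²`
  have hsq : maximalIdeal R ^ 2 ≤ T := by
    rw [sq, Ideal.mul_le]
    intro a ha b hb
    obtain ⟨g, rfl⟩ := hext b hb
    exact hT.mpr ⟨a • g, fun x ↦ Ideal.mul_mem_right _ _ ha, rfl⟩
  have hTm : maximalIdeal R ≤ T := by
    by_contra hcon
    have hex : ∃ x ∈ maximalIdeal R, IsSMulRegular R x := by
      obtain ⟨r, rs', rfl⟩ := List.exists_cons_of_length_eq_add_one hn
      exact ⟨r, h.mem r (by simp), ((isWeaklyRegular_cons_iff _ _ _).mp h.isWeaklyRegular).1⟩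
    obtain ⟨b, hb, hbreg, hbT⟩ := exists_isSMulRegular_notMem hex hcon
    have hS := isQuotientByRegular_quotient hb hbreg
    have : IsLocalRing (R ⧸ Ideal.span {b}) := isLocalRing_quotient
      ((Ideal.span_singleton_le_iff_mem _).mpr hb)
    obtain ⟨g, hg⟩ := hext b hb
    obtain ⟨x, hx⟩ : ∃ x, IsUnit (g x) := by
      by_contra! hcon'
      exact hbT (hT.mpr ⟨g, hcon', hg⟩)
    let g₁ : X →ₗ[R] R ⧸ Ideal.span {b} := (Ideal.span {b}).mkQ ∘ₗ g
    obtain ⟨g', hg'⟩ := exists_factor_of_ker_le hp g₁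
      (hle g₁ ((Submodule.Quotient.mk_eq_zero _).mpr
        (by rw [hg]; exact Ideal.mem_span_singleton_self b)))
    have hg₁ : Function.Surjective g₁ :=
      (Submodule.mkQ_surjective _).comp (surjective_of_isUnit g hx)
    let g'' : syzygy R n (ModuleCat.of R (ResidueField R)) →ₛₗ[algebraMap R (R ⧸ Ideal.span {b})]
        R ⧸ Ideal.span {b} :=
      { toFun := g'
        map_add' := map_add g'
        map_smul' := fun r a ↦ by
          rw [map_smul, Algebra.smul_def, smul_eq_mul] }
    refine hreg (isRegularLocalRing_of_surjective_of_quotient hS (fun hb2 ↦ hbT (hsq hb2))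
      (isRegularLocalRing_of_surjective _) n g'' ?_)
    rw [← hg'] at hg₁
    exact Function.Surjective.of_comp (g := p) hg₁
  -- so `f` can be corrected to vanish at `y` without changing its values modulo `𝔪`
  have hfy : f y ∈ maximalIdeal R := by
    intro hu
    obtain ⟨t, ht⟩ := IsUnit.exists_left_inv hu
    exact hmin (t • f) y hy ht
  obtain ⟨f', hf', hfy'⟩ := hT.mp (hTm hfy)
  obtain ⟨x, hx⟩ := hf 1
  refine dutta (f - f') (hle _ (by rw [LinearMap.sub_apply, hfy', sub_self]))
    (surjective_of_isUnit _ (x := x) ?_)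
  rw [LinearMap.sub_apply, hx]
  exact IsLocalRing.isUnit_one_sub_self_of_mem_nonunits _ (hf' x)

end Delta

/-! ### Systems of parameters of Gorenstein rings -/

section SystemsOfParameters

variable {R : Type u} [CommRing R] [IsLocalRing R] [IsNoetherianRing R]

omit [IsLocalRing R] [IsNoetherianRing R] in
lemma ext_quotSMulTop_subsingleton {N M : Type u} [AddCommGroup N] [Module R N] [AddCommGroup M]
    [Module R M] {x : R} (hx : IsSMulRegular M x) {t : ℕ}
    (h : ∀ i < t + 1, Subsingleton (ExtMod R N M i)) :
    ∀ i < t, Subsingleton (ExtMod R N (QuotSMulTop x M) i) := fun i hi ↦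
  ext_covariant_right (lsmul_injective_of_isSMulRegular hx) (exact_lsmul_mkQ x)
    (Submodule.mkQ_surjective _) (h (i + 1) (by lia)) (h i (by lia))

lemma exists_isSMulRegular_of_subsingleton {M : Type u} [AddCommGroup M] [Module R M]
    [Module.Finite R M] [Nontrivial M] (h : Subsingleton (ExtMod R (ResidueField R) M 0)) :
    ∃ x ∈ maximalIdeal R, IsSMulRegular M x := by
  by_contra! hcon
  obtain ⟨m, hm, hm'⟩ := exists_smul_eq_zero_of_forall_not_isSMulRegular hcon
  obtain ⟨ψ, hψ⟩ := exists_residueField_map_one_eq hm'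
  have := ext_zero_subsingleton_iff.mp h
  exact hm (by rw [← hψ, Subsingleton.elim ψ 0, LinearMap.zero_apply])

/-- If `x` is `M`-regular and `P` is an associated prime of `M`, then some associated prime of
`M/xM` contains `P` and `x`: by Nakayama's lemma, the elements killed by `P` do not all lie in
`xM`. -/
lemma exists_isAssociatedPrime_quotSMulTop {M : Type u} [AddCommGroup M] [Module R M]
    [Module.Finite R M] {x : R} (hx : x ∈ maximalIdeal R) (hreg : IsSMulRegular M x)
    {P : Ideal R} (hP : IsAssociatedPrime P M) :
    ∃ Q : Ideal R, IsAssociatedPrime Q (QuotSMulTop x M) ∧ P ≤ Q ∧ x ∈ Q ∧ x ∉ P := by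
  obtain ⟨hPp, m, hm⟩ := isAssociatedPrime_iff.mp hP
  have hPm {r : R} : r ∈ P ↔ r • m = 0 := by
    rw [hm, Submodule.mem_colon_singleton, Submodule.mem_bot]
  have hm0 : m ≠ 0 := by
    rintro rfl
    exact hPp.ne_top (by simp [hm])
  have hxP : x ∉ P := fun h ↦
    hm0 (isSMulRegular_iff_right_eq_zero_of_smul.mp hreg m (hPm.mp h))
  let V : Submodule R M := ⨅ r : P, LinearMap.ker (LinearMap.lsmul R M (r : R))
  have hV {v : M} : v ∈ V ↔ ∀ r ∈ P, r • v = 0 := by simp [V]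
  -- `V ⊆ xM` would imply `V = xV`, as `x` is regular
  obtain ⟨v, hv, hvx⟩ : ∃ v ∈ V, v ∉ x • (⊤ : Submodule R M) := by
    by_contra! hcon
    have h0 : V = ⊥ := by
      refine Submodule.eq_bot_of_le_smul_of_le_jacobson_bot (maximalIdeal R) _
        (IsNoetherian.noetherian _) (fun v hv ↦ ?_) (IsLocalRing.maximalIdeal_le_jacobson _)
      obtain ⟨w, -, rfl⟩ := (Submodule.mem_smul_pointwise_iff_exists _ _ _).mp (hcon v hv)
      refine Submodule.smul_mem_smul hx (hV.mpr fun r hr ↦ ?_)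
      refine isSMulRegular_iff_right_eq_zero_of_smul.mp hreg _ ?_
      rw [smul_comm]
      exact hV.mp hv r hr
    have : m ∈ V := hV.mpr fun r hr ↦ hPm.mp hr
    rw [h0] at this
    exact hm0 this
  obtain ⟨Q, hQ, hle⟩ := exists_le_isAssociatedPrime_of_isNoetherianRing R
    (Submodule.Quotient.mk v : QuotSMulTop x M)
    (fun h ↦ hvx ((Submodule.Quotient.mk_eq_zero _).mp h))
  have hmem (r : R) (hr : r • v ∈ x • (⊤ : Submodule R M)) : r ∈ Q := by
    refine hle (Submodule.mem_colon_singleton.mpr ?_)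
    rw [← Submodule.Quotient.mk_smul]
    exact (Submodule.Quotient.mk_eq_zero _).mpr hr
  refine ⟨Q, hQ, fun r hr ↦ hmem r ?_, hmem x (Submodule.smul_mem_pointwise_smul _ _ _ trivial),
    hxP⟩
  rw [hV.mp hv r hr]
  exact zero_mem _

/-- The depth of `M`, measured by the vanishing of `Ext(k, M)`, is at most `dim R/P` for all
associated primes `P` of `M`. -/
lemma le_ringKrullDim_quotient_of_isAssociatedPrime (t : ℕ) {M : Type u} [AddCommGroup M]
    [Module R M] [Module.Finite R M] (h : ∀ i < t, Subsingleton (ExtMod R (ResidueField R) M i))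
    {P : Ideal R} (hP : IsAssociatedPrime P M) : (t : WithBot ℕ∞) ≤ ringKrullDim (R ⧸ P) := by
  induction t generalizing M P with
  | zero =>
    have : Nontrivial (R ⧸ P) := Ideal.Quotient.nontrivial_iff.mpr hP.isPrime.ne_top
    exact ringKrullDim_nonneg_of_nontrivial
  | succ t ih =>
    have : Nontrivial M := by
      by_contra hcon
      rw [not_nontrivial_iff_subsingleton] at hcon
      exact not_isAssociatedPrime_of_subsingleton hP
    obtain ⟨x, hx, hreg⟩ := exists_isSMulRegular_of_subsingleton (h 0 (by lia))
    obtain ⟨Q, hQ, hPQ, hxQ, hxP⟩ := exists_isAssociatedPrime_quotSMulTop hx hreg hP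
    have h1 := ih (ext_quotSMulTop_subsingleton hreg h) hQ
    have : P.IsPrime := hP.isPrime
    have h2 : ringKrullDim ((R ⧸ P) ⧸ Ideal.span {Ideal.Quotient.mk P x}) + 1 ≤
        ringKrullDim (R ⧸ P) := by
      refine ringKrullDim_quotient_succ_le_of_nonZeroDivisor (mem_nonZeroDivisors_of_ne_zero ?_)
      rwa [Ne, Ideal.Quotient.eq_zero_iff_mem]
    have h3 : ringKrullDim (R ⧸ Q) ≤
        ringKrullDim ((R ⧸ P) ⧸ Ideal.span {Ideal.Quotient.mk P x}) := by
      refine ringKrullDim_le_of_surjective (Ideal.Quotient.lift _ (Ideal.Quotient.factor hPQ) ?_)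
        (Ideal.Quotient.lift_surjective_of_surjective _ _ (Ideal.Quotient.factor_surjective hPQ))
      intro a ha
      obtain ⟨b, rfl⟩ := Ideal.mem_span_singleton.mp ha
      rw [map_mul, Ideal.Quotient.factor_mk, Ideal.Quotient.eq_zero_iff_mem.mpr hxQ, zero_mul]
    push_cast
    exact (add_le_add_left (h1.trans h3) 1).trans h2

lemma ringKrullDim_quotient_le_length {P : Ideal R} [P.IsPrime] {xs : List R}
    (hmem : ∀ x ∈ xs, x ∈ maximalIdeal R)
    (h : ∀ p : Ideal R, p.IsPrime → P ≤ p → (∀ x ∈ xs, x ∈ p) → p = maximalIdeal R) :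
    ringKrullDim (R ⧸ P) ≤ xs.length := by
  classical
  have hPm : P ≤ maximalIdeal R := le_maximalIdeal (Ideal.IsPrime.ne_top ‹_›)
  have := isLocalRing_quotient hPm
  let s : Finset (R ⧸ P) := (xs.map (Ideal.Quotient.mk P)).toFinset
  have hs {x} (hx : x ∈ xs) : Ideal.Quotient.mk P x ∈ Ideal.span (s : Set (R ⧸ P)) :=
    Ideal.subset_span (by simpa [s] using ⟨x, hx, rfl⟩)
  have h0 : Ring.KrullDimLE 0 ((R ⧸ P) ⧸ Ideal.span (s : Set (R ⧸ P))) := by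
    refine krullDimLE_zero_of_surjective ((Ideal.Quotient.mk _).comp (Ideal.Quotient.mk P))
      (Ideal.Quotient.mk_surjective.comp Ideal.Quotient.mk_surjective) fun p hp hle ↦
        h p hp (fun r hr ↦ hle ?_) fun x hx ↦ hle ?_
    · rw [RingHom.mem_ker, RingHom.comp_apply, Ideal.Quotient.eq_zero_iff_mem.mpr hr, map_zero]
    · exact Ideal.Quotient.eq_zero_iff_mem.mpr (hs hx)
  refine (ringKrullDim_le_ringKrullDim_quotient_add_card s fun a ha ↦ ?_).trans ?_
  · obtain ⟨x, hx, rfl⟩ : ∃ x ∈ xs, Ideal.Quotient.mk P x = a := by simpa [s] using ha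
    rw [IsLocalRing.ringJacobson_eq_maximalIdeal]
    exact mk_mem_maximalIdeal hPm (hmem x hx)
  · have h1 : ringKrullDim ((R ⧸ P) ⧸ Ideal.span (s : Set (R ⧸ P))) ≤ 0 :=
      Ring.krullDimLE_iff.mp h0
    have h2 : s.card ≤ xs.length := (List.toFinset_card_le _).trans (by simp)
    calc _ ≤ (0 : WithBot ℕ∞) + (s.card : WithBot ℕ∞) := add_le_add_left h1 _
      _ ≤ xs.length := by rw [zero_add]; exact_mod_cast h2

/-- A sequence of length at most the depth of `M` which generates an `𝔪`-primary ideal modulo the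
annihilator of `M` is `M`-regular. -/
lemma isWeaklyRegular_of_ext_subsingleton (xs : List R) {M : Type u} [AddCommGroup M] [Module R M]
    [Module.Finite R M] (hmem : ∀ x ∈ xs, x ∈ maximalIdeal R)
    (hext : ∀ i < xs.length, Subsingleton (ExtMod R (ResidueField R) M i))
    (h : ∀ p : Ideal R, p.IsPrime → Module.annihilator R M ≤ p → (∀ x ∈ xs, x ∈ p) →
      p = maximalIdeal R) : IsWeaklyRegular M xs := by
  induction xs generalizing M with
  | nil => exact .nil R M
  | cons x xs ih =>
    have hx : IsSMulRegular M x := by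
      by_contra hcon
      have hx' : x ∈ ⋃ p ∈ associatedPrimes R M, (p : Set R) := by
        rw [biUnion_associatedPrimes_eq_compl_regular]
        exact hcon
      simp only [Set.mem_iUnion] at hx'
      obtain ⟨P, hP, hxP⟩ := hx'
      have hP' : IsAssociatedPrime P M := hP
      have := hP'.isPrime
      have h1 := le_ringKrullDim_quotient_of_isAssociatedPrime _ hext hP'
      have h2 := h1.trans (ringKrullDim_quotient_le_length (xs := xs)
        (fun y hy ↦ hmem y (by simp [hy])) fun p hp hle hxs ↦ h p hp
          (le_trans (by rw [← Submodule.annihilator_top]; exact hP'.annihilator_le) hle)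
          (by simpa using ⟨hle hxP, hxs⟩))
      have h3 : (x :: xs).length ≤ xs.length := by exact_mod_cast h2
      simp at h3
    rw [isWeaklyRegular_cons_iff]
    refine ⟨hx, ih (fun y hy ↦ hmem y (by simp [hy])) (ext_quotSMulTop_subsingleton hx hext) ?_⟩
    intro p hp hle hxs
    refine h p hp (le_trans ?_ hle) ?_
    · exact LinearMap.annihilator_le_of_surjective (Submodule.mkQ _) (Submodule.mkQ_surjective _)
    · have : x ∈ p := hle (Module.mem_annihilator.mpr fun m ↦ by
        obtain ⟨m, rfl⟩ := Submodule.Quotient.mk_surjective _ m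
        rw [← Submodule.Quotient.mk_smul]
        exact (Submodule.Quotient.mk_eq_zero _).mpr
          (Submodule.smul_mem_pointwise_smul _ _ _ trivial))
      simpa using ⟨this, hxs⟩

omit [IsLocalRing R] [IsNoetherianRing R] in
lemma ofList_ofFn_take {d : ℕ} (x : Fin d → R) (i : Fin d) :
    Ideal.ofList ((List.ofFn x).take i) = Ideal.span (x '' {j | j < i}) := by
  refine congrArg Ideal.span (Set.ext fun r ↦ ?_)
  simp only [Set.mem_ofPred_eq, Set.mem_image, List.mem_take_iff_getElem, List.getElem_ofFn,
    List.length_ofFn]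
  constructor
  · rintro ⟨j, hj, rfl⟩
    exact ⟨⟨j, by lia⟩, Fin.lt_def.mpr (by simp; lia), rfl⟩
  · rintro ⟨j, hj, rfl⟩
    exact ⟨j, by have := j.2; have := Fin.lt_def.mp hj; lia, rfl⟩

omit [IsLocalRing R] [IsNoetherianRing R] in
lemma ofList_ofFn {d : ℕ} (x : Fin d → R) :
    Ideal.ofList (List.ofFn x) = Ideal.span (Set.range x) := by
  refine congrArg Ideal.span (Set.ext fun r ↦ ?_)
  simp

variable {rs : List R}

omit [IsNoetherianRing R] in
lemma IsGorensteinSequence.ext_residueField_subsingleton (h : IsGorensteinSequence R rs) :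
    ∀ i < rs.length, Subsingleton (ExtMod R (ResidueField R) R i) := fun _ hi ↦
  ext_subsingleton_of_isWeaklyRegular rs h.isWeaklyRegular
    (fun _ hr m ↦ maximalIdeal_smul_residueField (h.mem _ hr) m) hi

/-- Systems of parameters of a Gorenstein ring are regular sequences. -/
lemma IsGorensteinSequence.isWeaklyRegular_of_isSystemOfParameters (h : IsGorensteinSequence R rs)
    {d : ℕ} {x : Fin d → R} (hx : IsSystemOfParameters R x) :
    IsWeaklyRegular R (List.ofFn x) := by
  have hd : rs.length = d := by
    have := h.length_eq.symm.trans hx.dim_eq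
    exact_mod_cast this
  refine isWeaklyRegular_of_ext_subsingleton _ (by simpa using hx.mem) ?_ fun p hp _ hle ↦ ?_
  · rw [List.length_ofFn, ← hd]
    exact h.ext_residueField_subsingleton
  · refine le_antisymm (le_maximalIdeal hp.ne_top) ?_
    rw [← hx.radical_eq, hp.radical_le_iff, ← ofList_ofFn]
    exact Ideal.span_le.mpr hle

omit [IsLocalRing R] [IsNoetherianRing R] in
lemma ext_quotient_ofList_subsingleton (xs : List R) {M N : Type u} [AddCommGroup M]
    [Module R M] [AddCommGroup N] [Module R N] (hreg : IsWeaklyRegular M xs) {t : ℕ}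
    (h : ∀ i < t + xs.length, Subsingleton (ExtMod R N M i)) :
    ∀ i < t, Subsingleton (ExtMod R N (M ⧸ (Ideal.ofList xs • ⊤ : Submodule R M)) i) := by
  induction xs generalizing M with
  | nil =>
    intro i hi
    refine ext_congr_right (Submodule.quotEquivOfEqBot _ ?_).symm (h i (by simpa using hi))
    rw [Ideal.ofList_nil, Submodule.bot_smul]
  | cons x xs ih =>
    intro i hi
    rw [isWeaklyRegular_cons_iff] at hreg
    exact ext_congr_right (Submodule.quotOfListConsSMulTopEquivQuotSMulTopInner M x xs).symm
      (ih hreg.2 (ext_quotSMulTop_subsingleton hreg.1 h) i hi)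

/-- In a nonregular Gorenstein ring, prime avoidance provides a system of parameters which is part
of a minimal generating set of the maximal ideal. -/
lemma IsGorensteinSequence.exists_isSystemOfParameters (h : IsGorensteinSequence R rs)
    (hreg : ¬ IsRegularLocalRing R) :
    ∃ x : Fin rs.length → R, IsSystemOfParameters R x ∧
      ∀ i, x i ∉ maximalIdeal R ^ 2 ⊔ Ideal.span (x '' {j | j < i}) := by
  have key : ∀ t ≤ rs.length, ∃ xs : List R, xs.length = t ∧ (∀ x ∈ xs, x ∈ maximalIdeal R) ∧
      IsWeaklyRegular R xs ∧ ∀ (i : ℕ) (hi : i < xs.length),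
        xs[i] ∉ maximalIdeal R ^ 2 ⊔ Ideal.ofList (xs.take i) := by
    intro t
    induction t with
    | zero => exact fun _ ↦ ⟨[], rfl, by simp, .nil R R, by simp⟩
    | succ t ih =>
      intro ht
      obtain ⟨xs, rfl, hmem, hxs, hmin⟩ := ih (by lia)
      have hle : Ideal.ofList xs ≤ maximalIdeal R := Ideal.span_le.mpr hmem
      have hnt : Nontrivial (R ⧸ (Ideal.ofList xs • ⊤ : Submodule R R)) := by
        refine Submodule.Quotient.nontrivial_iff.mpr ?_
        rw [smul_eq_mul, Ideal.mul_top]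
        exact ne_top_of_le_ne_top (maximalIdeal.isMaximal R).ne_top hle
      obtain ⟨y, hy, hyreg, hyn⟩ := exists_isSMulRegular_notMem
        (I := maximalIdeal R ^ 2 ⊔ Ideal.ofList xs)
        (exists_isSMulRegular_of_subsingleton (ext_quotient_ofList_subsingleton xs hxs (t := 1)
          (fun i hi ↦ h.ext_residueField_subsingleton i (by lia)) 0 zero_lt_one)) <| by
        intro hcon
        refine hreg (.of_spanFinrank_maximalIdeal_le _ ?_)
        have h1 : maximalIdeal R ≤ Ideal.ofList xs :=
          Submodule.le_of_le_smul_of_le_jacobson_bot (I := maximalIdeal R)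
            (IsNoetherian.noetherian _) (IsLocalRing.maximalIdeal_le_jacobson _)
            (by rwa [smul_eq_mul, ← sq, sup_comm])
        rw [le_antisymm h1 hle, h.length_eq]
        have h2 := Submodule.spanFinrank_span_le_ncard_of_finite (R := R) xs.finite_toSet
        have h3 : {x | x ∈ xs}.ncard ≤ xs.length := by
          classical
          rw [← List.coe_toFinset, Set.ncard_coe_finset]
          exact List.toFinset_card_le _
        exact_mod_cast h2.trans (h3.trans (by lia))
      refine ⟨xs ++ [y], by simp, ?_, ?_, fun i hi ↦ ?_⟩
      · simpa [or_imp, forall_and] using ⟨hmem, hy⟩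
      · rw [isWeaklyRegular_append_iff]
        exact ⟨hxs, by simpa using hyreg⟩
      · rcases lt_or_eq_of_le (Nat.lt_succ_iff.mp (by simpa using hi)) with hi' | rfl
        · rw [List.getElem_append_left hi', List.take_append_of_le_length hi'.le]
          exact hmin i hi'
        · simpa using hyn
  obtain ⟨xs, hlen, hmem, hxs, hmin⟩ := key _ le_rfl
  obtain ⟨x, rfl⟩ : ∃ x : Fin rs.length → R, List.ofFn x = xs :=
    ⟨fun i ↦ xs[i], List.ext_getElem (by simp [hlen]) (by simp)⟩
  refine ⟨x, ⟨h.length_eq, by simpa using hmem, ?_⟩, fun i ↦ ?_⟩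
  · rw [← ofList_ofFn, Ideal.radical_eq_sInf]
    have hle : Ideal.ofList (List.ofFn x) ≤ maximalIdeal R := Ideal.span_le.mpr hmem
    have hdim : Ring.KrullDimLE 0 (R ⧸ Ideal.ofList (List.ofFn x)) := by
      have h1 := ringKrullDim_quotient_ofList hmem hxs
      rw [h.length_eq, hlen] at h1
      rw [Ring.krullDimLE_iff, ← ENat.WithBot.add_le_add_natCast_right_iff (c := rs.length), h1,
        Nat.cast_zero, zero_add]
    refine le_antisymm (sInf_le ⟨hle, inferInstance⟩) (le_sInf fun p ⟨hp, hpp⟩ ↦ ?_)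
    have hsurj := Ideal.Quotient.mk_surjective (I := Ideal.ofList (List.ofFn x))
    have h2 := Ideal.map_isPrime_of_surjective hsurj (I := p) (Ideal.mk_ker.trans_le hp)
    have h3 := Ideal.comap_isMaximal_of_surjective _ hsurj (K := p.map (Ideal.Quotient.mk _))
      (H := Ring.krullDimLE_zero_iff.mp hdim _ h2)
    rw [Ideal.comap_map_of_surjective _ hsurj, ← RingHom.ker_eq_comap_bot, Ideal.mk_ker,
      sup_eq_left.mpr hp] at h3
    exact (IsLocalRing.eq_maximalIdeal h3).ge
  · have := hmin i (by simp)
    rwa [ofList_ofFn_take, List.getElem_ofFn] at this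

end SystemsOfParameters

/-! ### Quotients by minimal systems of parameters -/

section MinimalSystems

/-- A regular sequence in the maximal ideal which is part of a minimal generating set of the
maximal ideal. Regularity is stated elementwise. -/
structure IsMinimalRegularSystem {R : Type u} [CommRing R] [IsLocalRing R] {d : ℕ}
    (x : Fin d → R) : Prop where
  mem : ∀ i, x i ∈ maximalIdeal R
  regular : ∀ i r, x i * r ∈ Ideal.span (x '' {j | j < i}) → r ∈ Ideal.span (x '' {j | j < i})
  notMem : ∀ i, x i ∉ maximalIdeal R ^ 2 ⊔ Ideal.span (x '' {j | j < i})

lemma mem_span_of_mul_mem_of_isWeaklyRegular {R : Type u} [CommRing R] {d : ℕ}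
    {x : Fin d → R} (h : IsWeaklyRegular R (List.ofFn x)) (i : Fin d) (r : R)
    (hr : x i * r ∈ Ideal.span (x '' {j | j < i})) : r ∈ Ideal.span (x '' {j | j < i}) := by
  have h1 := h.regular_mod_prev i (by simp)
  have h2 : (Ideal.ofList ((List.ofFn x).take i) • ⊤ : Submodule R R) =
      Ideal.span (x '' {j | j < i}) := by
    rw [ofList_ofFn_take, smul_eq_mul, Ideal.mul_top]
  rw [h2, List.getElem_ofFn] at h1
  refine (Submodule.Quotient.mk_eq_zero _).mp
    (isSMulRegular_iff_right_eq_zero_of_smul.mp h1 (Submodule.Quotient.mk r) ?_)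
  rw [← Submodule.Quotient.mk_smul]
  exact (Submodule.Quotient.mk_eq_zero _).mpr hr

variable {R S : Type u} [CommRing R] [IsLocalRing R]

lemma maximalIdeal_quotient_eq {I : Ideal R} [IsLocalRing (R ⧸ I)] (hI : I ≤ maximalIdeal R) :
    maximalIdeal (R ⧸ I) = (maximalIdeal R).map (Ideal.Quotient.mk I) := by
  have hle : (maximalIdeal R).map (Ideal.Quotient.mk I) ≤ maximalIdeal (R ⧸ I) :=
    Ideal.map_le_iff_le_comap.mpr fun _ hr ↦ mk_mem_maximalIdeal hI hr
  exact (IsLocalRing.eq_maximalIdeal ((Ideal.map_eq_top_or_isMaximal_of_surjective _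
    Ideal.Quotient.mk_surjective (maximalIdeal.isMaximal R)).resolve_left
      (ne_top_of_le_ne_top (maximalIdeal.isMaximal _).ne_top hle))).symm

omit [CommRing R] [IsLocalRing R] in
lemma image_succ_lt {α : Type*} {d : ℕ} (x : Fin (d + 1) → α) (i : Fin d) :
    x '' {j | j < i.succ} = insert (x 0) ((fun j : Fin d ↦ x j.succ) '' {j | j < i}) := by
  ext r
  simp only [Set.mem_image, Set.mem_ofPred_eq, Set.mem_insert_iff, Fin.exists_fin_succ,
    Fin.succ_pos, true_and, Fin.succ_lt_succ_iff, eq_comm]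

/-- The images of the remaining members of a minimal regular system modulo its first member. -/
lemma IsMinimalRegularSystem.tail {d : ℕ} {x : Fin (d + 1) → R} (hx : IsMinimalRegularSystem x)
    [IsLocalRing (R ⧸ Ideal.span {x 0})] :
    IsMinimalRegularSystem fun i : Fin d ↦ Ideal.Quotient.mk (Ideal.span {x 0}) (x i.succ) := by
  have hle : Ideal.span {x 0} ≤ maximalIdeal R :=
    (Ideal.span_singleton_le_iff_mem _).mpr (hx.mem 0)
  have hsurj := Ideal.Quotient.mk_surjective (I := Ideal.span {x 0})
  have hspan (i : Fin d) : Ideal.span ((fun i : Fin d ↦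
      Ideal.Quotient.mk (Ideal.span {x 0}) (x i.succ)) '' {j | j < i}) =
      (Ideal.span ((fun j : Fin d ↦ x j.succ) '' {j | j < i})).map
        (Ideal.Quotient.mk (Ideal.span {x 0})) := by
    rw [Ideal.map_span, ← Set.image_comp]
    rfl
  have hmap (J : Ideal R) (r : R) (hr : Ideal.Quotient.mk (Ideal.span {x 0}) r ∈
      J.map (Ideal.Quotient.mk (Ideal.span {x 0}))) : r ∈ J ⊔ Ideal.span {x 0} := by
    rwa [← Ideal.mem_comap, Ideal.comap_map_of_surjective _ hsurj, ← RingHom.ker_eq_comap_bot,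
      Ideal.mk_ker] at hr
  have hsucc (i : Fin d) : Ideal.span (x '' {j | j < i.succ}) =
      Ideal.span ((fun j : Fin d ↦ x j.succ) '' {j | j < i}) ⊔ Ideal.span {x 0} := by
    rw [image_succ_lt, Ideal.span_insert, sup_comm]
  have hmax : maximalIdeal (R ⧸ Ideal.span {x 0}) =
      (maximalIdeal R).map (Ideal.Quotient.mk (Ideal.span {x 0})) := maximalIdeal_quotient_eq hle
  refine ⟨fun i ↦ mk_mem_maximalIdeal hle (hx.mem _), fun i r hr ↦ ?_, fun i hi ↦ ?_⟩
  · obtain ⟨r, rfl⟩ := hsurj r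
    rw [hspan] at hr ⊢
    rw [← map_mul] at hr
    have h1 := hmap _ _ hr
    rw [← hsucc] at h1
    have h2 := Ideal.mem_map_of_mem (Ideal.Quotient.mk (Ideal.span {x 0})) (hx.regular _ _ h1)
    rwa [hsucc, Ideal.map_sup, Ideal.map_quotient_self, sup_bot_eq] at h2
  · rw [hspan, hmax, ← Ideal.map_pow, ← Ideal.map_sup] at hi
    have h1 := hmap _ _ hi
    rw [sup_assoc, ← hsucc] at h1
    exact hx.notMem _ h1

/-- The surjections `Ω_R^n k → Ω_{R/x}^n k` compose along a minimal regular system. -/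
lemma IsMinimalRegularSystem.exists_syzygy_map [IsNoetherianRing R] {d : ℕ} {x : Fin (d + 1) → R}
    (hx : IsMinimalRegularSystem x) [CommRing S] [IsLocalRing S] [IsNoetherianRing S]
    (σ : R →+* S) (hσ : Function.Surjective σ) (hker : RingHom.ker σ = Ideal.span (Set.range x))
    (n : ℕ) :
    ∃ π : syzygy R n (ModuleCat.of R (ResidueField R)) →ₛₗ[σ]
      syzygy S n (ModuleCat.of S (ResidueField S)),
      Function.Surjective π ∧ FinPD R (LinearMap.ker π) := by
  have hreg : IsSMulRegular R (x 0) := by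
    refine isSMulRegular_iff_right_eq_zero_of_smul.mpr fun r hr ↦ ?_
    simpa using hx.regular 0 r (by rw [← smul_eq_mul, hr]; exact zero_mem _)
  have hx0 : x 0 ∉ maximalIdeal R ^ 2 := fun h ↦ hx.notMem 0 (Ideal.mem_sup_left h)
  induction d generalizing R with
  | zero =>
    let _ := σ.toAlgebra
    refine exists_syzygy_residueField_map (S := S) ⟨hx.mem 0, hreg, hσ, fun r ↦ ?_⟩ hx0 n
    have h1 : Set.range x = {x 0} := by
      ext r
      simp [Fin.exists_fin_one, eq_comm]
    rw [← Ideal.mem_span_singleton, ← h1, ← hker]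
    exact RingHom.mem_ker.symm
  | succ d ih =>
    have hS := isQuotientByRegular_quotient (hx.mem 0) hreg
    have := isLocalRing_quotient ((Ideal.span_singleton_le_iff_mem _).mpr (hx.mem 0))
    let σ' : R ⧸ Ideal.span {x 0} →+* S := Ideal.Quotient.lift _ σ fun r hr ↦ by
      have : Ideal.span {x 0} ≤ RingHom.ker σ := by
        rw [hker]
        exact Ideal.span_mono (by simp)
      exact this hr
    have hσ'σ (r : R) : σ' (Ideal.Quotient.mk _ r) = σ r := rfl
    have hσ' : Function.Surjective σ' := Ideal.Quotient.lift_surjective_of_surjective _ _ hσ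
    have hker' : RingHom.ker σ' = Ideal.span (Set.range fun i : Fin (d + 1) ↦
        Ideal.Quotient.mk (Ideal.span {x 0}) (x i.succ)) := by
      have h0 : Set.range x = insert (x 0) (Set.range fun i : Fin (d + 1) ↦ x i.succ) := by
        ext r
        simp [Fin.exists_fin_succ, eq_comm]
      have h1 : Ideal.Quotient.mk (Ideal.span {x 0}) (x 0) = 0 :=
        Ideal.Quotient.eq_zero_iff_mem.mpr (Ideal.mem_span_singleton_self _)
      rw [Ideal.ker_quotient_lift, hker, Ideal.map_span, h0, Set.image_insert_eq,
        Ideal.span_insert, h1, Ideal.span_singleton_eq_bot.mpr rfl, bot_sup_eq, ← Set.range_comp]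
      rfl
    have hx' := hx.tail
    obtain ⟨π', h1, h2⟩ := ih hx' σ' hσ' hker'
      (isSMulRegular_iff_right_eq_zero_of_smul.mpr fun r hr ↦ by
        simpa using hx'.regular 0 r (by rw [← smul_eq_mul, hr]; exact zero_mem _))
      (fun h ↦ hx'.notMem 0 (Ideal.mem_sup_left h))
    obtain ⟨φ, h3, h4⟩ := exists_syzygy_residueField_map hS hx0 n
    let π : syzygy R n (ModuleCat.of R (ResidueField R)) →ₛₗ[σ]
        syzygy S n (ModuleCat.of S (ResidueField S)) :=
      { toFun := fun a ↦ π' (φ a)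
        map_add' := fun a b ↦ by rw [map_add, map_add]
        map_smul' := fun r a ↦ by rw [map_smulₛₗ, map_smulₛₗ]; rfl }
    refine ⟨π, h1.comp h3, ?_⟩
    let _ : Module R (LinearMap.ker π') := Module.compHom _ (algebraMap R (R ⧸ Ideal.span {x 0}))
    have : IsScalarTower R (R ⧸ Ideal.span {x 0}) (LinearMap.ker π') :=
      ⟨fun r s v ↦ by
        rw [Algebra.smul_def, mul_smul]; rfl⟩
    have h5 : FinPD R (LinearMap.ker π') := hS.finPD_of_finPD _ h2
    let ρ : LinearMap.ker π →ₗ[R] LinearMap.ker π' :=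
      { toFun := fun a ↦ ⟨φ a.1, a.2⟩
        map_add' := fun a b ↦ Subtype.ext (map_add φ a.1 b.1)
        map_smul' := fun r a ↦ Subtype.ext (map_smulₛₗ φ r a.1) }
    refine FinPD.of_ker (g := ρ) (fun ⟨b, hb⟩ ↦ ?_) ?_ h5
    · obtain ⟨a, rfl⟩ := h3 b
      exact ⟨⟨a, hb⟩, rfl⟩
    · let e : LinearMap.ker φ ≃ₗ[R] LinearMap.ker ρ :=
        { toFun := fun a ↦ ⟨⟨a.1, (congrArg π' a.2).trans (map_zero π')⟩, Subtype.ext a.2⟩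
          map_add' := fun _ _ ↦ rfl
          map_smul' := fun _ _ ↦ rfl
          invFun := fun a ↦ ⟨a.1.1, congrArg Subtype.val a.2⟩
          left_inv := fun _ ↦ rfl
          right_inv := fun _ ↦ rfl }
      exact h4.congr e

end MinimalSystems

/-! ### The approximations of the two modules -/

section Conclusion

variable {R : Type u} [CommRing R] [IsLocalRing R]

lemma HasApprox.syzygy [IsNoetherianRing R] {rs : List R} (hR : IsWeaklyRegular R rs) {j : ℕ}
    (n : ℕ) {M : ModuleCat.{u} R} [Module.Finite R M] (h : HasApprox R rs j M) :
    HasApprox R rs (j + n) (syzygy R n M) := by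
  induction n generalizing M j with
  | zero => exact h
  | succ n ih =>
    obtain ⟨ι, _, f, hf, ⟨e⟩⟩ := exists_isMinimalCover_firstSyzygy M
    have h1 : HasApprox R rs (j + 1) (firstSyzygy R M) :=
      (h.ker hR .of_projective hf.surjective).congr e.symm
    have h2 := ih h1
    rwa [add_assoc, add_comm 1] at h2

lemma IsGorensteinSequence.hasApprox_residueField [IsNoetherianRing R] {rs : List R}
    (h : IsGorensteinSequence R rs) (j : ℕ) : HasApprox R rs j (ResidueField R) := by
  have hle : Ideal.ofList rs ≤ maximalIdeal R := Ideal.span_le.mpr h.mem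
  exact (h.hasApprox j ((R ⧸ Ideal.ofList rs) ⧸
    (maximalIdeal R).map (Ideal.Quotient.mk (Ideal.ofList rs)))).congr
      (DoubleQuot.quotQuotEquivQuotOfLEₐ R hle).toLinearEquiv

/-- Over a nonregular ring, the syzygies of the residue field do not vanish. -/
lemma nontrivial_syzygy_residueField [IsNoetherianRing R] (hreg : ¬ IsRegularLocalRing R) (n : ℕ) :
    Nontrivial (syzygy R n (ModuleCat.of R (ResidueField R))) := by
  induction n with
  | zero => exact (inferInstance : Nontrivial (ResidueField R))
  | succ n ih =>
    rw [syzygy_succ_eq]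
    by_contra hcon
    rw [not_nontrivial_iff_subsingleton] at hcon
    obtain ⟨ι, _, f, hf, ⟨e⟩⟩ := exists_isMinimalCover_firstSyzygy
      (syzygy R n (ModuleCat.of R (ResidueField R)))
    have hinj : Function.Injective f := by
      rw [← LinearMap.ker_eq_bot, ← Submodule.subsingleton_iff_eq_bot]
      exact e.symm.toEquiv.subsingleton
    let E := LinearEquiv.ofBijective f ⟨hinj, hf.surjective⟩
    rcases isEmpty_or_nonempty ι with hι | ⟨⟨i⟩⟩
    · exact not_subsingleton _ E.symm.toEquiv.subsingleton
    · exact hreg (isRegularLocalRing_of_surjective R n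
        ((LinearMap.proj i : (ι → R) →ₗ[R] R) ∘ₗ E.symm.toLinearMap)
        (surjective_of_isUnit _ (x := E fun _ ↦ 1) (by simp)))

/-- If `M` had finite projective dimension, then so would `X`, which would therefore be free. -/
lemma not_finPD_of_not_surjective [IsNoetherianRing R] {X M : Type u} [AddCommGroup X] [Module R X]
    [AddCommGroup M] [Module R M] [Module.Finite R X] [Nontrivial X]
    (hX : ∀ i, Subsingleton (ExtMod R X R (i + 1))) {q : X →ₗ[R] M} (hq : Function.Surjective q)
    (hk : FinPD R (LinearMap.ker q)) (hns : ∀ f : X →ₗ[R] R, ¬ Function.Surjective f) :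
    ¬ FinPD R M := by
  intro hM
  have : Module.Projective R X := projective_of_finPD hX (FinPD.of_ker hq hk hM)
  have : Module.Free R X := Module.free_of_flat_of_isLocalRing
  let b := Module.Free.chooseBasis R X
  rcases isEmpty_or_nonempty (Module.Free.ChooseBasisIndex R X) with h | ⟨⟨i⟩⟩
  · exact not_subsingleton X b.repr.toEquiv.subsingleton
  · exact hns (b.coord i) (surjective_of_isUnit _ (x := b i) (by simp))

lemma isFiniteLength_quotientResidueSyzygy [IsNoetherianRing R] {d : ℕ} {x : Fin d → R}
    (hx : IsSystemOfParameters R x) (n : ℕ) :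
    IsFiniteLength R (quotientResidueSyzygy R (Ideal.span (Set.range x)) n) := by
  set I := Ideal.span (Set.range x)
  have hI : I ≤ maximalIdeal R := Ideal.span_le.mpr (by rintro _ ⟨i, rfl⟩; exact hx.mem i)
  have := isLocalRing_quotient hI
  have h0 : Ring.KrullDimLE 0 (R ⧸ I) :=
    krullDimLE_zero_of_surjective (Ideal.Quotient.mk I) Ideal.Quotient.mk_surjective
      fun p hp hle ↦ le_antisymm (le_maximalIdeal hp.ne_top) (by
        rw [← hx.radical_eq, hp.radical_le_iff]
        exact Ideal.mk_ker.symm.trans_le hle)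
  have : IsArtinianRing (R ⧸ I) :=
    isArtinianRing_iff_isNoetherianRing_krullDimLE_zero.mpr ⟨inferInstance, h0⟩
  let V : ModuleCat.{u} (R ⧸ I) :=
    ModuleCat.of (R ⧸ I) ((R ⧸ I) ⧸ (maximalIdeal R).map (Ideal.Quotient.mk I))
  let W := syzygy (R ⧸ I) n V
  let _ : Module R W := Module.compHom W (algebraMap R (R ⧸ I))
  have : IsScalarTower R (R ⧸ I) W := ⟨fun r s v ↦ by rw [Algebra.smul_def, mul_smul]; rfl⟩
  have : Module.Finite R W := Module.Finite.trans (R ⧸ I) W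
  have : IsArtinian R W :=
    isArtinian_of_surjective_algebraMap (S := R) (R := R ⧸ I) Ideal.Quotient.mk_surjective
  exact (isFiniteLength_iff_isNoetherian_isArtinian (R := R) (M := W)).mpr
    ⟨inferInstance, this⟩

/-- A minimal approximation of `Ω_R^{d-1} k` remains minimal when it is composed with a surjection
whose kernel has finite projective dimension. -/
theorem IsGorensteinSequence.isoMinimalMCM {rs : List R} [IsNoetherianRing R]
    (h : IsGorensteinSequence R rs) {n : ℕ} (hn : rs.length = n + 1)
    (hreg : ¬ IsRegularLocalRing R) {M : ModuleCat.{u} R}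
    {π : syzygy R n (ModuleCat.of R (ResidueField R)) →ₗ[R] M} (hπ : Function.Surjective π)
    (hk : FinPD R (LinearMap.ker π)) :
    projectiveDimension M = ⊤ ∧
      IsoMinimalMCM M (syzygy R n (ModuleCat.of R (ResidueField R))) := by
  obtain ⟨X, p, hp⟩ := h.exists_isMinimalMCMApproximation (by lia)
    (HasApprox.syzygy (M := ModuleCat.of R (ResidueField R)) h.isWeaklyRegular n
      (h.hasApprox_residueField rs.length))
  have := hp.isMCM.finite
  have hX := h.ext_subsingleton_of_isMCM hp.isMCM
  have hns := not_surjective_of_minimal_syzygy h hn hreg hp.surjective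
    hp.projectiveDimension_ker_ne_top hX fun f y hy ↦ apply_ne_one_of_minimal hp.minimal f hy
  have hqk : FinPD R (LinearMap.ker (π ∘ₗ p)) := by
    let ρ : LinearMap.ker (π ∘ₗ p) →ₗ[R] LinearMap.ker π :=
      (p ∘ₗ (LinearMap.ker (π ∘ₗ p)).subtype).codRestrict _ fun a ↦ a.2
    let e : LinearMap.ker p ≃ₗ[R] LinearMap.ker ρ :=
      { toFun := fun a ↦ ⟨⟨a.1, (congrArg π a.2).trans (map_zero π)⟩, Subtype.ext a.2⟩
        map_add' := fun _ _ ↦ rfl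
        map_smul' := fun _ _ ↦ rfl
        invFun := fun a ↦ ⟨a.1.1, congrArg Subtype.val a.2⟩
        left_inv := fun _ ↦ rfl
        right_inv := fun _ ↦ rfl }
    refine FinPD.of_ker (g := ρ) (fun ⟨b, hb⟩ ↦ ?_)
      (FinPD.congr e hp.projectiveDimension_ker_ne_top) hk
    obtain ⟨a, rfl⟩ := hp.surjective b
    exact ⟨⟨a, hb⟩, rfl⟩
  have hq : IsMinimalMCMApproximation (π ∘ₗ p) :=
    { isMCM := hp.isMCM
      surjective := hπ.comp hp.surjective
      projectiveDimension_ker_ne_top := hqk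
      minimal := fun φ hφ ↦ bijective_of_comp_eq hX hqk
        (fun f y _ hfy ↦ hns f (surjective_of_isUnit f (x := y) (hfy ▸ isUnit_one))) hφ }
  refine ⟨?_, ⟨X, _, hq⟩, ⟨X, p, hp⟩, fun X' Y' p' q' hp' hq' ↦ ?_⟩
  · have := nontrivial_syzygy_residueField hreg n
    have := hp.surjective.nontrivial
    by_contra hcon
    exact not_finPD_of_not_surjective hX hq.surjective hqk hns hcon
  · obtain ⟨e⟩ := h.nonempty_linearEquiv hp' hq
    obtain ⟨e'⟩ := h.nonempty_linearEquiv hp hq'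
    exact ⟨e.trans e'⟩

/-- The surjection of `IsMinimalRegularSystem.exists_syzygy_map`, as a map of `R`-modules to the
syzygy of the residue field `R'/𝔪R'`. -/
lemma exists_map_quotientResidueSyzygy [IsNoetherianRing R] {d : ℕ} {x : Fin (d + 1) → R}
    (hx : IsMinimalRegularSystem x) (n : ℕ) :
    ∃ π : syzygy R n (ModuleCat.of R (ResidueField R)) →ₗ[R]
      quotientResidueSyzygy R (Ideal.span (Set.range x)) n,
      Function.Surjective π ∧ FinPD R (LinearMap.ker π) := by
  set I := Ideal.span (Set.range x)
  have hI : I ≤ maximalIdeal R := Ideal.span_le.mpr (by rintro _ ⟨i, rfl⟩; exact hx.mem i)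
  have := isLocalRing_quotient hI
  obtain ⟨π, h1, h2⟩ := hx.exists_syzygy_map (Ideal.Quotient.mk I) Ideal.Quotient.mk_surjective
    Ideal.mk_ker n
  obtain ⟨e⟩ := syzygy_congr n (M := ModuleCat.of (R ⧸ I) (ResidueField (R ⧸ I)))
    (M' := ModuleCat.of (R ⧸ I) ((R ⧸ I) ⧸ (maximalIdeal R).map (Ideal.Quotient.mk I)))
    (Submodule.quotEquivOfEq _ _ (maximalIdeal_quotient_eq hI))
  let π' : syzygy R n (ModuleCat.of R (ResidueField R)) →ₗ[R] quotientResidueSyzygy R I n :=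
    { toFun := fun a ↦ e (π a)
      map_add' := fun a b ↦ by rw [map_add, map_add]; rfl
      map_smul' := fun r a ↦ by
        rw [map_smulₛₗ, map_smul]; rfl }
  refine ⟨π', e.surjective.comp h1, h2.congr (LinearEquiv.ofEq _ _ ?_)⟩
  ext a
  exact (e.map_eq_zero_iff (x := π a)).symm

end Conclusion

theorem proposition2p6 (R : Type u) [CommRing R] [IsGorensteinLocalRing R]
    (hreg : ¬ IsRegularLocalRing R) (d : ℕ) (hd : 0 < d) (hdim : ringKrullDim R = d) :
    (∃ M : ModuleCat.{u} R, projectiveDimension M = ⊤ ∧ IsFiniteLength R M ∧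
      IsoMinimalMCM M (syzygy R (d - 1) (ModuleCat.of R (ResidueField R)))) ∧
    (∃ x : Fin d → R, IsSystemOfParameters R x ∧
      ∀ i, x i ∉ maximalIdeal R ^ 2 ⊔ Ideal.span (x '' {j | j < i})) ∧
    (∀ x : Fin d → R, IsSystemOfParameters R x →
      (∀ i, x i ∉ maximalIdeal R ^ 2 ⊔ Ideal.span (x '' {j | j < i})) →
      projectiveDimension (quotientResidueSyzygy R (Ideal.span (Set.range x)) (d - 1)) = ⊤ ∧
      IsFiniteLength R (quotientResidueSyzygy R (Ideal.span (Set.range x)) (d - 1)) ∧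
      IsoMinimalMCM (quotientResidueSyzygy R (Ideal.span (Set.range x)) (d - 1))
        (syzygy R (d - 1) (ModuleCat.of R (ResidueField R)))) := by
  obtain ⟨rs, h⟩ := exists_isGorensteinSequence R hdim
  obtain ⟨n, rfl⟩ : ∃ n, d = n + 1 := Nat.exists_eq_add_one.mpr hd
  have hn : rs.length = n + 1 := by
    have := h.length_eq.symm.trans hdim
    exact_mod_cast this
  have h3 (x : Fin (n + 1) → R) (hx : IsSystemOfParameters R x)
      (hmin : ∀ i, x i ∉ maximalIdeal R ^ 2 ⊔ Ideal.span (x '' {j | j < i})) :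
      projectiveDimension (quotientResidueSyzygy R (Ideal.span (Set.range x)) n) = ⊤ ∧
      IsFiniteLength R (quotientResidueSyzygy R (Ideal.span (Set.range x)) n) ∧
      IsoMinimalMCM (quotientResidueSyzygy R (Ideal.span (Set.range x)) n)
        (syzygy R n (ModuleCat.of R (ResidueField R))) := by
    obtain ⟨π, hπ, hk⟩ := exists_map_quotientResidueSyzygy
      ⟨hx.mem, mem_span_of_mul_mem_of_isWeaklyRegular
        (h.isWeaklyRegular_of_isSystemOfParameters hx), hmin⟩ n
    obtain ⟨h1, h2⟩ := h.isoMinimalMCM hn hreg hπ hk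
    exact ⟨h1, isFiniteLength_quotientResidueSyzygy hx n, h2⟩
  have h2 := h.exists_isSystemOfParameters hreg
  rw [hn] at h2
  obtain ⟨x, hx, hmin⟩ := h2
  exact ⟨⟨_, h3 x hx hmin⟩, ⟨x, hx, hmin⟩, h3⟩
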